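/- Let $\mathbb F$ be a field and let $\mathrm{GL}(\mathbb F^2)\times\mathrm{GL}(\mathbb F^3)$ act on $\mathbb F^2\otimes\mathbb F^3$ by $(g,h)(a\otimes b)=ga\otimes hb$, and hence on the points, lines and planes of $\mathrm{PG}(\mathbb F^2\otimes\mathbb F^3)$ (the linear subspaces of dimension $1,2,3$). Identify $\mathbb F^2\otimes\mathbb F^3$ with the $2\times3$ matrices by $\sum_{i,j} m_{ij}\,e_i\otimes e_j\leftrightarrow(m_{ij})$. Let $\sigma$ be the Segre embedding $(\langle a\rangle,\langle b\rangle)\mapsto\langle a\otimes b\rangle$ and $S_{2,3}$ its image. A line on $S_{2,3}$ is of the first kind if it is $\sigma(x\times\ell)$ with $x$ a point of $\mathrm{PG}(\mathbb F^2)$ and $\ell$ a line of $\mathrm{PG}(\mathbb F^3)$, and of the second kind if it is $\sigma(\mathrm{PG}(\mathbb F^2)\times y)$ with $y$ a point of $\mathrm{PG}(\mathbb F^3)$. Each symbol below stands for the set of all subspaces equivalent to one of the listed form ($x,y,z$ run over $\mathbb F$; rows are separated by semicolons). It is followed by the intersection of every such subspace with $S_{2,3}$, and by its minimal size $m\times n$: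 there are subspaces $A\le\mathbb F^2$, $B\le\mathbb F^3$ of dimensions $m,n$ such that $A\otimes B$ contains the subspace, and $m\le\dim A'$, $n\le\dim B'$ whenever $A'\otimes B'$ contains it. Condition (Q) is: $v\ne0$ and $v\lambda^2+uv\lambda-1\neq0$ for all $\lambda\in\mathbb F$. Condition (C) is: $\lambda^3+\gamma\lambda^2-\beta\lambda+\alpha\ne0$ for all $\lambda\in\mathbb F$. Points: - $o_1$: $[x,0,0;0,0,0]$; a point; $1\times1$. - $o_4$: $[x,0,0;0,x,0]$; $\emptyset$; $2\times2$. Lines: - $o_2$: $[x,y,0;0,0,0]$; a line of the first kind; $1\times2$. - $o_4^T$: $[x,0,0;y,0,0]$; a line of the second kind; $2\times1$. - $o_5$: $[x,0,0;0,y,0]$; two points; $2\times2$. - $o_6$: $[x,0,0;y,x,0]$; one point; $2\times2$. - $o_7$: $[x,y,0;0,0,x]$; one point; $2\times3$. - $o_{10}$: $[x,ux+y,0;vy,x,0]$ for some $u,v$ satisfying (Q); $\emptyset$; $2\times2$. - $o_{11}$: $[x,y,0;0,x,y]$; $\emptyset$; $2\times3$. Planes: - $o_3$: $[x,y,z;0,0,0]$;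 a plane $\sigma(x_0\times\mathrm{PG}(\mathbb F^3))$ for a point $x_0$ of $\mathrm{PG}(\mathbb F^2)$; $1\times3$. - $o_7^T$: $[z,0,0;x,y,0]$; the union of a line of the first kind and a line of the second kind meeting in a point; $2\times2$. - $o_8$: $[x,0,0;0,y,z]$; a line of the first kind and a point not on it; $2\times3$. - $o_9$: $[z,0,0;x,y,z]$; a line of the first kind; $2\times3$. - $o_{11}^T$: $[x,y,0;y,z,0]$; a nondegenerate conic of the plane (with equation $c_0c_2=c_1^2$ in suitable coordinates); $2\times2$. - $o_{12}$: $[x,y,0;0,z,x]$; a line of the second kind; $2\times3$. - $o_{13}$: $[x,y,0;0,x,z]$; two points; $2\times3$. - $o_{14}$: $[x,y,0;0,y,z]$; three points; $2\times3$. - $o_{15}$: $[x,ux+y,z;vy,x,0]$ for some $u,v$ satisfying (Q); one point, and the plane contains a line of $o_{10}$; $2\times3$. - $o_{16}$: $[x,y,z;0,x,y]$; one point, and the plane contains a line of $o_{11}$; $2\times3$. - $o_{17}$: $[x,y,z;\alpha z,x+\beta z,y+\gamma z]$ for some $\alpha,\beta,\gamma$ satisfying (C); $\emptyset$; $2\times3$.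 (1) If $\mathbb F$ is algebraically closed, there are exactly $2$ orbits of points, $6$ orbits of lines and $9$ orbits of planes in $\mathrm{PG}(\mathbb F^2\otimes\mathbb F^3)$. The sets $o_{10}$, $o_{15}$, $o_{17}$ are empty, each of the other sets above is a single orbit, every point, line and plane lies in exactly one of the sets, and the stated intersections and minimal sizes hold. (2) If $\mathbb F=\mathbb R$, there are exactly $2$ orbits of points, $7$ orbits of lines and $10$ orbits of planes. The set $o_{17}$ is empty, each of the other sets above is a single orbit, every point, line and plane lies in exactly one of the sets, and the stated intersections and minimal sizes hold. -/

import Mathlib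

open scoped TensorProduct

namespace SegreOrbits

/-- The tensor product space `F² ⊗ F³`. -/
abbrev V (F : Type*) [Field F] : Type _ := (Fin 2 → F) ⊗[F] (Fin 3 → F)

/-- The subspaces of projective dimension `d` of the projective space `PG(F² ⊗ F³)`: the linear
subspaces of `F² ⊗ F³` of dimension `d + 1`. Points, lines and planes are the cases `d = 0, 1, 2`. -/
abbrev PG (F : Type*) [Field F] (d : ℕ) : Type _ :=
  {U : Submodule F (V F) // Module.finrank F U = d + 1}

/-- The group `GL(F²) × GL(F³)`. -/
abbrev H2 (F : Type*) [Field F] : Type _ :=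
  ((Fin 2 → F) ≃ₗ[F] (Fin 2 → F)) × ((Fin 3 → F) ≃ₗ[F] (Fin 3 → F))

/-- The linear action on `F² ⊗ F³`, determined by `(g, h) (a ⊗ b) = g a ⊗ h b`. -/
noncomputable def act {F : Type*} [Field F] (g : H2 F) : V F ≃ₗ[F] V F :=
  TensorProduct.congr g.1 g.2

theorem act_one {F : Type*} [Field F] :
    ((act (1 : H2 F)) : V F →ₗ[F] V F) = LinearMap.id := by
  ext a b
  simp [act]

theorem act_mul {F : Type*} [Field F] (g h : H2 F) :
    ((act (g * h)) : V F →ₗ[F] V F) =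
      ((act g) : V F →ₗ[F] V F) ∘ₗ ((act h) : V F →ₗ[F] V F) := by
  ext a b
  simp [act]

/-- The induced action on the projective subspaces of dimension `d`, by taking images. Its orbits
are the orbits of the projective group induced by `GL(F²) × GL(F³)`. -/
noncomputable instance instMulActionPG {F : Type*} [Field F] {d : ℕ} :
    MulAction (H2 F) (PG F d) where
  smul g U := ⟨U.1.map ((act g) : V F →ₗ[F] V F),
    (LinearEquiv.finrank_map_eq (act g) U.1).trans U.2⟩
  one_smul U := Subtype.ext (by
    change U.1.map _ = U.1
    rw [act_one, Submodule.map_id])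
  mul_smul g h U := Subtype.ext (by
    change U.1.map _ = (U.1.map _).map _
    rw [act_mul, Submodule.map_comp])

/-- The number of orbits of `GL(F²) × GL(F³)` on projective subspaces of dimension `d`
(`0` if there are infinitely many). -/
noncomputable def numOrbits (F : Type*) [Field F] (d : ℕ) : ℕ :=
  Nat.card (MulAction.orbitRel.Quotient (H2 F) (PG F d))

/-! ### The Segre variety -/

/-- `σ(PG(A) × PG(B))`: the points `⟨a ⊗ b⟩` with nonzero `a ∈ A`, `b ∈ B`. -/
def segreSub {F : Type*} [Field F] (A : Submodule F (Fin 2 → F)) (B : Submodule F (Fin 3 → F)) :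
    Set (PG F 0) :=
  {p | ∃ a ∈ A, ∃ b ∈ B, a ≠ 0 ∧ b ≠ 0 ∧ p.1 = Submodule.span F {a ⊗ₜ[F] b}}

/-- The Segre variety `S_{2,3}`. -/
def segre (F : Type*) [Field F] : Set (PG F 0) := segreSub ⊤ ⊤

/-- The intersection of a projective subspace with the Segre variety. -/
def meet {F : Type*} [Field F] {d : ℕ} (U : PG F d) : Set (PG F 0) :=
  {p | p ∈ segre F ∧ p.1 ≤ U.1}

/-- A line `σ(x × ℓ)`, for a point `x` of `PG(F²)` and a line `ℓ` of `PG(F³)`. -/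
def IsLineFirstKind {F : Type*} [Field F] (S : Set (PG F 0)) : Prop :=
  ∃ (A : Submodule F (Fin 2 → F)) (B : Submodule F (Fin 3 → F)),
    Module.finrank F A = 1 ∧ Module.finrank F B = 2 ∧ S = segreSub A B

/-- A line `σ(PG(F²) × y)`, for a point `y` of `PG(F³)`. -/
def IsLineSecondKind {F : Type*} [Field F] (S : Set (PG F 0)) : Prop :=
  ∃ B : Submodule F (Fin 3 → F), Module.finrank F B = 1 ∧ S = segreSub ⊤ B

/-- A plane `σ(x × PG(F³))`, for a point `x` of `PG(F²)`. -/
def IsSegrePlane {F : Type*} [Field F] (S : Set (PG F 0)) : Prop :=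
  ∃ A : Submodule F (Fin 2 → F), Module.finrank F A = 1 ∧ S = segreSub A ⊤

/-- `S` is a nondegenerate conic of the plane `PG(U)`: in suitable projective coordinates
`(c₀ : c₁ : c₂)` of the plane it has the equation `c₀ c₂ = c₁²`. -/
def IsConicOf {F : Type*} [Field F] (U : PG F 2) (S : Set (PG F 0)) : Prop :=
  ∃ φ : (Fin 3 → F) ≃ₗ[F] U.1, S = {p | ∃ c : Fin 3 → F, c ≠ 0 ∧ c 0 * c 2 = c 1 ^ 2 ∧
    p.1 = Submodule.span F {(φ c : V F)}}

/-- `A ⊗ B` as a subspace of `F² ⊗ F³`, i.e. the span of `σ(PG(A) × PG(B))`. -/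
def tensorSub {F : Type*} [Field F] (A : Submodule F (Fin 2 → F))
    (B : Submodule F (Fin 3 → F)) : Submodule F (V F) :=
  Submodule.span F {t | ∃ a ∈ A, ∃ b ∈ B, t = a ⊗ₜ[F] b}

/-- The minimal Segre subvariety `σ(PG(A) × PG(B))` of `S_{2,3}` whose span contains `U` is an
`S_{m,n}`, where `m = dim A`, `n = dim B`. -/
def HasMinSegre {F : Type*} [Field F] {d : ℕ} (U : PG F d) (mn : ℕ × ℕ) : Prop :=
  (∃ (A : Submodule F (Fin 2 → F)) (B : Submodule F (Fin 3 → F)),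
    Module.finrank F A = mn.1 ∧ Module.finrank F B = mn.2 ∧ U.1 ≤ tensorSub A B) ∧
  ∀ (A : Submodule F (Fin 2 → F)) (B : Submodule F (Fin 3 → F)), U.1 ≤ tensorSub A B →
    mn.1 ≤ Module.finrank F A ∧ mn.2 ≤ Module.finrank F B

/-! ### Representatives -/

/-- The tensor `∑ M i j • (e_i ⊗ e_j)` with coordinate matrix `M`. -/
noncomputable def tens {F : Type*} [Field F] (M : Matrix (Fin 2) (Fin 3) F) : V F :=
  ∑ i, ∑ j, M i j • ((Pi.single i 1 : Fin 2 → F) ⊗ₜ[F] (Pi.single j 1 : Fin 3 → F))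

/-- The subspace of all tensors with coordinate matrix `M x`, for a linear family `M`. -/
noncomputable def rep1 {F : Type*} [Field F] (M : F → Matrix (Fin 2) (Fin 3) F) :
    Submodule F (V F) :=
  Submodule.span F {t | ∃ x, t = tens (M x)}

/-- The subspace of all tensors with coordinate matrix `M x y`, for a linear family `M`. -/
noncomputable def rep2 {F : Type*} [Field F] (M : F → F → Matrix (Fin 2) (Fin 3) F) :
    Submodule F (V F) :=
  Submodule.span F {t | ∃ x y, t = tens (M x y)}

/-- The subspace of all tensors with coordinate matrix `M x y z`, for a linear family `M`. -/
noncomputable def rep3 {F : Type*} [Field F] (M : F → F → F → Matrix (Fin 2) (Fin 3) F) :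
    Submodule F (V F) :=
  Submodule.span F {t | ∃ x y z, t = tens (M x y z)}

/-- The condition on the parameters of `o₁₀` and `o₁₅`: `v λ² + u v λ - 1` is a quadratic
polynomial without roots in `F`. -/
def QuadCond {F : Type*} [Field F] (u v : F) : Prop :=
  v ≠ 0 ∧ ∀ l : F, v * l ^ 2 + u * v * l - 1 ≠ 0

/-- The condition on the parameters of `o₁₇`: `λ³ + γ λ² - β λ + α` has no root in `F`. -/
def CubicCond {F : Type*} [Field F] (α β γ : F) : Prop :=
  ∀ l : F, l ^ 3 + γ * l ^ 2 - β * l + α ≠ 0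

/-- The projective subspaces equivalent under `GL(F²) × GL(F³)` to one of the given ones. -/
def orbitsOf {F : Type*} [Field F] {d : ℕ} (R : Set (Submodule F (V F))) : Set (PG F d) :=
  {U | ∃ W ∈ R, ∃ g : H2 F, U.1 = W.map ((act g) : V F →ₗ[F] V F)}

/-! ### The table of points -/

inductive PointType
  | o1 | o4

def pointReps (F : Type*) [Field F] : PointType → Set (Submodule F (V F))
  | .o1 => {rep1 fun x => !![x, 0, 0; 0, 0, 0]}
  | .o4 => {rep1 fun x => !![x, 0, 0; 0, x, 0]}

def pointOrbit (F : Type*) [Field F] (t : PointType) : Set (PG F 0) := orbitsOf (pointReps F t)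

def pointMeet {F : Type*} [Field F] (U : PG F 0) : PointType → Prop
  | .o1 => (meet U).ncard = 1
  | .o4 => meet U = ∅

def pointMin : PointType → ℕ × ℕ
  | .o1 => (1, 1)
  | .o4 => (2, 2)

/-! ### The table of lines -/

inductive LineType
  | o2 | o4T | o5 | o6 | o7 | o10 | o11

def lineReps (F : Type*) [Field F] : LineType → Set (Submodule F (V F))
  | .o2 => {rep2 fun x y => !![x, y, 0; 0, 0, 0]}
  | .o4T => {rep2 fun x y => !![x, 0, 0; y, 0, 0]}
  | .o5 => {rep2 fun x y => !![x, 0, 0; 0, y, 0]}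
  | .o6 => {rep2 fun x y => !![x, 0, 0; y, x, 0]}
  | .o7 => {rep2 fun x y => !![x, y, 0; 0, 0, x]}
  | .o10 => {W | ∃ u v : F, QuadCond u v ∧
      W = rep2 fun x y => !![x, u * x + y, 0; v * y, x, 0]}
  | .o11 => {rep2 fun x y => !![x, y, 0; 0, x, y]}

def lineOrbit (F : Type*) [Field F] (t : LineType) : Set (PG F 1) := orbitsOf (lineReps F t)

def lineMeet {F : Type*} [Field F] (U : PG F 1) : LineType → Prop
  | .o2 => IsLineFirstKind (meet U)
  | .o4T => IsLineSecondKind (meet U)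
  | .o5 => (meet U).ncard = 2
  | .o6 => (meet U).ncard = 1
  | .o7 => (meet U).ncard = 1
  | .o10 => meet U = ∅
  | .o11 => meet U = ∅

def lineMin : LineType → ℕ × ℕ
  | .o2 => (1, 2)
  | .o4T => (2, 1)
  | .o5 => (2, 2)
  | .o6 => (2, 2)
  | .o7 => (2, 3)
  | .o10 => (2, 2)
  | .o11 => (2, 3)

/-! ### The table of planes -/

inductive PlaneType
  | o3 | o7T | o8 | o9 | o11T | o12 | o13 | o14 | o15 | o16 | o17

def planeReps (F : Type*) [Field F] : PlaneType → Set (Submodule F (V F))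
  | .o3 => {rep3 fun x y z => !![x, y, z; 0, 0, 0]}
  | .o7T => {rep3 fun x y z => !![z, 0, 0; x, y, 0]}
  | .o8 => {rep3 fun x y z => !![x, 0, 0; 0, y, z]}
  | .o9 => {rep3 fun x y z => !![z, 0, 0; x, y, z]}
  | .o11T => {rep3 fun x y z => !![x, y, 0; y, z, 0]}
  | .o12 => {rep3 fun x y z => !![x, y, 0; 0, z, x]}
  | .o13 => {rep3 fun x y z => !![x, y, 0; 0, x, z]}
  | .o14 => {rep3 fun x y z => !![x, y, 0; 0, y, z]}
  | .o15 => {W | ∃ u v : F, QuadCond u v ∧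
      W = rep3 fun x y z => !![x, u * x + y, z; v * y, x, 0]}
  | .o16 => {rep3 fun x y z => !![x, y, z; 0, x, y]}
  | .o17 => {W | ∃ α β γ : F, CubicCond α β γ ∧
      W = rep3 fun x y z => !![x, y, z; α * z, x + β * z, y + γ * z]}

def planeOrbit (F : Type*) [Field F] (t : PlaneType) : Set (PG F 2) := orbitsOf (planeReps F t)

def planeMeet {F : Type*} [Field F] (U : PG F 2) : PlaneType → Prop
  | .o3 => IsSegrePlane (meet U)
  | .o7T => ∃ S T, IsLineFirstKind S ∧ IsLineSecondKind T ∧ (S ∩ T).ncard = 1 ∧ meet U = S ∪ T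
  | .o8 => ∃ S p, IsLineFirstKind S ∧ p ∉ S ∧ meet U = S ∪ {p}
  | .o9 => IsLineFirstKind (meet U)
  | .o11T => IsConicOf U (meet U)
  | .o12 => IsLineSecondKind (meet U)
  | .o13 => (meet U).ncard = 2
  | .o14 => (meet U).ncard = 3
  | .o15 => (meet U).ncard = 1 ∧ ∃ L ∈ lineOrbit F .o10, L.1 ≤ U.1
  | .o16 => (meet U).ncard = 1 ∧ ∃ L ∈ lineOrbit F .o11, L.1 ≤ U.1
  | .o17 => meet U = ∅

def planeMin : PlaneType → ℕ × ℕ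
  | .o3 => (1, 3)
  | .o7T => (2, 2)
  | .o8 => (2, 3)
  | .o9 => (2, 3)
  | .o11T => (2, 2)
  | .o12 => (2, 3)
  | .o13 => (2, 3)
  | .o14 => (2, 3)
  | .o15 => (2, 3)
  | .o16 => (2, 3)
  | .o17 => (2, 3)

/-! ### Classifications -/

/-- The classes `orb t`, with `t` not in `missing`, are exactly the orbits on the projective
subspaces of dimension `d`, without repetition, and the classes with `t` in `missing` are empty. -/
structure IsOrbitList {F : Type*} [Field F] {d : ℕ} {ι : Type} (orb : ι → Set (PG F d))
    (missing : Set ι) : Prop where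
  empty_of_missing : ∀ t ∈ missing, orb t = ∅
  orbit_of_not_missing : ∀ t ∉ missing, ∃ U, orb t = MulAction.orbit (H2 F) U
  exists_unique : ∀ U, ∃! t, U ∈ orb t

/-- Every subspace in one of the classes has the stated intersection with the Segre variety and
the stated minimal Segre subvariety. -/
def TablesHold (F : Type*) [Field F] : Prop :=
  (∀ t, ∀ U ∈ pointOrbit F t, pointMeet U t ∧ HasMinSegre U (pointMin t)) ∧
  (∀ t, ∀ U ∈ lineOrbit F t, lineMeet U t ∧ HasMinSegre U (lineMin t)) ∧
  (∀ t, ∀ U ∈ planeOrbit F t, planeMeet U t ∧ HasMinSegre U (planeMin t))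

end SegreOrbits

open SegreOrbits

/-! In a basis `a₀, a₁` of F², a tensor is `a₀ ⊗ c + a₁ ⊗ d`, a pair of rows in F³; it spans a point
of the Segre variety when it is nonzero and its rows are proportional. The classification has an
existence half (every subspace reaches a table row) and a uniqueness half (no subspace reaches two).

Existence. By `IsRep.exists_map_eq` it is enough to find bases of F² and F³ in which the basis
tensors of a row lie in `U`; the equality of dimensions does the rest. For a line without pure
tensors the second rows `d₁, d₂` are independent. Either some first row leaves their span, which
leads to o₁₁, or the first rows are `S d₁, S d₂` for an endomorphism `S` of the plane of the `d`s. A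
nonscalar `S` has a cyclic basis `d, S d` (`exists_cyclic`), and a root of its characteristic
polynomial produces a pure tensor (`pure_mem_of_root`), so without pure tensors the polynomial is
irreducible and the line is in o₁₀. The cyclic step returns for planes. A plane that contains a pure
tensor `a₀ ⊗ b₀` is sorted by the position of the remaining second rows relative to `b₀`; if they
are independent together with `b₀`, the characteristic polynomial of `S` decides between o₁₅ (no
root), o₁₃ (double root) and o₁₄ (two roots), a scalar `S` giving a line of the first kind. That a
plane contains a pure tensor at all is a cubic condition, the vanishing of the determinant of a
pencil of 3 × 3 matrices (`exists_pure_mem_of_cubic`). Every cubic has a root over an algebraically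
closed field and over ℝ, which is also why o₁₇ is empty there.

Uniqueness. The minimal size and the number of points on the Segre variety are invariants, computed
on the representatives and transported by `orbitsOf_induction`. The few pairs of plane rows which
they do not separate are told apart by three further invariants, `ContainsRuling`,
`ContainsSkewPair` and `ContainsTangent`.

Finally o₁₀ and o₁₅ are the only classes with parameters left. They are empty over an algebraically
closed field. Over ℝ an endomorphism of a plane without real eigenvalues is, up to scaling and
adding a scalar, a square root of -1, so each of the two is a single orbit
(`exists_real_normalization`). -/

namespace SegreOrbits

variable {F : Type*} [Field F]

/-! ### Linear independence of two or three vectors -/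

section Independence

variable {E : Type*} [AddCommGroup E] [Module F E]

theorem li_two {v w : E} :
    LinearIndependent F ![v, w] ↔ ∀ x y : F, x • v + y • w = 0 → x = 0 ∧ y = 0 :=
  LinearIndependent.pair_iff

theorem li_three {u v w : E} :
    LinearIndependent F ![u, v, w] ↔
      ∀ x y z : F, x • u + y • v + z • w = 0 → x = 0 ∧ y = 0 ∧ z = 0 := by
  rw [Fintype.linearIndependent_iff]
  constructor
  · intro h x y z hxyz
    have := h ![x, y, z] (by simpa [Fin.sum_univ_three] using hxyz)
    exact ⟨this 0, this 1, this 2⟩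
  · intro h g hg
    obtain ⟨h0, h1, h2⟩ := h (g 0) (g 1) (g 2) (by simpa [Fin.sum_univ_three] using hg)
    intro i
    fin_cases i <;> assumption

theorem li_two_or {v : E} (hv : v ≠ 0) (w : E) :
    LinearIndependent F ![v, w] ∨ ∃ x : F, w = x • v := by
  by_cases h : ∃ x : F, w = x • v
  · exact .inr h
  · left
    rw [LinearIndependent.pair_iff' hv]
    exact fun x hx => h ⟨x, hx.symm⟩

theorem li_three_or {u v : E} (h : LinearIndependent F ![u, v]) (w : E) :
    LinearIndependent F ![u, v, w] ∨ ∃ x y : F, w = x • u + y • v := by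
  by_cases hw : ∃ x y : F, w = x • u + y • v
  · exact .inr hw
  · left
    rw [li_three]
    intro x y z hz
    have hz0 : z = 0 := by
      by_contra hz0
      refine hw ⟨-(z⁻¹ * x), -(z⁻¹ * y), ?_⟩
      have : z⁻¹ • (x • u + y • v + z • w) = 0 := by rw [hz, smul_zero]
      rw [smul_add, smul_smul _ _ w, inv_mul_cancel₀ hz0, one_smul] at this
      rw [eq_neg_of_add_eq_zero_right this]
      module
    subst hz0
    obtain ⟨hx, hy⟩ := li_two.1 h x y (by simpa using hz)
    exact ⟨hx, hy, rfl⟩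

theorem li_swap {v w : E} (h : LinearIndependent F ![v, w]) : LinearIndependent F ![w, v] :=
  LinearIndependent.pair_symm_iff.1 h

/-- Cyclic shift of three independent vectors. -/
theorem li_rotate {u v w : E} (h : LinearIndependent F ![u, v, w]) :
    LinearIndependent F ![v, w, u] := by
  rw [li_three] at h ⊢
  intro x y z e
  obtain ⟨h1, h2, h3⟩ := h z x y (by rw [← e]; module)
  exact ⟨h2, h3, h1⟩

theorem li_swap_left {u v w : E} (h : LinearIndependent F ![u, v, w]) :
    LinearIndependent F ![v, u, w] := by
  rw [li_three] at h ⊢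
  intro x y z e
  obtain ⟨h1, h2, h3⟩ := h y x z (by rw [← e]; module)
  exact ⟨h2, h1, h3⟩

theorem li_init {u v w : E} (h : LinearIndependent F ![u, v, w]) :
    LinearIndependent F ![u, v] := by
  rw [li_three] at h
  rw [li_two]
  intro x y e
  obtain ⟨h1, h2, -⟩ := h x y 0 (by rw [← e]; module)
  exact ⟨h1, h2⟩

theorem li_left_ne {v w : E} (h : LinearIndependent F ![v, w]) : v ≠ 0 := h.ne_zero 0

theorem li_right_ne {v w : E} (h : LinearIndependent F ![v, w]) : w ≠ 0 := h.ne_zero 1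

theorem exists_li_two {a : Fin 2 → F} (ha : a ≠ 0) : ∃ b, LinearIndependent F ![a, b] := by
  by_contra! h
  have hs : (⊤ : Submodule F (Fin 2 → F)) ≤ Submodule.span F {a} := by
    intro b _
    rcases li_two_or (F := F) ha b with hb | ⟨x, rfl⟩
    · exact absurd hb (h b)
    · exact Submodule.smul_mem _ _ (Submodule.mem_span_singleton_self a)
  have := Submodule.finrank_mono hs
  rw [finrank_span_singleton ha, finrank_top] at this
  simp at this

theorem exists_li_pair {a : Fin 3 → F} (ha : a ≠ 0) : ∃ b, LinearIndependent F ![a, b] := by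
  by_contra! h
  have hs : (⊤ : Submodule F (Fin 3 → F)) ≤ Submodule.span F {a} := by
    intro b _
    rcases li_two_or (F := F) ha b with hb | ⟨x, rfl⟩
    · exact absurd hb (h b)
    · exact Submodule.smul_mem _ _ (Submodule.mem_span_singleton_self a)
  have := Submodule.finrank_mono hs
  rw [finrank_span_singleton ha, finrank_top] at this
  simp at this

theorem exists_li_three {a b : Fin 3 → F} (h : LinearIndependent F ![a, b]) :
    ∃ c, LinearIndependent F ![a, b, c] := by
  by_contra! h'
  have hs : (⊤ : Submodule F (Fin 3 → F)) ≤ Submodule.span F (Set.range ![a, b]) := by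
    intro c _
    rcases li_three_or h c with hb | ⟨x, y, rfl⟩
    · exact absurd hb (h' c)
    · exact add_mem (Submodule.smul_mem _ _ (Submodule.subset_span ⟨0, rfl⟩))
        (Submodule.smul_mem _ _ (Submodule.subset_span ⟨1, rfl⟩))
  have := Submodule.finrank_mono hs
  rw [finrank_span_eq_card h, finrank_top] at this
  simp at this

theorem exists_coords_two {a b : Fin 2 → F} (h : LinearIndependent F ![a, b]) (c : Fin 2 → F) :
    ∃ x y : F, c = x • a + y • b := by
  rcases li_three_or h c with hb | hb
  · have := hb.fintype_card_le_finrank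
    simp at this
  · exact hb

theorem exists_coords_three {a b c : Fin 3 → F} (h : LinearIndependent F ![a, b, c])
    (d : Fin 3 → F) : ∃ x y z : F, d = x • a + y • b + z • c := by
  have ht := h.span_eq_top_of_card_eq_finrank (by simp)
  have hd : d ∈ Submodule.span F (Set.range ![a, b, c]) := ht ▸ Submodule.mem_top
  obtain ⟨g, rfl⟩ := (Submodule.mem_span_range_iff_exists_fun F).1 hd
  exact ⟨g 0, g 1, g 2, by simp [Fin.sum_univ_three]⟩

/-- The span of `n` vectors is too small to contain `U`. This extends tensors already found in `U`
to a basis, one at a time. -/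
theorem exists_mem_notMem_span {n : ℕ} {U : Submodule F E} {s : Fin n → E}
    (h : n < Module.finrank F U) : ∃ t ∈ U, t ∉ Submodule.span F (Set.range s) := by
  by_contra! hs
  have := FiniteDimensional.span_of_finite F (Set.finite_range s)
  have h1 := Submodule.finrank_mono (show U ≤ Submodule.span F (Set.range s) from hs)
  have h2 := finrank_range_le_card (R := F) s
  rw [Set.finrank, Fintype.card_fin] at h2
  omega

theorem exists_li_of_finrank {n : ℕ} {U : Submodule F E} (h : Module.finrank F U = n + 1) :
    ∃ s : Fin (n + 1) → E, (∀ i, s i ∈ U) ∧ LinearIndependent F s := by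
  have : Module.Finite F U := Module.finite_of_finrank_eq_succ h
  let B := Module.finBasisOfFinrankEq F U h
  exact ⟨fun i => B i, fun i => (B i).2,
    B.linearIndependent.map' U.subtype (Submodule.ker_subtype _)⟩

end Independence

/-! ### Coordinates -/

/-- The coefficient of `e_i ⊗ e_j`. -/
noncomputable def entry (i : Fin 2) (j : Fin 3) : V F →ₗ[F] F :=
  LinearMap.mul' F F ∘ₗ TensorProduct.map (LinearMap.proj i) (LinearMap.proj j)

@[simp]
theorem entry_tmul (i : Fin 2) (j : Fin 3) (a : Fin 2 → F) (b : Fin 3 → F) :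
    entry i j (a ⊗ₜ[F] b) = a i * b j := by
  simp [entry]

/-- The tensor with coordinate matrix `M` with respect to the tensors `a i ⊗ b j`. -/
noncomputable def mix (a : Fin 2 → Fin 2 → F) (b : Fin 3 → Fin 3 → F) :
    Matrix (Fin 2) (Fin 3) F →ₗ[F] V F where
  toFun M := ∑ i, ∑ j, M i j • (a i ⊗ₜ[F] b j)
  map_add' M N := by simp [add_smul, Finset.sum_add_distrib]
  map_smul' c M := by simp [mul_smul, Finset.smul_sum]

theorem mix_apply (a : Fin 2 → Fin 2 → F) (b : Fin 3 → Fin 3 → F)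
    (M : Matrix (Fin 2) (Fin 3) F) : mix a b M = ∑ i, ∑ j, M i j • (a i ⊗ₜ[F] b j) := rfl

theorem tens_eq_mix (M : Matrix (Fin 2) (Fin 3) F) :
    tens M = mix (fun i => Pi.single i 1) (fun j => Pi.single j 1) M := rfl

theorem act_mix (g : H2 F) (a : Fin 2 → Fin 2 → F) (b : Fin 3 → Fin 3 → F)
    (M : Matrix (Fin 2) (Fin 3) F) :
    act g (mix a b M) = mix (fun i => g.1 (a i)) (fun j => g.2 (b j)) M := by
  simp [mix_apply, act]

@[simp]
theorem act_tmul (g : H2 F) (a : Fin 2 → F) (b : Fin 3 → F) :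
    act g (a ⊗ₜ[F] b) = g.1 a ⊗ₜ[F] g.2 b := by
  simp [act]

@[simp]
theorem entry_tens (i : Fin 2) (j : Fin 3) (M : Matrix (Fin 2) (Fin 3) F) :
    entry i j (tens M) = M i j := by
  simp only [tens, map_sum, map_smul, entry_tmul, smul_eq_mul]
  rw [Finset.sum_eq_single i, Finset.sum_eq_single j] <;> simp +contextual [Pi.single_apply, eq_comm]

/-- Together with `entry_tens` this identifies tensors with 2 × 3 matrices, so equalities and linear
conditions can be checked on entries. -/
theorem tens_entry (t : V F) : tens (Matrix.of fun i j => entry i j t) = t := by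
  induction t using TensorProduct.induction_on with
  | zero => simp [tens]
  | tmul a b =>
    have ha : a = ∑ i, a i • (Pi.single i 1 : Fin 2 → F) := by ext; simp [Pi.single_apply]
    have hb : b = ∑ j, b j • (Pi.single j 1 : Fin 3 → F) := by ext; simp [Pi.single_apply]
    conv_rhs => rw [ha, hb]
    simp only [tens, entry_tmul, TensorProduct.sum_tmul, TensorProduct.tmul_sum,
      TensorProduct.smul_tmul_smul, Matrix.of_apply]
    exact Finset.sum_comm
  | add s t hs ht =>
    conv_rhs => rw [← hs, ← ht]
    simp [tens, add_smul, Finset.sum_add_distrib]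

theorem tens_injective : Function.Injective (tens : Matrix (Fin 2) (Fin 3) F → V F) := by
  intro M N h
  ext i j
  rw [← entry_tens i j M, h, entry_tens]

theorem ext_entry {s t : V F} (h : ∀ i j, entry i j s = entry i j t) : s = t := by
  rw [← tens_entry s, ← tens_entry t]
  simp [h]

theorem eq_tens_iff {t : V F} {M : Matrix (Fin 2) (Fin 3) F} :
    t = tens M ↔ ∀ i j, entry i j t = M i j :=
  ⟨by rintro rfl i j; simp, fun h => ext_entry (by simpa using h)⟩

theorem tmul_ne_zero {a : Fin 2 → F} {b : Fin 3 → F} (ha : a ≠ 0) (hb : b ≠ 0) :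
    a ⊗ₜ[F] b ≠ 0 := by
  obtain ⟨i, hi⟩ := Function.ne_iff.1 ha
  obtain ⟨j, hj⟩ := Function.ne_iff.1 hb
  intro h
  have := entry_tmul i j a b
  rw [h, map_zero] at this
  exact mul_ne_zero hi hj this.symm

/-- Every tensor is `a₀ ⊗ c + a₁ ⊗ d`, for a given basis `a₀, a₁` of `F²`. -/
theorem exists_rows {a₀ a₁ : Fin 2 → F} (h : LinearIndependent F ![a₀, a₁]) (t : V F) :
    ∃ c d : Fin 3 → F, t = a₀ ⊗ₜ[F] c + a₁ ⊗ₜ[F] d := by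
  induction t using TensorProduct.induction_on with
  | zero => exact ⟨0, 0, by simp⟩
  | tmul a b =>
    obtain ⟨x, y, rfl⟩ := exists_coords_two h a
    exact ⟨x • b, y • b, by simp [TensorProduct.add_tmul, TensorProduct.smul_tmul]⟩
  | add s t hs ht =>
    obtain ⟨c, d, rfl⟩ := hs
    obtain ⟨c', d', rfl⟩ := ht
    exact ⟨c + c', d + d', by simp only [TensorProduct.tmul_add]; abel⟩

/-! ### Orbits of a subspace given by a basis of matrices -/

/-- The tensors of the matrices `T k` are a basis of `W`. -/
structure IsRep {n : ℕ} (W : Submodule F (V F)) (T : Fin n → Matrix (Fin 2) (Fin 3) F) :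
    Prop where
  eq_span : W = Submodule.span F (Set.range fun k => tens (T k))
  li : LinearIndependent F T

theorem IsRep.finrank_eq {n : ℕ} {W : Submodule F (V F)}
    {T : Fin n → Matrix (Fin 2) (Fin 3) F} (h : IsRep W T) : Module.finrank F W = n := by
  rw [h.eq_span, finrank_span_eq_card, Fintype.card_fin]
  exact h.li.map' (mix (fun i => Pi.single i 1) (fun j => Pi.single j 1))
    (LinearMap.ker_eq_bot.2 tens_injective)

/-- A subspace which contains the tensors of a table row, written in some bases of `F²` and `F³`,
is equivalent to that row. -/
theorem IsRep.exists_map_eq {d : ℕ} {W : Submodule F (V F)}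
    {T : Fin (d + 1) → Matrix (Fin 2) (Fin 3) F} (h : IsRep W T) {U : PG F d}
    {a : Fin 2 → Fin 2 → F} {b : Fin 3 → Fin 3 → F}
    (ha : LinearIndependent F a) (hb : LinearIndependent F b) (hU : ∀ k, mix a b (T k) ∈ U.1) :
    ∃ g : H2 F, U.1 = W.map ((act g) : V F →ₗ[F] V F) := by
  let A := basisOfLinearIndependentOfCardEqFinrank ha (by simp)
  let B := basisOfLinearIndependentOfCardEqFinrank hb (by simp)
  let g : H2 F := ((Pi.basisFun F (Fin 2)).equiv A (Equiv.refl _),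
    (Pi.basisFun F (Fin 3)).equiv B (Equiv.refl _))
  have h1 : ∀ i, g.1 (Pi.single i 1) = a i := fun i => by
    rw [← Pi.basisFun_apply]
    rw [Module.Basis.equiv_apply]
    simp [A]
  have h2 : ∀ i, g.2 (Pi.single i 1) = b i := fun i => by
    rw [← Pi.basisFun_apply]
    rw [Module.Basis.equiv_apply]
    simp [B]
  -- Only the inclusion of the image of `W` in `U` has to be checked on generators; both have
  -- dimension `d + 1`.
  refine ⟨g, (Submodule.eq_of_le_of_finrank_eq ?_ ?_).symm⟩
  · rw [h.eq_span, Submodule.map_span, Submodule.span_le]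
    rintro _ ⟨_, ⟨k, rfl⟩, rfl⟩
    have := hU k
    simp only [LinearEquiv.coe_coe, tens_eq_mix, act_mix, h1, h2]
    exact this
  · rw [U.2, LinearEquiv.finrank_map_eq, h.finrank_eq]

/-- The family `M` is linear in its parameter, and injective. -/
structure IsParam1 (M : F → Matrix (Fin 2) (Fin 3) F) : Prop where
  linear : ∀ x, M x = x • M 1
  eq_zero : ∀ x, M x = 0 → x = 0

/-- The values of a linear family are already closed under sums and multiples, so the span in `rep1`
adds nothing. -/
theorem IsParam1.mem_iff {M : F → Matrix (Fin 2) (Fin 3) F} (h : IsParam1 M)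
    {t : V F} :
    t ∈ rep1 M ↔ ∃ x, t = tens (M x) := by
  have hM := h.linear
  refine ⟨fun h => ?_, fun h => Submodule.subset_span h⟩
  induction h using Submodule.span_induction with
  | mem t h => exact h
  | zero => exact ⟨0, by rw [hM, zero_smul, tens_eq_mix, map_zero]⟩
  | add s t _ _ hs ht =>
    obtain ⟨x, rfl⟩ := hs
    obtain ⟨x', rfl⟩ := ht
    refine ⟨x + x', ?_⟩
    simp only [tens_eq_mix]
    rw [hM x, hM x', hM (x + x'), ← map_add]
    congr 1
    module
  | smul c t _ ht =>
    obtain ⟨x, rfl⟩ := ht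
    refine ⟨c * x, ?_⟩
    simp only [tens_eq_mix]
    rw [hM x, hM (c * x), ← map_smul]
    congr 1
    module

/-- The family `M` is linear in its parameters, and injective. -/
structure IsParam2 (M : F → F → Matrix (Fin 2) (Fin 3) F) : Prop where
  linear : ∀ x y, M x y = x • M 1 0 + y • M 0 1
  eq_zero : ∀ x y, M x y = 0 → x = 0 ∧ y = 0

theorem IsParam2.mem_iff {M : F → F → Matrix (Fin 2) (Fin 3) F} (h : IsParam2 M)
    {t : V F} :
    t ∈ rep2 M ↔ ∃ x y, t = tens (M x y) := by
  have hM := h.linear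
  refine ⟨fun h => ?_, fun h => Submodule.subset_span h⟩
  induction h using Submodule.span_induction with
  | mem t h => exact h
  | zero => exact ⟨0, 0, by rw [hM, zero_smul, zero_smul, add_zero, tens_eq_mix, map_zero]⟩
  | add s t _ _ hs ht =>
    obtain ⟨x, y, rfl⟩ := hs
    obtain ⟨x', y', rfl⟩ := ht
    refine ⟨x + x', y + y', ?_⟩
    simp only [tens_eq_mix]
    rw [hM x, hM x', hM (x + x'), ← map_add]
    congr 1
    module
  | smul c t _ ht =>
    obtain ⟨x, y, rfl⟩ := ht
    refine ⟨c * x, c * y, ?_⟩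
    simp only [tens_eq_mix]
    rw [hM x, hM (c * x), ← map_smul]
    congr 1
    module

/-- The family `M` is linear in its parameters, and injective. -/
structure IsParam3 (M : F → F → F → Matrix (Fin 2) (Fin 3) F) : Prop where
  linear : ∀ x y z, M x y z = x • M 1 0 0 + y • M 0 1 0 + z • M 0 0 1
  eq_zero : ∀ x y z, M x y z = 0 → x = 0 ∧ y = 0 ∧ z = 0

theorem IsParam3.mem_iff {M : F → F → F → Matrix (Fin 2) (Fin 3) F} (h : IsParam3 M)
    {t : V F} :
    t ∈ rep3 M ↔ ∃ x y z, t = tens (M x y z) := by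
  have hM := h.linear
  refine ⟨fun h => ?_, fun h => Submodule.subset_span h⟩
  induction h using Submodule.span_induction with
  | mem t h => exact h
  | zero =>
    exact ⟨0, 0, 0, by
      rw [hM, zero_smul, zero_smul, zero_smul, add_zero, add_zero, tens_eq_mix, map_zero]⟩
  | add s t _ _ hs ht =>
    obtain ⟨x, y, z, rfl⟩ := hs
    obtain ⟨x', y', z', rfl⟩ := ht
    refine ⟨x + x', y + y', z + z', ?_⟩
    simp only [tens_eq_mix]
    rw [hM x, hM x', hM (x + x'), ← map_add]
    congr 1
    module
  | smul c t _ ht =>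
    obtain ⟨x, y, z, rfl⟩ := ht
    refine ⟨c * x, c * y, c * z, ?_⟩
    simp only [tens_eq_mix]
    rw [hM x, hM (c * x), ← map_smul]
    congr 1
    module

/-! ### Bases of linear families of matrices -/

theorem IsParam1.isRep {M : F → Matrix (Fin 2) (Fin 3) F} (h : IsParam1 M) :
    IsRep (rep1 M) ![M 1] where
  eq_span := by
    refine le_antisymm (Submodule.span_le.2 ?_) (Submodule.span_mono ?_)
    · rintro _ ⟨x, rfl⟩
      rw [show tens (M x) = x • tens (M 1) by simp only [tens_eq_mix, ← map_smul, ← h.linear]]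
      exact Submodule.smul_mem _ _ (Submodule.subset_span ⟨0, rfl⟩)
    · rintro _ ⟨k, rfl⟩
      fin_cases k
      exact ⟨1, rfl⟩
  li := by
    rw [linearIndependent_unique_iff]
    intro h1
    exact one_ne_zero (h.eq_zero 1 h1)

theorem IsParam2.isRep {M : F → F → Matrix (Fin 2) (Fin 3) F} (h : IsParam2 M) :
    IsRep (rep2 M) ![M 1 0, M 0 1] where
  eq_span := by
    refine le_antisymm (Submodule.span_le.2 ?_) (Submodule.span_mono ?_)
    · rintro _ ⟨x, y, rfl⟩
      rw [show tens (M x y) = x • tens (M 1 0) + y • tens (M 0 1) by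
        simp only [tens_eq_mix, ← map_smul, ← map_add, ← h.linear]]
      exact add_mem (Submodule.smul_mem _ _ (Submodule.subset_span ⟨0, rfl⟩))
        (Submodule.smul_mem _ _ (Submodule.subset_span ⟨1, rfl⟩))
    · rintro _ ⟨k, rfl⟩
      fin_cases k
      exacts [⟨1, 0, rfl⟩, ⟨0, 1, rfl⟩]
  li := li_two.2 fun x y h' => h.eq_zero x y (by rw [h.linear, h'])

theorem IsParam3.isRep {M : F → F → F → Matrix (Fin 2) (Fin 3) F} (h : IsParam3 M) :
    IsRep (rep3 M) ![M 1 0 0, M 0 1 0, M 0 0 1] where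
  eq_span := by
    refine le_antisymm (Submodule.span_le.2 ?_) (Submodule.span_mono ?_)
    · rintro _ ⟨x, y, z, rfl⟩
      rw [show tens (M x y z) = x • tens (M 1 0 0) + y • tens (M 0 1 0) + z • tens (M 0 0 1) by
        simp only [tens_eq_mix, ← map_smul, ← map_add, ← h.linear]]
      exact add_mem (add_mem (Submodule.smul_mem _ _ (Submodule.subset_span ⟨0, rfl⟩))
        (Submodule.smul_mem _ _ (Submodule.subset_span ⟨1, rfl⟩)))
        (Submodule.smul_mem _ _ (Submodule.subset_span ⟨2, rfl⟩))
    · rintro _ ⟨k, rfl⟩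
      fin_cases k
      exacts [⟨1, 0, 0, rfl⟩, ⟨0, 1, 0, rfl⟩, ⟨0, 0, 1, rfl⟩]
  li := li_three.2 fun x y z h' => h.eq_zero x y z (by rw [h.linear, h'])

/-! ### The table rows as subspaces, and recognition of their orbits -/

theorem isParam_o1 :
    IsParam1 (fun x : F => !![x, 0, 0; 0, 0, 0]) where
  linear := by intros; simp
  eq_zero x h := by
    simp [← Matrix.ext_iff, Fin.forall_fin_succ] at h
    tauto

/-- Pattern for all the recognition lemmas `mem_o…`: the hypotheses place in `U` the generators of
the row, obtained by setting one parameter to 1 and the others to 0, written in the given bases. -/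
theorem mem_o1 {U : PG F 0} {a₀ a₁ : Fin 2 → F} {b₀ b₁ b₂ : Fin 3 → F}
    (ha : LinearIndependent F ![a₀, a₁]) (hb : LinearIndependent F ![b₀, b₁, b₂])
    (h0 : a₀ ⊗ₜ[F] b₀ ∈ U.1) :
    U ∈ pointOrbit F .o1 := by
  obtain ⟨g, hg⟩ := isParam_o1.isRep.exists_map_eq (U := U) ha hb (by
    intro k
    fin_cases k
    · simpa [mix_apply, Fin.sum_univ_succ] using h0
    )
  exact ⟨_, rfl, g, hg⟩

theorem isParam_o4 :
    IsParam1 (fun x : F => !![x, 0, 0; 0, x, 0]) where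
  linear := by intros; simp
  eq_zero x h := by
    simp [← Matrix.ext_iff, Fin.forall_fin_succ] at h
    tauto

theorem mem_o4 {U : PG F 0} {a₀ a₁ : Fin 2 → F} {b₀ b₁ b₂ : Fin 3 → F}
    (ha : LinearIndependent F ![a₀, a₁]) (hb : LinearIndependent F ![b₀, b₁, b₂])
    (h0 : a₀ ⊗ₜ[F] b₀ + a₁ ⊗ₜ[F] b₁ ∈ U.1) :
    U ∈ pointOrbit F .o4 := by
  obtain ⟨g, hg⟩ := isParam_o4.isRep.exists_map_eq (U := U) ha hb (by
    intro k
    fin_cases k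
    · simpa [mix_apply, Fin.sum_univ_succ] using h0
    )
  exact ⟨_, rfl, g, hg⟩

theorem isParam_o2 :
    IsParam2 (fun x y : F => !![x, y, 0; 0, 0, 0]) where
  linear := by intros; simp
  eq_zero x y h := by
    simp [← Matrix.ext_iff, Fin.forall_fin_succ] at h
    tauto

theorem mem_o2 {U : PG F 1} {a₀ a₁ : Fin 2 → F} {b₀ b₁ b₂ : Fin 3 → F}
    (ha : LinearIndependent F ![a₀, a₁]) (hb : LinearIndependent F ![b₀, b₁, b₂])
    (h0 : a₀ ⊗ₜ[F] b₀ ∈ U.1)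
    (h1 : a₀ ⊗ₜ[F] b₁ ∈ U.1) :
    U ∈ lineOrbit F .o2 := by
  obtain ⟨g, hg⟩ := isParam_o2.isRep.exists_map_eq (U := U) ha hb (by
    intro k
    fin_cases k
    · simpa [mix_apply, Fin.sum_univ_succ] using h0
    · simpa [mix_apply, Fin.sum_univ_succ] using h1
    )
  exact ⟨_, rfl, g, hg⟩

theorem isParam_o4T :
    IsParam2 (fun x y : F => !![x, 0, 0; y, 0, 0]) where
  linear := by intros; simp
  eq_zero x y h := by
    simp [← Matrix.ext_iff, Fin.forall_fin_succ] at h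
    tauto

theorem mem_o4T {U : PG F 1} {a₀ a₁ : Fin 2 → F} {b₀ b₁ b₂ : Fin 3 → F}
    (ha : LinearIndependent F ![a₀, a₁]) (hb : LinearIndependent F ![b₀, b₁, b₂])
    (h0 : a₀ ⊗ₜ[F] b₀ ∈ U.1)
    (h1 : a₁ ⊗ₜ[F] b₀ ∈ U.1) :
    U ∈ lineOrbit F .o4T := by
  obtain ⟨g, hg⟩ := isParam_o4T.isRep.exists_map_eq (U := U) ha hb (by
    intro k
    fin_cases k
    · simpa [mix_apply, Fin.sum_univ_succ] using h0
    · simpa [mix_apply, Fin.sum_univ_succ] using h1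
    )
  exact ⟨_, rfl, g, hg⟩

theorem isParam_o5 :
    IsParam2 (fun x y : F => !![x, 0, 0; 0, y, 0]) where
  linear := by intros; simp
  eq_zero x y h := by
    simp [← Matrix.ext_iff, Fin.forall_fin_succ] at h
    tauto

theorem mem_o5 {U : PG F 1} {a₀ a₁ : Fin 2 → F} {b₀ b₁ b₂ : Fin 3 → F}
    (ha : LinearIndependent F ![a₀, a₁]) (hb : LinearIndependent F ![b₀, b₁, b₂])
    (h0 : a₀ ⊗ₜ[F] b₀ ∈ U.1)
    (h1 : a₁ ⊗ₜ[F] b₁ ∈ U.1) :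
    U ∈ lineOrbit F .o5 := by
  obtain ⟨g, hg⟩ := isParam_o5.isRep.exists_map_eq (U := U) ha hb (by
    intro k
    fin_cases k
    · simpa [mix_apply, Fin.sum_univ_succ] using h0
    · simpa [mix_apply, Fin.sum_univ_succ] using h1
    )
  exact ⟨_, rfl, g, hg⟩

theorem isParam_o6 :
    IsParam2 (fun x y : F => !![x, 0, 0; y, x, 0]) where
  linear := by intros; simp
  eq_zero x y h := by
    simp [← Matrix.ext_iff, Fin.forall_fin_succ] at h
    tauto

theorem mem_o6 {U : PG F 1} {a₀ a₁ : Fin 2 → F} {b₀ b₁ b₂ : Fin 3 → F}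
    (ha : LinearIndependent F ![a₀, a₁]) (hb : LinearIndependent F ![b₀, b₁, b₂])
    (h0 : a₀ ⊗ₜ[F] b₀ + a₁ ⊗ₜ[F] b₁ ∈ U.1)
    (h1 : a₁ ⊗ₜ[F] b₀ ∈ U.1) :
    U ∈ lineOrbit F .o6 := by
  obtain ⟨g, hg⟩ := isParam_o6.isRep.exists_map_eq (U := U) ha hb (by
    intro k
    fin_cases k
    · simpa [mix_apply, Fin.sum_univ_succ] using h0
    · simpa [mix_apply, Fin.sum_univ_succ] using h1
    )
  exact ⟨_, rfl, g, hg⟩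

theorem isParam_o7 :
    IsParam2 (fun x y : F => !![x, y, 0; 0, 0, x]) where
  linear := by intros; simp
  eq_zero x y h := by
    simp [← Matrix.ext_iff, Fin.forall_fin_succ] at h
    tauto

theorem mem_o7 {U : PG F 1} {a₀ a₁ : Fin 2 → F} {b₀ b₁ b₂ : Fin 3 → F}
    (ha : LinearIndependent F ![a₀, a₁]) (hb : LinearIndependent F ![b₀, b₁, b₂])
    (h0 : a₀ ⊗ₜ[F] b₀ + a₁ ⊗ₜ[F] b₂ ∈ U.1)
    (h1 : a₀ ⊗ₜ[F] b₁ ∈ U.1) :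
    U ∈ lineOrbit F .o7 := by
  obtain ⟨g, hg⟩ := isParam_o7.isRep.exists_map_eq (U := U) ha hb (by
    intro k
    fin_cases k
    · simpa [mix_apply, Fin.sum_univ_succ] using h0
    · simpa [mix_apply, Fin.sum_univ_succ] using h1
    )
  exact ⟨_, rfl, g, hg⟩

theorem isParam_o10 (u v : F) :
    IsParam2 (fun x y : F => !![x, u * x + y, 0; v * y, x, 0]) where
  linear := by intros; simp [mul_comm]
  eq_zero x y h := by
    simp [← Matrix.ext_iff, Fin.forall_fin_succ] at h
    have hx : x = 0 := by tauto
    subst hx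
    simpa using h.1.2

theorem mem_o10 {U : PG F 1} {u v : F} (huv : QuadCond u v)
    {a₀ a₁ : Fin 2 → F} {b₀ b₁ b₂ : Fin 3 → F}
    (ha : LinearIndependent F ![a₀, a₁]) (hb : LinearIndependent F ![b₀, b₁, b₂])
    (h0 : a₀ ⊗ₜ[F] b₀ + u• a₀ ⊗ₜ[F] b₁ + a₁ ⊗ₜ[F] b₁ ∈ U.1)
    (h1 : a₀ ⊗ₜ[F] b₁ + v• a₁ ⊗ₜ[F] b₀ ∈ U.1) :
    U ∈ lineOrbit F .o10 := by
  obtain ⟨g, hg⟩ := (isParam_o10 u v).isRep.exists_map_eq (U := U) ha hb (by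
    intro k
    fin_cases k
    · simpa [mix_apply, Fin.sum_univ_succ] using h0
    · simpa [mix_apply, Fin.sum_univ_succ] using h1
    )
  exact ⟨_, ⟨u, v, huv, rfl⟩, g, hg⟩

theorem isParam_o11 :
    IsParam2 (fun x y : F => !![x, y, 0; 0, x, y]) where
  linear := by intros; simp
  eq_zero x y h := by
    simp [← Matrix.ext_iff, Fin.forall_fin_succ] at h
    tauto

theorem mem_o11 {U : PG F 1} {a₀ a₁ : Fin 2 → F} {b₀ b₁ b₂ : Fin 3 → F}
    (ha : LinearIndependent F ![a₀, a₁]) (hb : LinearIndependent F ![b₀, b₁, b₂])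
    (h0 : a₀ ⊗ₜ[F] b₀ + a₁ ⊗ₜ[F] b₁ ∈ U.1)
    (h1 : a₀ ⊗ₜ[F] b₁ + a₁ ⊗ₜ[F] b₂ ∈ U.1) :
    U ∈ lineOrbit F .o11 := by
  obtain ⟨g, hg⟩ := isParam_o11.isRep.exists_map_eq (U := U) ha hb (by
    intro k
    fin_cases k
    · simpa [mix_apply, Fin.sum_univ_succ] using h0
    · simpa [mix_apply, Fin.sum_univ_succ] using h1
    )
  exact ⟨_, rfl, g, hg⟩

theorem isParam_o3 :
    IsParam3 (fun x y z : F => !![x, y, z; 0, 0, 0]) where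
  linear := by intros; simp
  eq_zero x y z h := by
    simp [← Matrix.ext_iff, Fin.forall_fin_succ] at h
    tauto

theorem mem_o3 {U : PG F 2} {a₀ a₁ : Fin 2 → F} {b₀ b₁ b₂ : Fin 3 → F}
    (ha : LinearIndependent F ![a₀, a₁]) (hb : LinearIndependent F ![b₀, b₁, b₂])
    (h0 : a₀ ⊗ₜ[F] b₀ ∈ U.1)
    (h1 : a₀ ⊗ₜ[F] b₁ ∈ U.1)
    (h2 : a₀ ⊗ₜ[F] b₂ ∈ U.1) :
    U ∈ planeOrbit F .o3 := by
  obtain ⟨g, hg⟩ := isParam_o3.isRep.exists_map_eq (U := U) ha hb (by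
    intro k
    fin_cases k
    · simpa [mix_apply, Fin.sum_univ_succ] using h0
    · simpa [mix_apply, Fin.sum_univ_succ] using h1
    · simpa [mix_apply, Fin.sum_univ_succ] using h2
    )
  exact ⟨_, rfl, g, hg⟩

theorem isParam_o7T :
    IsParam3 (fun x y z : F => !![z, 0, 0; x, y, 0]) where
  linear := by intros; simp
  eq_zero x y z h := by
    simp [← Matrix.ext_iff, Fin.forall_fin_succ] at h
    tauto

theorem mem_o7T {U : PG F 2} {a₀ a₁ : Fin 2 → F} {b₀ b₁ b₂ : Fin 3 → F}
    (ha : LinearIndependent F ![a₀, a₁]) (hb : LinearIndependent F ![b₀, b₁, b₂])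
    (h0 : a₁ ⊗ₜ[F] b₀ ∈ U.1)
    (h1 : a₁ ⊗ₜ[F] b₁ ∈ U.1)
    (h2 : a₀ ⊗ₜ[F] b₀ ∈ U.1) :
    U ∈ planeOrbit F .o7T := by
  obtain ⟨g, hg⟩ := isParam_o7T.isRep.exists_map_eq (U := U) ha hb (by
    intro k
    fin_cases k
    · simpa [mix_apply, Fin.sum_univ_succ] using h0
    · simpa [mix_apply, Fin.sum_univ_succ] using h1
    · simpa [mix_apply, Fin.sum_univ_succ] using h2
    )
  exact ⟨_, rfl, g, hg⟩

theorem isParam_o8 :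
    IsParam3 (fun x y z : F => !![x, 0, 0; 0, y, z]) where
  linear := by intros; simp
  eq_zero x y z h := by
    simp [← Matrix.ext_iff, Fin.forall_fin_succ] at h
    tauto

theorem mem_o8 {U : PG F 2} {a₀ a₁ : Fin 2 → F} {b₀ b₁ b₂ : Fin 3 → F}
    (ha : LinearIndependent F ![a₀, a₁]) (hb : LinearIndependent F ![b₀, b₁, b₂])
    (h0 : a₀ ⊗ₜ[F] b₀ ∈ U.1)
    (h1 : a₁ ⊗ₜ[F] b₁ ∈ U.1)
    (h2 : a₁ ⊗ₜ[F] b₂ ∈ U.1) :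
    U ∈ planeOrbit F .o8 := by
  obtain ⟨g, hg⟩ := isParam_o8.isRep.exists_map_eq (U := U) ha hb (by
    intro k
    fin_cases k
    · simpa [mix_apply, Fin.sum_univ_succ] using h0
    · simpa [mix_apply, Fin.sum_univ_succ] using h1
    · simpa [mix_apply, Fin.sum_univ_succ] using h2
    )
  exact ⟨_, rfl, g, hg⟩

theorem isParam_o9 :
    IsParam3 (fun x y z : F => !![z, 0, 0; x, y, z]) where
  linear := by intros; simp
  eq_zero x y z h := by
    simp [← Matrix.ext_iff, Fin.forall_fin_succ] at h
    tauto

theorem mem_o9 {U : PG F 2} {a₀ a₁ : Fin 2 → F} {b₀ b₁ b₂ : Fin 3 → F}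
    (ha : LinearIndependent F ![a₀, a₁]) (hb : LinearIndependent F ![b₀, b₁, b₂])
    (h0 : a₁ ⊗ₜ[F] b₀ ∈ U.1)
    (h1 : a₁ ⊗ₜ[F] b₁ ∈ U.1)
    (h2 : a₀ ⊗ₜ[F] b₀ + a₁ ⊗ₜ[F] b₂ ∈ U.1) :
    U ∈ planeOrbit F .o9 := by
  obtain ⟨g, hg⟩ := isParam_o9.isRep.exists_map_eq (U := U) ha hb (by
    intro k
    fin_cases k
    · simpa [mix_apply, Fin.sum_univ_succ] using h0
    · simpa [mix_apply, Fin.sum_univ_succ] using h1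
    · simpa [mix_apply, Fin.sum_univ_succ] using h2
    )
  exact ⟨_, rfl, g, hg⟩

theorem isParam_o11T :
    IsParam3 (fun x y z : F => !![x, y, 0; y, z, 0]) where
  linear := by intros; simp
  eq_zero x y z h := by
    simp [← Matrix.ext_iff, Fin.forall_fin_succ] at h
    tauto

theorem mem_o11T {U : PG F 2} {a₀ a₁ : Fin 2 → F} {b₀ b₁ b₂ : Fin 3 → F}
    (ha : LinearIndependent F ![a₀, a₁]) (hb : LinearIndependent F ![b₀, b₁, b₂])
    (h0 : a₀ ⊗ₜ[F] b₀ ∈ U.1)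
    (h1 : a₀ ⊗ₜ[F] b₁ + a₁ ⊗ₜ[F] b₀ ∈ U.1)
    (h2 : a₁ ⊗ₜ[F] b₁ ∈ U.1) :
    U ∈ planeOrbit F .o11T := by
  obtain ⟨g, hg⟩ := isParam_o11T.isRep.exists_map_eq (U := U) ha hb (by
    intro k
    fin_cases k
    · simpa [mix_apply, Fin.sum_univ_succ] using h0
    · simpa [mix_apply, Fin.sum_univ_succ] using h1
    · simpa [mix_apply, Fin.sum_univ_succ] using h2
    )
  exact ⟨_, rfl, g, hg⟩

theorem isParam_o12 :
    IsParam3 (fun x y z : F => !![x, y, 0; 0, z, x]) where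
  linear := by intros; simp
  eq_zero x y z h := by
    simp [← Matrix.ext_iff, Fin.forall_fin_succ] at h
    tauto

theorem mem_o12 {U : PG F 2} {a₀ a₁ : Fin 2 → F} {b₀ b₁ b₂ : Fin 3 → F}
    (ha : LinearIndependent F ![a₀, a₁]) (hb : LinearIndependent F ![b₀, b₁, b₂])
    (h0 : a₀ ⊗ₜ[F] b₀ + a₁ ⊗ₜ[F] b₂ ∈ U.1)
    (h1 : a₀ ⊗ₜ[F] b₁ ∈ U.1)
    (h2 : a₁ ⊗ₜ[F] b₁ ∈ U.1) :
    U ∈ planeOrbit F .o12 := by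
  obtain ⟨g, hg⟩ := isParam_o12.isRep.exists_map_eq (U := U) ha hb (by
    intro k
    fin_cases k
    · simpa [mix_apply, Fin.sum_univ_succ] using h0
    · simpa [mix_apply, Fin.sum_univ_succ] using h1
    · simpa [mix_apply, Fin.sum_univ_succ] using h2
    )
  exact ⟨_, rfl, g, hg⟩

theorem isParam_o13 :
    IsParam3 (fun x y z : F => !![x, y, 0; 0, x, z]) where
  linear := by intros; simp
  eq_zero x y z h := by
    simp [← Matrix.ext_iff, Fin.forall_fin_succ] at h
    tauto

theorem mem_o13 {U : PG F 2} {a₀ a₁ : Fin 2 → F} {b₀ b₁ b₂ : Fin 3 → F}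
    (ha : LinearIndependent F ![a₀, a₁]) (hb : LinearIndependent F ![b₀, b₁, b₂])
    (h0 : a₀ ⊗ₜ[F] b₀ + a₁ ⊗ₜ[F] b₁ ∈ U.1)
    (h1 : a₀ ⊗ₜ[F] b₁ ∈ U.1)
    (h2 : a₁ ⊗ₜ[F] b₂ ∈ U.1) :
    U ∈ planeOrbit F .o13 := by
  obtain ⟨g, hg⟩ := isParam_o13.isRep.exists_map_eq (U := U) ha hb (by
    intro k
    fin_cases k
    · simpa [mix_apply, Fin.sum_univ_succ] using h0
    · simpa [mix_apply, Fin.sum_univ_succ] using h1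
    · simpa [mix_apply, Fin.sum_univ_succ] using h2
    )
  exact ⟨_, rfl, g, hg⟩

theorem isParam_o14 :
    IsParam3 (fun x y z : F => !![x, y, 0; 0, y, z]) where
  linear := by intros; simp
  eq_zero x y z h := by
    simp [← Matrix.ext_iff, Fin.forall_fin_succ] at h
    tauto

theorem mem_o14 {U : PG F 2} {a₀ a₁ : Fin 2 → F} {b₀ b₁ b₂ : Fin 3 → F}
    (ha : LinearIndependent F ![a₀, a₁]) (hb : LinearIndependent F ![b₀, b₁, b₂])
    (h0 : a₀ ⊗ₜ[F] b₀ ∈ U.1)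
    (h1 : a₀ ⊗ₜ[F] b₁ + a₁ ⊗ₜ[F] b₁ ∈ U.1)
    (h2 : a₁ ⊗ₜ[F] b₂ ∈ U.1) :
    U ∈ planeOrbit F .o14 := by
  obtain ⟨g, hg⟩ := isParam_o14.isRep.exists_map_eq (U := U) ha hb (by
    intro k
    fin_cases k
    · simpa [mix_apply, Fin.sum_univ_succ] using h0
    · simpa [mix_apply, Fin.sum_univ_succ] using h1
    · simpa [mix_apply, Fin.sum_univ_succ] using h2
    )
  exact ⟨_, rfl, g, hg⟩

theorem isParam_o15 (u v : F) :
    IsParam3 (fun x y z : F => !![x, u * x + y, z; v * y, x, 0]) where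
  linear := by intros; simp [mul_comm]
  eq_zero x y z h := by
    simp [← Matrix.ext_iff, Fin.forall_fin_succ] at h
    have hx : x = 0 := by tauto
    subst hx
    simpa using h.1.2

theorem mem_o15 {U : PG F 2} {u v : F} (huv : QuadCond u v)
    {a₀ a₁ : Fin 2 → F} {b₀ b₁ b₂ : Fin 3 → F}
    (ha : LinearIndependent F ![a₀, a₁]) (hb : LinearIndependent F ![b₀, b₁, b₂])
    (h0 : a₀ ⊗ₜ[F] b₀ + u• a₀ ⊗ₜ[F] b₁ + a₁ ⊗ₜ[F] b₁ ∈ U.1)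
    (h1 : a₀ ⊗ₜ[F] b₁ + v• a₁ ⊗ₜ[F] b₀ ∈ U.1)
    (h2 : a₀ ⊗ₜ[F] b₂ ∈ U.1) :
    U ∈ planeOrbit F .o15 := by
  obtain ⟨g, hg⟩ := (isParam_o15 u v).isRep.exists_map_eq (U := U) ha hb (by
    intro k
    fin_cases k
    · simpa [mix_apply, Fin.sum_univ_succ] using h0
    · simpa [mix_apply, Fin.sum_univ_succ] using h1
    · simpa [mix_apply, Fin.sum_univ_succ] using h2
    )
  exact ⟨_, ⟨u, v, huv, rfl⟩, g, hg⟩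

theorem isParam_o16 :
    IsParam3 (fun x y z : F => !![x, y, z; 0, x, y]) where
  linear := by intros; simp
  eq_zero x y z h := by
    simp [← Matrix.ext_iff, Fin.forall_fin_succ] at h
    tauto

theorem mem_o16 {U : PG F 2} {a₀ a₁ : Fin 2 → F} {b₀ b₁ b₂ : Fin 3 → F}
    (ha : LinearIndependent F ![a₀, a₁]) (hb : LinearIndependent F ![b₀, b₁, b₂])
    (h0 : a₀ ⊗ₜ[F] b₀ + a₁ ⊗ₜ[F] b₁ ∈ U.1)
    (h1 : a₀ ⊗ₜ[F] b₁ + a₁ ⊗ₜ[F] b₂ ∈ U.1)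
    (h2 : a₀ ⊗ₜ[F] b₂ ∈ U.1) :
    U ∈ planeOrbit F .o16 := by
  obtain ⟨g, hg⟩ := isParam_o16.isRep.exists_map_eq (U := U) ha hb (by
    intro k
    fin_cases k
    · simpa [mix_apply, Fin.sum_univ_succ] using h0
    · simpa [mix_apply, Fin.sum_univ_succ] using h1
    · simpa [mix_apply, Fin.sum_univ_succ] using h2
    )
  exact ⟨_, rfl, g, hg⟩

/-! ### Normal forms of points and lines -/

theorem li_single : LinearIndependent F ![(Pi.single 0 1 : Fin 2 → F), Pi.single 1 1] := by
  rw [li_two]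
  intro x y h
  have h0 := congrFun h 0
  have h1 := congrFun h 1
  simp at h0 h1
  exact ⟨h0, h1⟩

/-- A change of the second basis vector. -/
theorem li_shear {E : Type*} [AddCommGroup E] [Module F E] {v w : E}
    (h : LinearIndependent F ![v, w]) (s : F) : LinearIndependent F ![v, w + s • v] := by
  rw [li_two] at h ⊢
  intro x y e
  obtain ⟨h1, h2⟩ := h (x + y * s) y (by rw [← e]; module)
  subst h2
  exact ⟨by simpa using h1, rfl⟩

theorem li_smul_right {E : Type*} [AddCommGroup E] [Module F E] {v w : E}
    (h : LinearIndependent F ![v, w]) {s : F} (hs : s ≠ 0) :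
    LinearIndependent F ![v, s • w] := by
  rw [li_two] at h ⊢
  intro x y e
  obtain ⟨h1, h2⟩ := h x (y * s) (by rw [← e]; module)
  exact ⟨h1, (mul_eq_zero.1 h2).resolve_right hs⟩

theorem exists_mem_pointOrbit (U : PG F 0) : ∃ t, U ∈ pointOrbit F t := by
  have hU : U.1 ≠ ⊥ := by
    intro h
    have := U.2
    rw [h, finrank_bot] at this
    omega
  obtain ⟨t, ht, h0⟩ := Submodule.exists_mem_ne_zero_of_ne_bot hU
  obtain ⟨c, d, rfl⟩ := exists_rows li_single t
  by_cases hd : d = 0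
  · subst hd
    simp only [TensorProduct.tmul_zero, add_zero] at ht h0
    have hc : c ≠ 0 := by
      rintro rfl
      simp at h0
    obtain ⟨b, hb⟩ := exists_li_pair hc
    obtain ⟨b', hb'⟩ := exists_li_three hb
    exact ⟨.o1, mem_o1 li_single hb' ht⟩
  · rcases li_two_or (F := F) hd c with h | ⟨x, rfl⟩
    · have h' : LinearIndependent F ![c, d] := li_swap h
      obtain ⟨b, hb⟩ := exists_li_three h'
      exact ⟨.o4, mem_o4 li_single hb ht⟩
    · obtain ⟨b, hb⟩ := exists_li_pair hd
      obtain ⟨b', hb'⟩ := exists_li_three hb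
      -- Rows `x • d` and `d` make the tensor pure: it is `(a₁ + x • a₀) ⊗ d`.
      have ha := li_swap (li_shear (li_single (F := F)) x)
      refine ⟨.o1, mem_o1 ha hb' ?_⟩
      convert ht using 1
      simp only [TensorProduct.add_tmul, TensorProduct.tmul_smul, ← TensorProduct.smul_tmul']
      module

/-- A pencil `a₀ ⊗ S d + a₁ ⊗ d`, for a nonscalar endomorphism `S` of a plane, written with respect
to a cyclic basis `d`, `e = S d` of this plane. -/
theorem exists_cyclic {U : Submodule F (V F)} {a₀ a₁ : Fin 2 → F} {d₁ d₂ : Fin 3 → F}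
    {α β γ δ : F} (hS : ¬(β = 0 ∧ γ = 0 ∧ α = δ))
    (h₁ : a₀ ⊗ₜ[F] (α • d₁ + β • d₂) + a₁ ⊗ₜ[F] d₁ ∈ U)
    (h₂ : a₀ ⊗ₜ[F] (γ • d₁ + δ • d₂) + a₁ ⊗ₜ[F] d₂ ∈ U) :
    ∃ (d e : Fin 3 → F) (p q : F),
      (∀ b, LinearIndependent F ![b, d₁, d₂] → LinearIndependent F ![b, d, e]) ∧
      a₀ ⊗ₜ[F] e + a₁ ⊗ₜ[F] d ∈ U ∧ a₀ ⊗ₜ[F] (p • d + q • e) + a₁ ⊗ₜ[F] e ∈ U := by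
  -- The expression is the determinant of `d`, `S d` for `d = x d₁ + y d₂`. As a quadratic form in
  -- `x, y` it vanishes at (1,0), (0,1) and (1,1) only if `S` is scalar, so one of these three
  -- vectors is cyclic over any field.
  obtain ⟨x, y, hxy⟩ : ∃ x y : F, x * (x * β + y * δ) - y * (x * α + y * γ) ≠ 0 := by
    by_contra! h
    have e1 := h 1 0
    have e2 := h 0 1
    have e3 := h 1 1
    simp only [one_mul, zero_mul, add_zero, sub_zero, zero_add, zero_sub, neg_eq_zero] at e1 e2 e3
    subst e1 e2
    exact hS ⟨rfl, rfl, by linear_combination -e3⟩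
  -- By Cayley–Hamilton `S e = p d + q e`, where `p` is minus the determinant and `q` the trace of
  -- `S`.
  refine ⟨x • d₁ + y • d₂, (x * α + y * γ) • d₁ + (x * β + y * δ) • d₂,
    β * γ - α * δ, α + δ, ?_, ?_, ?_⟩
  · intro b hb
    rw [li_three] at hb ⊢
    intro r s t e
    obtain ⟨h0, h1, h2⟩ := hb r (s * x + t * (x * α + y * γ)) (s * y + t * (x * β + y * δ))
      (by rw [← e]; module)
    refine ⟨h0, ?_, ?_⟩
    · refine (mul_eq_zero.1 (?_ : s * _ = 0)).resolve_right hxy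
      linear_combination (x * β + y * δ) * h1 - (x * α + y * γ) * h2
    · refine (mul_eq_zero.1 (?_ : t * _ = 0)).resolve_right hxy
      linear_combination x * h2 - y * h1
  · convert U.add_mem (U.smul_mem x h₁) (U.smul_mem y h₂) using 1
    simp only [TensorProduct.tmul_add, TensorProduct.tmul_smul]
    module
  · convert U.add_mem (U.smul_mem (x * α + y * γ) h₁) (U.smul_mem (x * β + y * δ) h₂) using 1
    simp only [TensorProduct.tmul_add, TensorProduct.tmul_smul]
    module

/-- Only the second generator `a₀ ⊗ c + a₁ ⊗ d`, modulo `a₀ ⊗ b₀`, matters. If `d` is independent of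
`b₀`, the question is whether `c` lies in their span (o₅) or not (o₇). If `d` is a multiple of `b₀`,
the cases are whether `d` is zero and whether `c` is a multiple of `b₀` too (o₂, o₆, o₄ᵀ). -/
theorem exists_mem_lineOrbit_of_pure {U : PG F 1} {a₀ : Fin 2 → F} {b₀ : Fin 3 → F}
    (ha₀ : a₀ ≠ 0) (hb₀ : b₀ ≠ 0) (h₀ : a₀ ⊗ₜ[F] b₀ ∈ U.1) : ∃ t, U ∈ lineOrbit F t := by
  obtain ⟨a₁, ha⟩ := exists_li_two ha₀
  obtain ⟨t, ht, hs⟩ := exists_mem_notMem_span (s := ![a₀ ⊗ₜ[F] b₀])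
    (show 1 < Module.finrank F U.1 by rw [U.2]; omega)
  obtain ⟨c, d, rfl⟩ := exists_rows ha t
  simp only [Matrix.range_cons, Matrix.range_empty, Set.union_empty,
    Submodule.mem_span_singleton] at hs
  rcases li_two_or (F := F) hb₀ d with hd | ⟨s, rfl⟩
  · rcases li_three_or hd c with hc | ⟨x, y, rfl⟩
    · refine ⟨.o7, mem_o7 (b₀ := c) ha (li_rotate (li_rotate hc)) ht h₀⟩
    · obtain ⟨b, hb⟩ := exists_li_three hd
      refine ⟨.o5, mem_o5 (li_shear ha y) hb h₀ ?_⟩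
      convert U.1.sub_mem ht (U.1.smul_mem x h₀) using 1
      simp only [TensorProduct.add_tmul, TensorProduct.tmul_add, TensorProduct.tmul_smul,
        ← TensorProduct.smul_tmul']
      module
  · rcases eq_or_ne s 0 with rfl | hs0
    · simp only [zero_smul, TensorProduct.tmul_zero, add_zero] at ht hs
      rcases li_two_or (F := F) hb₀ c with hc | ⟨x, rfl⟩
      · obtain ⟨b, hb⟩ := exists_li_three hc
        exact ⟨.o2, mem_o2 ha hb h₀ ht⟩
      · exact absurd ⟨x, by simp⟩ hs
    · rcases li_two_or (F := F) hb₀ c with hc | ⟨x, rfl⟩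
      · obtain ⟨b, hb⟩ := exists_li_three hc
        refine ⟨.o6, mem_o6 (li_swap (li_smul_right ha hs0)) hb ?_ h₀⟩
        convert ht using 1
        simp only [TensorProduct.tmul_smul, ← TensorProduct.smul_tmul']
        module
      · obtain ⟨b, hb⟩ := exists_li_pair hb₀
        obtain ⟨b', hb'⟩ := exists_li_three hb
        refine ⟨.o4T, mem_o4T (li_smul_right ha hs0) hb' h₀ ?_⟩
        convert U.1.sub_mem ht (U.1.smul_mem x h₀) using 1
        simp only [TensorProduct.tmul_smul, ← TensorProduct.smul_tmul']
        module

/-- The row `c` supplies the third dimension. Subtracting a multiple of the first generator from the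
second and shearing `a₁` brings the pencil to the o₁₁ shape; the one coefficient that could obstruct
this is nonzero because `U` has no pure tensors. -/
theorem mem_o11_of_rows {U : PG F 1} {a₀ a₁ : Fin 2 → F} {c c' d d' : Fin 3 → F}
    (hU : ∀ a b, a ≠ 0 → b ≠ 0 → a ⊗ₜ[F] b ∉ U.1) (ha : LinearIndependent F ![a₀, a₁])
    (hb : LinearIndependent F ![d, d', c]) (h₁ : a₀ ⊗ₜ[F] c + a₁ ⊗ₜ[F] d ∈ U.1)
    (h₂ : a₀ ⊗ₜ[F] c' + a₁ ⊗ₜ[F] d' ∈ U.1) : U ∈ lineOrbit F .o11 := by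
  obtain ⟨x, y, z, rfl⟩ := exists_coords_three hb c'
  have ha' := li_shear ha y
  -- With `c' = x d + y d' + z c`, subtracting `z` times the first tensor removes `c` from the
  -- second. Replacing `a₁` by `a₁ + y a₀` then absorbs `d'` and leaves a multiple of `a₀ ⊗ d`.
  have h3 : (x + y * z) • (a₀ ⊗ₜ[F] d) + (a₁ + y • a₀) ⊗ₜ[F] (d' - z • d) ∈ U.1 := by
    convert U.1.sub_mem h₂ (U.1.smul_mem z h₁) using 1
    simp only [TensorProduct.add_tmul, TensorProduct.tmul_add, TensorProduct.tmul_sub,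
      TensorProduct.tmul_smul, ← TensorProduct.smul_tmul']
    module
  have hxyz : x + y * z ≠ 0 := by
    intro h0
    rw [h0, zero_smul, zero_add] at h3
    refine hU _ _ (li_right_ne ha') (fun h => ?_) h3
    have := (li_two.1 (li_init hb) (-z) 1 (by rw [← h]; module)).2
    exact one_ne_zero this
  refine mem_o11 (b₀ := c - y • d) (b₁ := d) (b₂ := (x + y * z)⁻¹ • (d' - z • d)) ha' ?_ ?_ ?_
  · rw [li_three] at hb ⊢
    intro r s t e
    obtain ⟨h0, h1, h2⟩ := hb (s - r * y - t * (x + y * z)⁻¹ * z) (t * (x + y * z)⁻¹) r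
      (by rw [← e]; module)
    have ht : t = 0 := (mul_eq_zero.1 h1).resolve_right (inv_ne_zero hxyz)
    subst ht h2
    exact ⟨rfl, by simpa using h0, rfl⟩
  · convert h₁ using 1
    simp only [TensorProduct.add_tmul, TensorProduct.tmul_sub,
      TensorProduct.tmul_smul, ← TensorProduct.smul_tmul']
    module
  · convert U.1.smul_mem (x + y * z)⁻¹ h3 using 1
    rw [smul_add, smul_smul, inv_mul_cancel₀ hxyz, one_smul, TensorProduct.tmul_smul]

/-- The root of the quadratic gives a rank one tensor. -/
theorem pure_mem_of_root {U : Submodule F (V F)} {a₀ a₁ : Fin 2 → F} {d e : Fin 3 → F} {p q l : F}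
    (h₁ : a₀ ⊗ₜ[F] e + a₁ ⊗ₜ[F] d ∈ U) (h₂ : a₀ ⊗ₜ[F] (p • d + q • e) + a₁ ⊗ₜ[F] e ∈ U)
    (hl : l ^ 2 = q * l + p) : (a₁ + l • a₀) ⊗ₜ[F] (e - (q - l) • d) ∈ U := by
  -- Here `p = -l (q - l)`, so the second tensor minus `q - l` times the first has first row `l (e -
  -- (q - l) d)`, which is `l` times its second row.
  obtain rfl : p = l ^ 2 - q * l := by rw [hl]; ring
  convert U.sub_mem h₂ (U.smul_mem (q - l) h₁) using 1
  simp only [TensorProduct.add_tmul, TensorProduct.tmul_add, TensorProduct.tmul_sub,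
    TensorProduct.tmul_smul, ← TensorProduct.smul_tmul']
  module

/-- Multiplying `p⁻¹ λ² + q p⁻¹ λ - 1` by `p` and substituting `λ = -l` gives `l² - q l - p`; `p` is
nonzero because 0 is not a root. -/
theorem quadCond_of_no_root {p q : F} (h : ∀ l : F, l ^ 2 ≠ q * l + p) : QuadCond q p⁻¹ := by
  have hp : p ≠ 0 := by
    rintro rfl
    exact h 0 (by simp)
  refine ⟨inv_ne_zero hp, fun l hl => h (-l) ?_⟩
  field_simp at hl
  linear_combination hl

theorem exists_mem_lineOrbit (U : PG F 1) : ∃ t, U ∈ lineOrbit F t := by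
  by_cases hU : ∀ a b, a ≠ 0 → b ≠ 0 → a ⊗ₜ[F] b ∉ U.1
  swap
  · push Not at hU
    obtain ⟨a, b, ha, hb, h⟩ := hU
    exact exists_mem_lineOrbit_of_pure ha hb h
  obtain ⟨t, ht, hli⟩ := exists_li_of_finrank U.2
  have ha := li_single (F := F)
  obtain ⟨c₁, d₁, e₁⟩ := exists_rows ha (t 0)
  obtain ⟨c₂, d₂, e₂⟩ := exists_rows ha (t 1)
  have h₁ := ht 0
  have h₂ := ht 1
  rw [e₁] at h₁
  rw [e₂] at h₂
  set a₀ : Fin 2 → F := Pi.single 0 1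
  set a₁ : Fin 2 → F := Pi.single 1 1
  -- A relation between the second rows would leave a tensor `a₀ ⊗ c` in `U`. It is not pure by
  -- `hU`, so `c = 0`, and the relation extends to the two generators.
  have hd : LinearIndependent F ![d₁, d₂] := by
    rw [li_two]
    intro x y e
    have hm : a₀ ⊗ₜ[F] (x • c₁ + y • c₂) ∈ U.1 := by
      convert U.1.add_mem (U.1.smul_mem x h₁) (U.1.smul_mem y h₂) using 1
      rw [← add_zero (a₀ ⊗ₜ[F] _), ← TensorProduct.tmul_zero (R := F) (N := Fin 3 → F) a₁, ← e]
      simp only [TensorProduct.tmul_add, TensorProduct.tmul_smul]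
      module
    have h0 : x • c₁ + y • c₂ = 0 := by
      by_contra h0
      exact hU _ _ (li_left_ne ha) h0 hm
    suffices hs : x • t 0 + y • t 1 = 0 by
      have := Fintype.linearIndependent_iff.1 hli ![x, y] (by simpa [Fin.sum_univ_two] using hs)
      exact ⟨this 0, this 1⟩
    rw [e₁, e₂]
    trans a₀ ⊗ₜ[F] (x • c₁ + y • c₂) + a₁ ⊗ₜ[F] (x • d₁ + y • d₂)
    · simp only [TensorProduct.tmul_add, TensorProduct.tmul_smul]
      module
    · rw [h0, e]
      simp
  rcases li_three_or hd c₁ with hc | ⟨α, β, rfl⟩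
  · exact ⟨.o11, mem_o11_of_rows hU ha hc h₁ h₂⟩
  rcases li_three_or hd c₂ with hc | ⟨γ, δ, rfl⟩
  · exact ⟨.o11, mem_o11_of_rows hU ha (li_swap_left hc) h₂ h₁⟩
  -- Both first rows are now in the span of `d₁, d₂`, so the line is the pencil of an endomorphism
  -- `S`. A scalar `S = α` would make `(a₁ + α a₀) ⊗ d₁` an element of `U`.
  by_cases hS : β = 0 ∧ γ = 0 ∧ α = δ
  · obtain ⟨rfl, rfl, rfl⟩ := hS
    refine absurd ?_ (hU (a₁ + α • a₀) d₁ (li_right_ne (li_shear ha α)) (li_left_ne hd))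
    convert h₁ using 1
    simp only [TensorProduct.add_tmul, TensorProduct.tmul_add,
      TensorProduct.tmul_smul, ← TensorProduct.smul_tmul']
    module
  obtain ⟨d, e, p, q, hb, h₁, h₂⟩ := exists_cyclic hS h₁ h₂
  obtain ⟨b, hb'⟩ := exists_li_three hd
  have hb' := hb b (li_rotate (li_rotate hb'))
  have hq : ∀ l : F, l ^ 2 ≠ q * l + p := by
    intro l hl
    refine hU _ _ (li_right_ne (li_shear ha l)) (fun h => ?_) (pure_mem_of_root h₁ h₂ hl)
    have := (li_three.1 hb' 0 (-(q - l)) 1 (by rw [← h]; module)).2.2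
    exact one_ne_zero this
  have hp := (quadCond_of_no_root hq).1
  -- The o₁₀ generators with `u = q`, `v = p⁻¹`: taking `b₀ = e - q d` makes the first one equal to
  -- `h₁`, and the second one is `p⁻¹ (h₂ - q h₁)`.
  refine ⟨.o10, mem_o10 (quadCond_of_no_root hq) (b₀ := e - q • d) (b₁ := d) (b₂ := b) ha ?_ ?_ ?_⟩
  · rw [li_three] at hb' ⊢
    intro x y z h
    obtain ⟨h0, h1, h2⟩ := hb' z (y - x * q) x (by rw [← h]; module)
    subst h2
    exact ⟨rfl, by simpa using h1, h0⟩
  · convert h₁ using 1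
    simp only [TensorProduct.tmul_sub, TensorProduct.tmul_smul]
    module
  · have hpp : p⁻¹ * p = 1 := inv_mul_cancel₀ (by simpa using hp)
    convert U.1.smul_mem p⁻¹ (U.1.sub_mem h₂ (U.1.smul_mem q h₁)) using 1
    simp only [TensorProduct.tmul_sub, TensorProduct.tmul_add, TensorProduct.tmul_smul]
    trans (p⁻¹ * p) • (a₀ ⊗ₜ[F] d) + p⁻¹ • (a₁ ⊗ₜ[F] e - q • a₁ ⊗ₜ[F] d)
    · rw [hpp, one_smul]
    · module

/-! ### Normal forms of planes -/

/-- The plane contains `a₀ ⊗ ⟨b₀, b₁⟩`, so its type depends on a third tensor `a₀ ⊗ c + a₁ ⊗ d`. If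
`d` is outside `⟨b₀, b₁⟩` it is o₈, and if `d = 0` it is o₃. For nonzero `d` inside, `c` outside
gives o₉ and `c` inside gives o₇ᵀ. -/
theorem exists_mem_planeOrbit_of_pure_line {U : PG F 2} {a₀ : Fin 2 → F} {b₀ b₁ : Fin 3 → F}
    (ha₀ : a₀ ≠ 0) (hb : LinearIndependent F ![b₀, b₁]) (h₀ : a₀ ⊗ₜ[F] b₀ ∈ U.1)
    (h₁ : a₀ ⊗ₜ[F] b₁ ∈ U.1) : ∃ t, U ∈ planeOrbit F t := by
  obtain ⟨a₁, ha⟩ := exists_li_two ha₀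
  obtain ⟨t, ht, hs⟩ := exists_mem_notMem_span (s := ![a₀ ⊗ₜ[F] b₀, a₀ ⊗ₜ[F] b₁])
    (show 2 < Module.finrank F U.1 by rw [U.2]; omega)
  obtain ⟨c, d, rfl⟩ := exists_rows ha t
  have hcomb : ∀ x y : F, a₀ ⊗ₜ[F] (x • b₀ + y • b₁) ∈ U.1 := by
    intro x y
    rw [TensorProduct.tmul_add, TensorProduct.tmul_smul, TensorProduct.tmul_smul]
    exact U.1.add_mem (U.1.smul_mem x h₀) (U.1.smul_mem y h₁)
  rcases li_three_or hb d with hd | ⟨x, y, rfl⟩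
  · obtain ⟨x, y, z, rfl⟩ := exists_coords_three hd c
    refine ⟨.o8, mem_o8 (li_swap (li_shear ha z)) (li_rotate (li_rotate hd)) ?_ h₀ h₁⟩
    convert U.1.sub_mem ht (hcomb x y) using 1
    simp only [TensorProduct.add_tmul, TensorProduct.tmul_add, TensorProduct.tmul_smul,
      ← TensorProduct.smul_tmul']
    module
  by_cases hxy : x = 0 ∧ y = 0
  · obtain ⟨rfl, rfl⟩ := hxy
    simp only [zero_smul, add_zero, TensorProduct.tmul_zero] at ht hs
    rcases li_three_or hb c with hc | ⟨r, s, rfl⟩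
    · exact ⟨.o3, mem_o3 ha hc h₀ h₁ ht⟩
    · refine absurd ?_ hs
      rw [TensorProduct.tmul_add, TensorProduct.tmul_smul, TensorProduct.tmul_smul]
      exact add_mem (Submodule.smul_mem _ _ (Submodule.subset_span ⟨0, rfl⟩))
        (Submodule.smul_mem _ _ (Submodule.subset_span ⟨1, rfl⟩))
  -- `d'` is whichever of `b₀`, `b₁` completes `d = x b₀ + y b₁` to a basis of `⟨b₀, b₁⟩`.
  obtain ⟨d', hd', h₂⟩ : ∃ d', (∀ c, LinearIndependent F ![b₀, b₁, c] →
      LinearIndependent F ![x • b₀ + y • b₁, d', c]) ∧ a₀ ⊗ₜ[F] d' ∈ U.1 := by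
    rcases eq_or_ne x 0 with rfl | hx
    · have hy : y ≠ 0 := fun h => hxy ⟨rfl, h⟩
      refine ⟨b₀, fun c hc => ?_, h₀⟩
      rw [li_three] at hc ⊢
      intro r s t e
      obtain ⟨g0, g1, g2⟩ := hc s (r * y) t (by rw [← e]; module)
      exact ⟨(mul_eq_zero.1 g1).resolve_right hy, g0, g2⟩
    · refine ⟨b₁, fun c hc => ?_, h₁⟩
      rw [li_three] at hc ⊢
      intro r s t e
      obtain ⟨g0, g1, g2⟩ := hc (r * x) (s + r * y) t (by rw [← e]; module)
      have hr := (mul_eq_zero.1 g0).resolve_right hx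
      subst hr
      exact ⟨rfl, by simpa using g1, g2⟩
  rcases li_three_or hb c with hc | ⟨r, s, rfl⟩
  · refine ⟨.o9, mem_o9 (li_swap ha) (hd' c hc) (hcomb x y) h₂ ?_⟩
    convert ht using 1
    exact add_comm _ _
  · obtain ⟨b₂, hb₂⟩ := exists_li_three hb
    refine ⟨.o7T, mem_o7T (li_swap ha) (hd' b₂ hb₂) (hcomb x y) h₂ ?_⟩
    convert U.1.sub_mem ht (hcomb r s) using 1
    module

/-- The last two generators are the pencil of an endomorphism with characteristic polynomial `l² - q
l - p`. Each root gives a pure tensor besides `a₀ ⊗ b₀`, so the number of roots selects o₁₅, o₁₃ or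
o₁₄. -/
theorem exists_mem_planeOrbit_of_cyclic {U : PG F 2} {a₀ a₁ : Fin 2 → F} {b₀ d e : Fin 3 → F}
    {p q : F} (ha : LinearIndependent F ![a₀, a₁]) (hb : LinearIndependent F ![b₀, d, e])
    (h₀ : a₀ ⊗ₜ[F] b₀ ∈ U.1) (h₁ : a₀ ⊗ₜ[F] e + a₁ ⊗ₜ[F] d ∈ U.1)
    (h₂ : a₀ ⊗ₜ[F] (p • d + q • e) + a₁ ⊗ₜ[F] e ∈ U.1) : ∃ t, U ∈ planeOrbit F t := by
  by_cases hq : ∀ l : F, l ^ 2 ≠ q * l + p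
  · have hp := (quadCond_of_no_root hq).1
    refine ⟨.o15, mem_o15 (quadCond_of_no_root hq) (b₀ := e - q • d) (b₁ := d) (b₂ := b₀)
      ha ?_ ?_ ?_ h₀⟩
    · rw [li_three] at hb ⊢
      intro x y z h
      obtain ⟨h0, h1, h2⟩ := hb z (y - x * q) x (by rw [← h]; module)
      subst h2
      exact ⟨rfl, by simpa using h1, h0⟩
    · convert h₁ using 1
      simp only [TensorProduct.tmul_sub, TensorProduct.tmul_smul]
      module
    · have hpp : p⁻¹ * p = 1 := inv_mul_cancel₀ (by simpa using hp)
      convert U.1.smul_mem p⁻¹ (U.1.sub_mem h₂ (U.1.smul_mem q h₁)) using 1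
      simp only [TensorProduct.tmul_sub, TensorProduct.tmul_add, TensorProduct.tmul_smul]
      trans (p⁻¹ * p) • (a₀ ⊗ₜ[F] d) + p⁻¹ • (a₁ ⊗ₜ[F] e - q • a₁ ⊗ₜ[F] d)
      · rw [hpp, one_smul]
      · module
  push Not at hq
  obtain ⟨l, hl⟩ := hq
  have g₁ := pure_mem_of_root h₁ h₂ hl
  -- One root forces the other: `l` and `m` have sum `q` and product `-p`.
  obtain ⟨m, rfl⟩ : ∃ m, q = l + m := ⟨q - l, by ring⟩
  obtain rfl : p = -(l * m) := by linear_combination -hl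
  have g₂ := pure_mem_of_root (l := m) h₁ h₂ (by ring)
  simp only [add_sub_cancel_left, add_sub_cancel_right] at g₁ g₂
  rcases eq_or_ne l m with rfl | hlm
  · refine ⟨.o13, mem_o13 (b₀ := d) (b₁ := e - l • d) (b₂ := b₀) (li_swap (li_shear ha l))
      ?_ ?_ g₁ h₀⟩
    · rw [li_three] at hb ⊢
      intro x y z h
      obtain ⟨h0, h1, h2⟩ := hb z (x - y * l) y (by rw [← h]; module)
      subst h2
      exact ⟨by simpa using h1, rfl, h0⟩
    · convert h₁ using 1
      simp only [TensorProduct.add_tmul, TensorProduct.tmul_sub, TensorProduct.tmul_smul,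
        ← TensorProduct.smul_tmul']
      module
  · have hlm' : l - m ≠ 0 := sub_ne_zero.2 hlm
    -- The three pure tensors are `(a₁ + l a₀) ⊗ (e - m d)`, `(a₁ + m a₀) ⊗ (e - l d)` and `a₀ ⊗
    -- b₀`. The minus sign makes the two left factors add up to `(l - m) a₀`, as the middle
    -- generator of o₁₄ requires.
    refine ⟨.o14, mem_o14 (a₀ := a₁ + l • a₀) (a₁ := -(a₁ + m • a₀)) (b₀ := e - m • d) (b₁ := b₀)
      (b₂ := e - l • d) ?_ ?_ g₁ ?_ ?_⟩
    · rw [li_two] at ha ⊢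
      intro x y h
      obtain ⟨h0, h1⟩ := ha (x * l - y * m) (x - y) (by rw [← h]; module)
      obtain rfl := sub_eq_zero.1 h1
      have hx : x = 0 := (mul_eq_zero.1 (by rw [← h0]; ring : x * (l - m) = 0)).resolve_right hlm'
      exact ⟨hx, hx⟩
    · rw [li_three] at hb ⊢
      intro x y z h
      obtain ⟨h0, h1, h2⟩ := hb y (-(x * m + z * l)) (x + z) (by rw [← h]; module)
      obtain rfl : z = -x := by linear_combination h2
      have hx : x = 0 := (mul_eq_zero.1 (by rw [← h1]; ring : x * (l - m) = 0)).resolve_right hlm'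
      subst hx
      exact ⟨rfl, h0, by simp⟩
    · convert U.1.smul_mem (l - m) h₀ using 1
      simp only [← TensorProduct.add_tmul, TensorProduct.smul_tmul']
      congr 1
      module
    · rw [TensorProduct.neg_tmul]
      exact U.1.neg_mem g₂

/-- Multiples of `a₀ ⊗ b₀` clear the `b₀` components of the first rows, which leaves an endomorphism
of the span of `d₁, d₂`. If it is a scalar `α`, both generators have the left factor `a₁ + α a₀` and
the plane contains a line of the first kind. -/
theorem exists_mem_planeOrbit_of_li {U : PG F 2} {a₀ a₁ : Fin 2 → F} {b₀ c₁ c₂ d₁ d₂ : Fin 3 → F}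
    (ha : LinearIndependent F ![a₀, a₁]) (hb : LinearIndependent F ![b₀, d₁, d₂])
    (h₀ : a₀ ⊗ₜ[F] b₀ ∈ U.1) (h₁ : a₀ ⊗ₜ[F] c₁ + a₁ ⊗ₜ[F] d₁ ∈ U.1)
    (h₂ : a₀ ⊗ₜ[F] c₂ + a₁ ⊗ₜ[F] d₂ ∈ U.1) : ∃ t, U ∈ planeOrbit F t := by
  obtain ⟨x, α, β, rfl⟩ := exists_coords_three hb c₁
  obtain ⟨y, γ, δ, rfl⟩ := exists_coords_three hb c₂
  have h₁ : a₀ ⊗ₜ[F] (α • d₁ + β • d₂) + a₁ ⊗ₜ[F] d₁ ∈ U.1 := by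
    convert U.1.sub_mem h₁ (U.1.smul_mem x h₀) using 1
    simp only [TensorProduct.tmul_add, TensorProduct.tmul_smul]
    module
  have h₂ : a₀ ⊗ₜ[F] (γ • d₁ + δ • d₂) + a₁ ⊗ₜ[F] d₂ ∈ U.1 := by
    convert U.1.sub_mem h₂ (U.1.smul_mem y h₀) using 1
    simp only [TensorProduct.tmul_add, TensorProduct.tmul_smul]
    module
  by_cases hS : β = 0 ∧ γ = 0 ∧ α = δ
  · obtain ⟨rfl, rfl, rfl⟩ := hS
    refine exists_mem_planeOrbit_of_pure_line (li_right_ne (li_shear ha α))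
      (li_init (li_rotate hb)) ?_ ?_
    · convert h₁ using 1
      simp only [TensorProduct.add_tmul, TensorProduct.tmul_add,
        TensorProduct.tmul_smul, ← TensorProduct.smul_tmul']
      module
    · convert h₂ using 1
      simp only [TensorProduct.add_tmul, TensorProduct.tmul_add,
        TensorProduct.tmul_smul, ← TensorProduct.smul_tmul']
      module
  · obtain ⟨d, e, p, q, hde, h₁, h₂⟩ := exists_cyclic hS h₁ h₂
    exact exists_mem_planeOrbit_of_cyclic ha (hde b₀ hb) h₀ h₁ h₂

/-- The second row of each tensor is the first row of the preceding one. The chain `b₀, c, c'`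
either spans F³, which is the shape of o₁₆, or closes up in `⟨b₀, c⟩`; in that case shearing `a₁`
makes the three tensors symmetric, as in o₁₁ᵀ. -/
theorem exists_mem_planeOrbit_of_chain {U : PG F 2} {a₀ a₁ : Fin 2 → F} {b₀ c c' : Fin 3 → F}
    (ha : LinearIndependent F ![a₀, a₁]) (hc : LinearIndependent F ![b₀, c])
    (h₀ : a₀ ⊗ₜ[F] b₀ ∈ U.1) (h₁ : a₀ ⊗ₜ[F] c + a₁ ⊗ₜ[F] b₀ ∈ U.1)
    (h₂ : a₀ ⊗ₜ[F] c' + a₁ ⊗ₜ[F] c ∈ U.1) : ∃ t, U ∈ planeOrbit F t := by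
  rcases li_three_or hc c' with hb | ⟨x, y, rfl⟩
  · exact ⟨.o16, mem_o16 ha (li_rotate (li_rotate (li_swap_left hb))) h₂ h₁ h₀⟩
  · obtain ⟨b, hb⟩ := exists_li_three hc
    refine ⟨.o11T, mem_o11T (li_shear ha y) hb h₀ ?_ ?_⟩
    · convert U.1.add_mem h₁ (U.1.smul_mem y h₀) using 1
      simp only [TensorProduct.add_tmul, ← TensorProduct.smul_tmul']
      module
    · convert U.1.sub_mem h₂ (U.1.smul_mem x h₀) using 1
      simp only [TensorProduct.add_tmul, TensorProduct.tmul_add,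
        TensorProduct.tmul_smul, ← TensorProduct.smul_tmul']
      module

/-- Here `U` contains a tangent tensor `a₀ ⊗ c + a₁ ⊗ b₀` at the point `a₀ ⊗ b₀`. The cases are `c`
outside `⟨b₀, d⟩` (o₁₃), `c` inside but not a multiple of `b₀` (a chain), and `c` a multiple of
`b₀`. In the last case `U` contains all of F² ⊗ `b₀`, and is o₁₂ or contains a line of the first
kind. -/
theorem exists_mem_planeOrbit_of_mem {U : PG F 2} {a₀ a₁ : Fin 2 → F} {b₀ c c' d : Fin 3 → F}
    (ha : LinearIndependent F ![a₀, a₁]) (hd : LinearIndependent F ![b₀, d])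
    (h₀ : a₀ ⊗ₜ[F] b₀ ∈ U.1) (h₁ : a₀ ⊗ₜ[F] c + a₁ ⊗ₜ[F] b₀ ∈ U.1)
    (h₂ : a₀ ⊗ₜ[F] c' + a₁ ⊗ₜ[F] d ∈ U.1) : ∃ t, U ∈ planeOrbit F t := by
  rcases li_two_or (F := F) (li_left_ne hd) c with hc | ⟨x, rfl⟩
  · rcases li_three_or hd c with hb | ⟨x, y, rfl⟩
    · obtain ⟨r, s, t, rfl⟩ := exists_coords_three hb c'
      -- Subtracting `t h₁` and `(r + s t) h₀` from `h₂` leaves the pure tensor `(a₁ + s a₀) ⊗ (d -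
      -- t b₀)`.
      refine ⟨.o13, mem_o13 (b₀ := c) (b₁ := b₀) (b₂ := d - t • b₀) (li_shear ha s) ?_ ?_ h₀ ?_⟩
      · rw [li_three] at hb ⊢
        intro x y z h
        obtain ⟨h0, h1, h2⟩ := hb (y - z * t) z x (by rw [← h]; module)
        subst h1
        exact ⟨h2, by simpa using h0, rfl⟩
      · convert U.1.add_mem h₁ (U.1.smul_mem s h₀) using 1
        simp only [TensorProduct.add_tmul, ← TensorProduct.smul_tmul']
        module
      · convert U.1.sub_mem (U.1.sub_mem h₂ (U.1.smul_mem t h₁)) (U.1.smul_mem (r + s * t) h₀)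
          using 1
        simp only [TensorProduct.add_tmul, TensorProduct.tmul_add, TensorProduct.tmul_sub,
          TensorProduct.tmul_smul, ← TensorProduct.smul_tmul']
        module
    -- Since `c = x b₀ + y d`, the combination `y h₂ + x h₁` has second row `c`, the next link of
    -- the chain.
    · refine exists_mem_planeOrbit_of_chain (c' := y • c' + x • (x • b₀ + y • d)) ha hc h₀ h₁ ?_
      convert U.1.add_mem (U.1.smul_mem y h₂) (U.1.smul_mem x h₁) using 1
      simp only [TensorProduct.tmul_add, TensorProduct.tmul_smul]
      module
  · have h₃ : a₁ ⊗ₜ[F] b₀ ∈ U.1 := by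
      convert U.1.sub_mem h₁ (U.1.smul_mem x h₀) using 1
      simp only [TensorProduct.tmul_smul]
      module
    rcases li_three_or hd c' with hb | ⟨r, s, rfl⟩
    · exact ⟨.o12, mem_o12 ha (li_rotate (li_rotate hb)) h₂ h₀ h₃⟩
    · refine exists_mem_planeOrbit_of_pure_line (li_right_ne (li_shear ha s)) hd ?_ ?_
      · convert U.1.add_mem h₃ (U.1.smul_mem s h₀) using 1
        simp only [TensorProduct.add_tmul, ← TensorProduct.smul_tmul']
      · convert U.1.sub_mem h₂ (U.1.smul_mem r h₀) using 1
        simp only [TensorProduct.add_tmul, TensorProduct.tmul_add,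
          TensorProduct.tmul_smul, ← TensorProduct.smul_tmul']
        module

/-- Complete `a₀ ⊗ b₀` to a basis by tensors with second rows `d₁, d₂`. If these are dependent, some
combination lies in `a₀ ⊗ F³` and yields a line of the first kind. If they are independent, `b₀` is
either outside their span or inside it; inside, a combination has second row `b₀`. -/
theorem exists_mem_planeOrbit_of_pure {U : PG F 2} {a₀ : Fin 2 → F} {b₀ : Fin 3 → F}
    (ha₀ : a₀ ≠ 0) (hb₀ : b₀ ≠ 0) (h₀ : a₀ ⊗ₜ[F] b₀ ∈ U.1) : ∃ t, U ∈ planeOrbit F t := by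
  obtain ⟨a₁, ha⟩ := exists_li_two ha₀
  obtain ⟨t₁, h₁, hs₁⟩ := exists_mem_notMem_span (s := ![a₀ ⊗ₜ[F] b₀])
    (show 1 < Module.finrank F U.1 by rw [U.2]; omega)
  obtain ⟨t₂, h₂, hs₂⟩ := exists_mem_notMem_span (s := ![a₀ ⊗ₜ[F] b₀, t₁])
    (show 2 < Module.finrank F U.1 by rw [U.2]; omega)
  obtain ⟨c₁, d₁, rfl⟩ := exists_rows ha t₁
  obtain ⟨c₂, d₂, rfl⟩ := exists_rows ha t₂
  rcases eq_or_ne d₁ 0 with rfl | hd₁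
  · simp only [TensorProduct.tmul_zero, add_zero] at h₁ hs₁
    rcases li_two_or (F := F) hb₀ c₁ with hc | ⟨x, rfl⟩
    · exact exists_mem_planeOrbit_of_pure_line ha₀ hc h₀ h₁
    · refine absurd ?_ hs₁
      rw [TensorProduct.tmul_smul]
      exact Submodule.smul_mem _ _ (Submodule.subset_span ⟨0, rfl⟩)
  rcases li_two_or (F := F) hd₁ d₂ with hd | ⟨x, rfl⟩
  · rcases li_three_or hd b₀ with hb | ⟨x, y, rfl⟩
    · exact exists_mem_planeOrbit_of_li ha (li_rotate (li_rotate hb)) h₀ h₁ h₂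
    · have h₃ : a₀ ⊗ₜ[F] (x • c₁ + y • c₂) + a₁ ⊗ₜ[F] (x • d₁ + y • d₂) ∈ U.1 := by
        convert U.1.add_mem (U.1.smul_mem x h₁) (U.1.smul_mem y h₂) using 1
        simp only [TensorProduct.tmul_add, TensorProduct.tmul_smul]
        module
      rcases li_two_or (F := F) hb₀ d₁ with hd' | ⟨z, hz⟩
      · exact exists_mem_planeOrbit_of_mem ha hd' h₀ h₃ h₁
      rcases li_two_or (F := F) hb₀ d₂ with hd' | ⟨w, hw⟩
      · exact exists_mem_planeOrbit_of_mem ha hd' h₀ h₃ h₂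
      -- Two independent vectors `d₁, d₂` cannot both be multiples of `b₀`.
      set b := x • d₁ + y • d₂
      exfalso
      obtain ⟨h1, h2⟩ := li_two.1 hd w (-z) (by rw [hz, hw]; module)
      rw [neg_eq_zero.1 h2, zero_smul] at hz
      exact hd₁ hz
  · have h₃ : a₀ ⊗ₜ[F] (c₂ - x • c₁) ∈ U.1 := by
      convert U.1.sub_mem h₂ (U.1.smul_mem x h₁) using 1
      simp only [TensorProduct.tmul_sub, TensorProduct.tmul_smul]
      module
    rcases li_two_or (F := F) hb₀ (c₂ - x • c₁) with hc | ⟨y, hy⟩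
    · exact exists_mem_planeOrbit_of_pure_line ha₀ hc h₀ h₃
    · refine absurd ?_ hs₂
      rw [sub_eq_iff_eq_add.1 hy]
      have e : a₀ ⊗ₜ[F] (y • b₀ + x • c₁) + a₁ ⊗ₜ[F] (x • d₁) =
          y • a₀ ⊗ₜ[F] b₀ + x • (a₀ ⊗ₜ[F] c₁ + a₁ ⊗ₜ[F] d₁) := by
        simp only [TensorProduct.tmul_add, TensorProduct.tmul_smul]
        module
      rw [e]
      exact add_mem (Submodule.smul_mem _ _ (Submodule.subset_span ⟨0, rfl⟩))
        (Submodule.smul_mem _ _ (Submodule.subset_span ⟨1, rfl⟩))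

/-- If every cubic over `F` has a root, every plane meets the Segre variety. -/
theorem exists_pure_mem_of_cubic (hF : ∀ b c d : F, ∃ x, x ^ 3 + b * x ^ 2 + c * x + d = 0)
    (U : PG F 2) : ∃ a b, a ≠ 0 ∧ b ≠ 0 ∧ a ⊗ₜ[F] b ∈ U.1 := by
  obtain ⟨t, ht, hli⟩ := exists_li_of_finrank U.2
  have ha := li_single (F := F)
  choose c d hcd using fun k => exists_rows ha (t k)
  have hcomb : ∀ y : Fin 3 → F, (Pi.single 0 1 : Fin 2 → F) ⊗ₜ[F] (∑ k, y k • c k) +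
      (Pi.single 1 1 : Fin 2 → F) ⊗ₜ[F] (∑ k, y k • d k) ∈ U.1 := by
    intro y
    have : ∑ k, y k • t k ∈ U.1 := U.1.sum_mem fun k _ => U.1.smul_mem _ (ht k)
    convert this using 1
    simp only [TensorProduct.tmul_sum, ← Finset.sum_add_distrib]
    refine Finset.sum_congr rfl fun k _ => ?_
    rw [hcd k, TensorProduct.tmul_smul, TensorProduct.tmul_smul, smul_add]
  -- A nonzero combination of independent tensors cannot have both rows zero.
  have hne : ∀ y : Fin 3 → F, y ≠ 0 → ∑ k, y k • c k = 0 → ∑ k, y k • d k ≠ 0 := by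
    intro y hy h1 h2
    refine hy (funext (Fintype.linearIndependent_iff.1 hli y ?_))
    trans (Pi.single 0 1 : Fin 2 → F) ⊗ₜ[F] (∑ k, y k • c k) +
      (Pi.single 1 1 : Fin 2 → F) ⊗ₜ[F] (∑ k, y k • d k)
    · simp only [TensorProduct.tmul_sum, ← Finset.sum_add_distrib]
      refine Finset.sum_congr rfl fun k _ => ?_
      rw [hcd k, TensorProduct.tmul_smul, TensorProduct.tmul_smul, smul_add]
    · rw [h1, h2, TensorProduct.tmul_zero, TensorProduct.tmul_zero, add_zero]
  let C : Matrix (Fin 3) (Fin 3) F := Matrix.of c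
  let D : Matrix (Fin 3) (Fin 3) F := Matrix.of d
  have hC : ∀ y, Matrix.vecMul y C = ∑ k, y k • c k := fun y => Matrix.vecMul_eq_sum y C
  have hD : ∀ y, Matrix.vecMul y D = ∑ k, y k • d k := fun y => Matrix.vecMul_eq_sum y D
  -- The combination with coefficients `y` has rows `y C` and `y D`, and a proportionality of the
  -- two is needed. For singular `C` the first row can be made zero. Otherwise a left eigenvector of
  -- `D C⁻¹` with eigenvalue `l` gives `y D = l (y C)`, so the tensor is `(e₀ + l e₁) ⊗ y C`.
  by_cases hdet : C.det = 0
  · obtain ⟨y, hy, hy0⟩ := Matrix.exists_vecMul_eq_zero_iff.2 hdet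
    rw [hC] at hy0
    refine ⟨_, _, li_right_ne ha, hne y hy hy0, ?_⟩
    have := hcomb y
    rwa [hy0, TensorProduct.tmul_zero, zero_add] at this
  · have hu : IsUnit C.det := isUnit_iff_ne_zero.2 hdet
    obtain ⟨l, hl⟩ : ∃ l, (D * C⁻¹).charpoly.eval l = 0 := by
      have hdeg : (D * C⁻¹).charpoly.natDegree = 3 := by simp [Matrix.charpoly_natDegree_eq_dim]
      have hlead : (D * C⁻¹).charpoly.coeff 3 = 1 := by
        have h := (D * C⁻¹).charpoly_monic
        rwa [Polynomial.Monic, Polynomial.leadingCoeff, hdeg] at h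
      obtain ⟨l, hl⟩ := hF ((D * C⁻¹).charpoly.coeff 2) ((D * C⁻¹).charpoly.coeff 1)
        ((D * C⁻¹).charpoly.coeff 0)
      refine ⟨l, ?_⟩
      rw [Polynomial.eval_eq_sum_range, hdeg, ← hl]
      simp only [Finset.sum_range_succ, Finset.sum_range_zero, hlead]
      ring
    rw [Matrix.eval_charpoly] at hl
    obtain ⟨y, hy, hy0⟩ := Matrix.exists_vecMul_eq_zero_iff.2 hl
    rw [Matrix.vecMul_sub, Matrix.scalar_apply, ← Matrix.smul_one_eq_diagonal, Matrix.vecMul_smul,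
      Matrix.vecMul_one, sub_eq_zero] at hy0
    have hdc : ∑ k, y k • d k = l • ∑ k, y k • c k := by
      rw [← hC, ← hD, ← Matrix.smul_vecMul, hy0, Matrix.vecMul_vecMul, Matrix.mul_assoc,
        Matrix.nonsing_inv_mul C hu, Matrix.mul_one]
    refine ⟨_, ∑ k, y k • c k, li_right_ne (li_shear (li_swap ha) l), fun h0 => hne y hy h0 (by rw [hdc, h0, smul_zero]), ?_⟩
    have := hcomb y
    rw [hdc, TensorProduct.tmul_smul, TensorProduct.smul_tmul', ← TensorProduct.add_tmul] at this
    exact this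

theorem exists_mem_planeOrbit (hF : ∀ b c d : F, ∃ x, x ^ 3 + b * x ^ 2 + c * x + d = 0)
    (U : PG F 2) : ∃ t, U ∈ planeOrbit F t := by
  obtain ⟨a, b, ha, hb, h⟩ := exists_pure_mem_of_cubic hF U
  exact exists_mem_planeOrbit_of_pure ha hb h

/-! ### Invariance under the group -/

theorem coe_smul {d : ℕ} (g : H2 F) (U : PG F d) :
    (g • U).1 = U.1.map ((act g) : V F →ₗ[F] V F) := rfl

theorem act_mem_smul {d : ℕ} {g : H2 F} {U : PG F d} {t : V F} :
    act g t ∈ (g • U).1 ↔ t ∈ U.1 := by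
  rw [coe_smul]
  constructor
  · rintro ⟨s, hs, h⟩
    rwa [← (act g).injective h]
  · exact fun h => ⟨t, h, rfl⟩

theorem smul_le_smul {d e : ℕ} {g : H2 F} {L : PG F d} {U : PG F e} (h : L.1 ≤ U.1) :
    (g • L).1 ≤ (g • U).1 := Submodule.map_mono h

/-- A property invariant under the group has to be verified only on the listed representatives; all
the intersection and size computations are reduced to matrices in this way. -/
theorem orbitsOf_induction {d : ℕ} {R : Set (Submodule F (V F))} {P : PG F d → Prop}
    (hP : ∀ (g : H2 F) U, P U → P (g • U)) (h : ∀ U : PG F d, U.1 ∈ R → P U) {U : PG F d}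
    (hU : U ∈ orbitsOf R) : P U := by
  obtain ⟨W, hW, g, hg⟩ := hU
  have hd : Module.finrank F W = d + 1 := by
    rw [← U.2, hg, LinearEquiv.finrank_map_eq]
  have : U = g • (⟨W, hd⟩ : PG F d) := Subtype.ext hg
  rw [this]
  exact hP g _ (h _ hW)

theorem smul_mem_orbitsOf {d : ℕ} {R : Set (Submodule F (V F))} (g : H2 F) {U : PG F d}
    (hU : U ∈ orbitsOf R) : g • U ∈ orbitsOf R := by
  obtain ⟨W, hW, h, hh⟩ := hU
  exact ⟨W, hW, g * h, by rw [coe_smul, hh, act_mul, Submodule.map_comp]⟩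

/-- The point `⟨a ⊗ b⟩` of the Segre variety. -/
noncomputable def pt (a : Fin 2 → F) (b : Fin 3 → F) (ha : a ≠ 0) (hb : b ≠ 0) : PG F 0 :=
  ⟨Submodule.span F {a ⊗ₜ[F] b}, finrank_span_singleton (tmul_ne_zero ha hb)⟩

theorem smul_coe_span (g : H2 F) {p : PG F 0} {t : V F} (h : p.1 = Submodule.span F {t}) :
    (g • p).1 = Submodule.span F {act g t} := by
  rw [coe_smul, h, Submodule.map_span, Set.image_singleton]
  rfl

theorem image_segreSub (g : H2 F) (A : Submodule F (Fin 2 → F)) (B : Submodule F (Fin 3 → F)) :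
    (g • ·) '' segreSub A B = segreSub (A.map (g.1 : (Fin 2 → F) →ₗ[F] (Fin 2 → F)))
      (B.map (g.2 : (Fin 3 → F) →ₗ[F] (Fin 3 → F))) := by
  ext q
  constructor
  · rintro ⟨p, ⟨a, ha, b, hb, ha0, hb0, hp⟩, rfl⟩
    refine ⟨g.1 a, ⟨a, ha, rfl⟩, g.2 b, ⟨b, hb, rfl⟩, by simpa using ha0, by simpa using hb0, ?_⟩
    rw [← act_tmul]
    exact smul_coe_span g hp
  · rintro ⟨_, ⟨a, ha, rfl⟩, _, ⟨b, hb, rfl⟩, ha0, hb0, hq⟩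
    have ha0 : a ≠ 0 := by
      rintro rfl
      simp at ha0
    have hb0 : b ≠ 0 := by
      rintro rfl
      simp at hb0
    refine ⟨pt a b ha0 hb0, ⟨a, ha, b, hb, ha0, hb0, rfl⟩, Subtype.ext ?_⟩
    rw [hq]
    exact (smul_coe_span g rfl).trans (by rw [act_tmul]; rfl)

/-- One inclusion holds for every group element; applied to `g⁻¹` it gives the other. -/
theorem image_meet {d : ℕ} (g : H2 F) (U : PG F d) : meet (g • U) = (g • ·) '' meet U := by
  have key : ∀ (g : H2 F) (U : PG F d) p, p ∈ meet U → g • p ∈ meet (g • U) := by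
    rintro g U p ⟨hp, hle⟩
    refine ⟨?_, smul_le_smul hle⟩
    have := image_segreSub g (⊤ : Submodule F (Fin 2 → F)) ⊤
    rw [Submodule.map_top, Submodule.map_top, LinearEquiv.range, LinearEquiv.range] at this
    rw [segre, ← this]
    exact ⟨p, hp, rfl⟩
  ext p
  constructor
  · intro hp
    refine ⟨g⁻¹ • p, ?_, smul_inv_smul g p⟩
    have := key g⁻¹ _ _ hp
    rwa [inv_smul_smul] at this
  · rintro ⟨p, hp, rfl⟩
    exact key g U p hp

theorem IsLineFirstKind.image {S : Set (PG F 0)} (h : IsLineFirstKind S) (g : H2 F) :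
    IsLineFirstKind ((g • ·) '' S) := by
  obtain ⟨A, B, hA, hB, rfl⟩ := h
  exact ⟨_, _, by rwa [LinearEquiv.finrank_map_eq], by rwa [LinearEquiv.finrank_map_eq],
    image_segreSub g A B⟩

theorem IsLineSecondKind.image {S : Set (PG F 0)} (h : IsLineSecondKind S) (g : H2 F) :
    IsLineSecondKind ((g • ·) '' S) := by
  obtain ⟨B, hB, rfl⟩ := h
  refine ⟨B.map (g.2 : (Fin 3 → F) →ₗ[F] (Fin 3 → F)), by rwa [LinearEquiv.finrank_map_eq], ?_⟩
  rw [image_segreSub, Submodule.map_top, LinearEquiv.range]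

theorem IsSegrePlane.image {S : Set (PG F 0)} (h : IsSegrePlane S) (g : H2 F) :
    IsSegrePlane ((g • ·) '' S) := by
  obtain ⟨A, hA, rfl⟩ := h
  refine ⟨A.map (g.1 : (Fin 2 → F) →ₗ[F] (Fin 2 → F)), by rwa [LinearEquiv.finrank_map_eq], ?_⟩
  rw [image_segreSub, Submodule.map_top, LinearEquiv.range]

theorem IsConicOf.image {U : PG F 2} {S : Set (PG F 0)} (h : IsConicOf U S) (g : H2 F) :
    IsConicOf (g • U) ((g • ·) '' S) := by
  obtain ⟨φ, rfl⟩ := h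
  refine ⟨φ.trans ((act g).submoduleMap U.1), ?_⟩
  ext p
  constructor
  · rintro ⟨p, ⟨c, hc, hc', hp⟩, rfl⟩
    exact ⟨c, hc, hc', smul_coe_span g hp⟩
  · rintro ⟨c, hc, hc', hp⟩
    refine ⟨g⁻¹ • p, ⟨c, hc, hc', ?_⟩, smul_inv_smul g p⟩
    have h1 : (g • (⟨Submodule.span F {(φ c : V F)}, finrank_span_singleton
        fun h0 => hc (φ.map_eq_zero_iff.1 (Subtype.ext h0))⟩ :
        PG F 0)) = p := Subtype.ext ((smul_coe_span g rfl).trans hp.symm)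
    rw [← h1, inv_smul_smul]

theorem smul_le_tensorSub {d : ℕ} {U : PG F d} {A : Submodule F (Fin 2 → F)}
    {B : Submodule F (Fin 3 → F)} (h : U.1 ≤ tensorSub A B) (g : H2 F) :
    (g • U).1 ≤ tensorSub (A.map (g.1 : (Fin 2 → F) →ₗ[F] (Fin 2 → F)))
      (B.map (g.2 : (Fin 3 → F) →ₗ[F] (Fin 3 → F))) := by
  refine (Submodule.map_mono h).trans ?_
  rw [tensorSub, Submodule.map_span]
  refine Submodule.span_mono ?_
  rintro _ ⟨_, ⟨a, ha, b, hb, rfl⟩, rfl⟩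
  exact ⟨g.1 a, ⟨a, ha, rfl⟩, g.2 b, ⟨b, hb, rfl⟩, act_tmul g a b⟩

theorem HasMinSegre.smul {d : ℕ} {U : PG F d} {mn : ℕ × ℕ} (h : HasMinSegre U mn) (g : H2 F) :
    HasMinSegre (g • U) mn := by
  obtain ⟨⟨A, B, hA, hB, hU⟩, h⟩ := h
  refine ⟨⟨_, _, ?_, ?_, smul_le_tensorSub hU g⟩, fun A B hAB => ?_⟩
  · rwa [LinearEquiv.finrank_map_eq]
  · rwa [LinearEquiv.finrank_map_eq]
  · have := smul_le_tensorSub hAB g⁻¹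
    rw [inv_smul_smul] at this
    have := h _ _ this
    rwa [LinearEquiv.finrank_map_eq, LinearEquiv.finrank_map_eq] at this

/-- The optimal pair for each size bounds the other size from above. Hence the minimal size is an
invariant that can separate orbits. -/
theorem HasMinSegre.unique {d : ℕ} {U : PG F d} {m n : ℕ × ℕ} (h : HasMinSegre U m)
    (h' : HasMinSegre U n) : m = n := by
  obtain ⟨⟨A, B, hA, hB, hU⟩, h⟩ := h
  obtain ⟨⟨A', B', hA', hB', hU'⟩, h'⟩ := h'
  have h1 := h _ _ hU'
  have h2 := h' _ _ hU
  ext <;> omega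

theorem ncard_meet_smul {d : ℕ} (g : H2 F) (U : PG F d) :
    (meet (g • U)).ncard = (meet U).ncard := by
  rw [image_meet, Set.ncard_image_of_injective _ (MulAction.injective g)]

theorem pointMeet_smul {U : PG F 0} {t : PointType} (g : H2 F) (h : pointMeet U t) :
    pointMeet (g • U) t := by
  cases t
  · exact (ncard_meet_smul g U).trans h
  · change meet _ = ∅
    rw [image_meet, show meet U = ∅ from h, Set.image_empty]

theorem lineMeet_smul {U : PG F 1} {t : LineType} (g : H2 F) (h : lineMeet U t) :
    lineMeet (g • U) t := by
  cases t
  case o2 =>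
    change IsLineFirstKind _
    rw [image_meet]
    exact IsLineFirstKind.image h g
  case o4T =>
    change IsLineSecondKind _
    rw [image_meet]
    exact IsLineSecondKind.image h g
  case o10 | o11 =>
    change meet _ = ∅
    rw [image_meet, show meet U = ∅ from h, Set.image_empty]
  all_goals exact (ncard_meet_smul g U).trans h

theorem planeMeet_smul {U : PG F 2} {t : PlaneType} (g : H2 F) (h : planeMeet U t) :
    planeMeet (g • U) t := by
  have hg : Function.Injective (g • · : PG F 0 → PG F 0) := MulAction.injective g
  cases t
  case o3 =>
    change IsSegrePlane _
    rw [image_meet]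
    exact IsSegrePlane.image h g
  case o7T =>
    obtain ⟨S, T, hS, hT, hST, hU⟩ := h
    refine ⟨_, _, hS.image g, hT.image g, ?_, ?_⟩
    · rw [← Set.image_inter hg, Set.ncard_image_of_injective _ hg, hST]
    · rw [image_meet, hU, Set.image_union]
  case o8 =>
    obtain ⟨S, p, hS, hp, hU⟩ := h
    refine ⟨_, g • p, hS.image g, fun h' => hp ?_, ?_⟩
    · exact (Function.Injective.mem_set_image hg).1 h'
    · rw [image_meet, hU, Set.image_union, Set.image_singleton]
  case o9 =>
    change IsLineFirstKind _
    rw [image_meet]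
    exact IsLineFirstKind.image h g
  case o11T =>
    change IsConicOf _ _
    rw [image_meet]
    exact IsConicOf.image h g
  case o12 =>
    change IsLineSecondKind _
    rw [image_meet]
    exact IsLineSecondKind.image h g
  case o13 | o14 => exact (ncard_meet_smul g U).trans h
  case o15 | o16 =>
    obtain ⟨h1, L, hL, hLU⟩ := h
    exact ⟨(ncard_meet_smul g U).trans h1, g • L, smul_mem_orbitsOf g hL, smul_le_smul hLU⟩
  case o17 =>
    change meet _ = ∅
    rw [image_meet, show meet U = ∅ from h, Set.image_empty]

/-! ### Equations of the table rows -/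

/-- In these lemmas the parameters are read off from entries. For a pure tensor `a ⊗ b` the
equations become relations between the products `a i * b j`, which determine the intersection with
the Segre variety. -/
theorem mem_rep_o1 {t : V F} :
    t ∈ rep1 (fun x : F => !![x, 0, 0; 0, 0, 0]) ↔
      entry 0 1 t = 0 ∧ entry 0 2 t = 0 ∧ entry 1 0 t = 0 ∧ entry 1 1 t = 0 ∧ entry 1 2 t = 0 := by
  rw [isParam_o1.mem_iff]
  constructor
  · rintro ⟨x, rfl⟩
    simp
  · intro h
    refine ⟨entry 0 0 t, eq_tens_iff.2 ?_⟩
    simp [Fin.forall_fin_succ, h]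

theorem mem_rep_o4 {t : V F} :
    t ∈ rep1 (fun x : F => !![x, 0, 0; 0, x, 0]) ↔
      entry 0 1 t = 0 ∧ entry 0 2 t = 0 ∧ entry 1 0 t = 0 ∧ entry 1 2 t = 0 ∧ entry 0 0 t = entry 1 1 t := by
  rw [isParam_o4.mem_iff]
  constructor
  · rintro ⟨x, rfl⟩
    simp
  · intro h
    refine ⟨entry 1 1 t, eq_tens_iff.2 ?_⟩
    simp [Fin.forall_fin_succ, h]

theorem mem_rep_o2 {t : V F} :
    t ∈ rep2 (fun x y : F => !![x, y, 0; 0, 0, 0]) ↔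
      entry 0 2 t = 0 ∧ entry 1 0 t = 0 ∧ entry 1 1 t = 0 ∧ entry 1 2 t = 0 := by
  rw [isParam_o2.mem_iff]
  constructor
  · rintro ⟨x, y, rfl⟩
    simp
  · intro h
    refine ⟨entry 0 0 t, entry 0 1 t, eq_tens_iff.2 ?_⟩
    simp [Fin.forall_fin_succ, h]

theorem mem_rep_o4T {t : V F} :
    t ∈ rep2 (fun x y : F => !![x, 0, 0; y, 0, 0]) ↔
      entry 0 1 t = 0 ∧ entry 0 2 t = 0 ∧ entry 1 1 t = 0 ∧ entry 1 2 t = 0 := by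
  rw [isParam_o4T.mem_iff]
  constructor
  · rintro ⟨x, y, rfl⟩
    simp
  · intro h
    refine ⟨entry 0 0 t, entry 1 0 t, eq_tens_iff.2 ?_⟩
    simp [Fin.forall_fin_succ, h]

theorem mem_rep_o5 {t : V F} :
    t ∈ rep2 (fun x y : F => !![x, 0, 0; 0, y, 0]) ↔
      entry 0 1 t = 0 ∧ entry 0 2 t = 0 ∧ entry 1 0 t = 0 ∧ entry 1 2 t = 0 := by
  rw [isParam_o5.mem_iff]
  constructor
  · rintro ⟨x, y, rfl⟩
    simp
  · intro h
    refine ⟨entry 0 0 t, entry 1 1 t, eq_tens_iff.2 ?_⟩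
    simp [Fin.forall_fin_succ, h]

theorem mem_rep_o6 {t : V F} :
    t ∈ rep2 (fun x y : F => !![x, 0, 0; y, x, 0]) ↔
      entry 0 1 t = 0 ∧ entry 0 2 t = 0 ∧ entry 1 2 t = 0 ∧ entry 0 0 t = entry 1 1 t := by
  rw [isParam_o6.mem_iff]
  constructor
  · rintro ⟨x, y, rfl⟩
    simp
  · intro h
    refine ⟨entry 1 1 t, entry 1 0 t, eq_tens_iff.2 ?_⟩
    simp [Fin.forall_fin_succ, h]

theorem mem_rep_o7 {t : V F} :
    t ∈ rep2 (fun x y : F => !![x, y, 0; 0, 0, x]) ↔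
      entry 0 2 t = 0 ∧ entry 1 0 t = 0 ∧ entry 1 1 t = 0 ∧ entry 0 0 t = entry 1 2 t := by
  rw [isParam_o7.mem_iff]
  constructor
  · rintro ⟨x, y, rfl⟩
    simp
  · intro h
    refine ⟨entry 1 2 t, entry 0 1 t, eq_tens_iff.2 ?_⟩
    simp [Fin.forall_fin_succ, h]

theorem mem_rep_o10 {u v : F} {t : V F} :
    t ∈ rep2 (fun x y : F => !![x, u * x + y, 0; v * y, x, 0]) ↔
      entry 0 2 t = 0 ∧ entry 1 2 t = 0 ∧ entry 0 0 t = entry 1 1 t ∧ entry 1 0 t = v * (entry 0 1 t - u * entry 1 1 t) := by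
  rw [(isParam_o10 u v).mem_iff]
  constructor
  · rintro ⟨x, y, rfl⟩
    simp
  · intro h
    refine ⟨entry 1 1 t, entry 0 1 t - u * entry 1 1 t, eq_tens_iff.2 ?_⟩
    simp [Fin.forall_fin_succ, h]

theorem mem_rep_o11 {t : V F} :
    t ∈ rep2 (fun x y : F => !![x, y, 0; 0, x, y]) ↔
      entry 0 2 t = 0 ∧ entry 1 0 t = 0 ∧ entry 0 0 t = entry 1 1 t ∧ entry 0 1 t = entry 1 2 t := by
  rw [isParam_o11.mem_iff]
  constructor
  · rintro ⟨x, y, rfl⟩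
    simp
  · intro h
    refine ⟨entry 1 1 t, entry 1 2 t, eq_tens_iff.2 ?_⟩
    simp [Fin.forall_fin_succ, h]

theorem mem_rep_o3 {t : V F} :
    t ∈ rep3 (fun x y z : F => !![x, y, z; 0, 0, 0]) ↔
      entry 1 0 t = 0 ∧ entry 1 1 t = 0 ∧ entry 1 2 t = 0 := by
  rw [isParam_o3.mem_iff]
  constructor
  · rintro ⟨x, y, z, rfl⟩
    simp
  · intro h
    refine ⟨entry 0 0 t, entry 0 1 t, entry 0 2 t, eq_tens_iff.2 ?_⟩
    simp [Fin.forall_fin_succ, h]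

theorem mem_rep_o7T {t : V F} :
    t ∈ rep3 (fun x y z : F => !![z, 0, 0; x, y, 0]) ↔
      entry 0 1 t = 0 ∧ entry 0 2 t = 0 ∧ entry 1 2 t = 0 := by
  rw [isParam_o7T.mem_iff]
  constructor
  · rintro ⟨x, y, z, rfl⟩
    simp
  · intro h
    refine ⟨entry 1 0 t, entry 1 1 t, entry 0 0 t, eq_tens_iff.2 ?_⟩
    simp [Fin.forall_fin_succ, h]

theorem mem_rep_o8 {t : V F} :
    t ∈ rep3 (fun x y z : F => !![x, 0, 0; 0, y, z]) ↔
      entry 0 1 t = 0 ∧ entry 0 2 t = 0 ∧ entry 1 0 t = 0 := by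
  rw [isParam_o8.mem_iff]
  constructor
  · rintro ⟨x, y, z, rfl⟩
    simp
  · intro h
    refine ⟨entry 0 0 t, entry 1 1 t, entry 1 2 t, eq_tens_iff.2 ?_⟩
    simp [Fin.forall_fin_succ, h]

theorem mem_rep_o9 {t : V F} :
    t ∈ rep3 (fun x y z : F => !![z, 0, 0; x, y, z]) ↔
      entry 0 1 t = 0 ∧ entry 0 2 t = 0 ∧ entry 0 0 t = entry 1 2 t := by
  rw [isParam_o9.mem_iff]
  constructor
  · rintro ⟨x, y, z, rfl⟩
    simp
  · intro h
    refine ⟨entry 1 0 t, entry 1 1 t, entry 1 2 t, eq_tens_iff.2 ?_⟩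
    simp [Fin.forall_fin_succ, h]

theorem mem_rep_o11T {t : V F} :
    t ∈ rep3 (fun x y z : F => !![x, y, 0; y, z, 0]) ↔
      entry 0 2 t = 0 ∧ entry 1 2 t = 0 ∧ entry 0 1 t = entry 1 0 t := by
  rw [isParam_o11T.mem_iff]
  constructor
  · rintro ⟨x, y, z, rfl⟩
    simp
  · intro h
    refine ⟨entry 0 0 t, entry 1 0 t, entry 1 1 t, eq_tens_iff.2 ?_⟩
    simp [Fin.forall_fin_succ, h]

theorem mem_rep_o12 {t : V F} :
    t ∈ rep3 (fun x y z : F => !![x, y, 0; 0, z, x]) ↔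
      entry 0 2 t = 0 ∧ entry 1 0 t = 0 ∧ entry 0 0 t = entry 1 2 t := by
  rw [isParam_o12.mem_iff]
  constructor
  · rintro ⟨x, y, z, rfl⟩
    simp
  · intro h
    refine ⟨entry 1 2 t, entry 0 1 t, entry 1 1 t, eq_tens_iff.2 ?_⟩
    simp [Fin.forall_fin_succ, h]

theorem mem_rep_o13 {t : V F} :
    t ∈ rep3 (fun x y z : F => !![x, y, 0; 0, x, z]) ↔
      entry 0 2 t = 0 ∧ entry 1 0 t = 0 ∧ entry 0 0 t = entry 1 1 t := by
  rw [isParam_o13.mem_iff]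
  constructor
  · rintro ⟨x, y, z, rfl⟩
    simp
  · intro h
    refine ⟨entry 1 1 t, entry 0 1 t, entry 1 2 t, eq_tens_iff.2 ?_⟩
    simp [Fin.forall_fin_succ, h]

theorem mem_rep_o14 {t : V F} :
    t ∈ rep3 (fun x y z : F => !![x, y, 0; 0, y, z]) ↔
      entry 0 2 t = 0 ∧ entry 1 0 t = 0 ∧ entry 0 1 t = entry 1 1 t := by
  rw [isParam_o14.mem_iff]
  constructor
  · rintro ⟨x, y, z, rfl⟩
    simp
  · intro h
    refine ⟨entry 0 0 t, entry 1 1 t, entry 1 2 t, eq_tens_iff.2 ?_⟩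
    simp [Fin.forall_fin_succ, h]

theorem mem_rep_o15 {u v : F} {t : V F} :
    t ∈ rep3 (fun x y z : F => !![x, u * x + y, z; v * y, x, 0]) ↔
      entry 1 2 t = 0 ∧ entry 0 0 t = entry 1 1 t ∧ entry 1 0 t = v * (entry 0 1 t - u * entry 1 1 t) := by
  rw [(isParam_o15 u v).mem_iff]
  constructor
  · rintro ⟨x, y, z, rfl⟩
    simp
  · intro h
    refine ⟨entry 1 1 t, entry 0 1 t - u * entry 1 1 t, entry 0 2 t, eq_tens_iff.2 ?_⟩
    simp [Fin.forall_fin_succ, h]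

theorem mem_rep_o16 {t : V F} :
    t ∈ rep3 (fun x y z : F => !![x, y, z; 0, x, y]) ↔
      entry 1 0 t = 0 ∧ entry 0 0 t = entry 1 1 t ∧ entry 0 1 t = entry 1 2 t := by
  rw [isParam_o16.mem_iff]
  constructor
  · rintro ⟨x, y, z, rfl⟩
    simp
  · intro h
    refine ⟨entry 1 1 t, entry 1 2 t, entry 0 2 t, eq_tens_iff.2 ?_⟩
    simp [Fin.forall_fin_succ, h]

/-! ### Minimal Segre subvarieties -/

/-- The coordinate hyperplane `x_k = 0`. -/
def hyper {n : ℕ} (k : Fin n) : Submodule F (Fin n → F) :=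
  LinearMap.ker (LinearMap.proj k : (Fin n → F) →ₗ[F] F)

@[simp]
theorem mem_hyper {n : ℕ} {k : Fin n} {a : Fin n → F} : a ∈ hyper k ↔ a k = 0 := Iff.rfl

theorem finrank_hyper {n : ℕ} (k : Fin (n + 1)) :
    Module.finrank F (hyper k : Submodule F (Fin (n + 1) → F)) = n := by
  have h := LinearMap.finrank_range_add_finrank_ker
    (LinearMap.proj k : (Fin (n + 1) → F) →ₗ[F] F)
  rw [LinearMap.range_eq_top.2 (Function.surjective_eval k), finrank_top,
    Module.finrank_self, Module.finrank_fin_fun] at h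
  change 1 + Module.finrank F (hyper k : Submodule F (Fin (n + 1) → F)) = n + 1 at h
  omega

/-- The lower bounds for minimal sizes rest on this and `col_mem`: unit vectors occurring as rows
lie in `B`, those occurring as columns lie in `A`. -/
theorem row_mem {A : Submodule F (Fin 2 → F)} {B : Submodule F (Fin 3 → F)} {t : V F}
    (h : t ∈ tensorSub A B) (i : Fin 2) : (fun j => entry i j t) ∈ B := by
  induction h using Submodule.span_induction with
  | mem t h =>
    obtain ⟨a, -, b, hb, rfl⟩ := h
    simp only [entry_tmul]
    exact B.smul_mem (a i) hb
  | zero =>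
    simp only [map_zero]
    exact B.zero_mem
  | add s t _ _ hs ht =>
    simp only [map_add]
    exact B.add_mem hs ht
  | smul c t _ ht =>
    simp only [map_smul]
    exact B.smul_mem c ht

theorem col_mem {A : Submodule F (Fin 2 → F)} {B : Submodule F (Fin 3 → F)} {t : V F}
    (h : t ∈ tensorSub A B) (j : Fin 3) : (fun i => entry i j t) ∈ A := by
  induction h using Submodule.span_induction with
  | mem t h =>
    obtain ⟨a, ha, b, -, rfl⟩ := h
    simp only [entry_tmul, mul_comm _ (b j)]
    exact A.smul_mem (b j) ha
  | zero =>
    simp only [map_zero]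
    exact A.zero_mem
  | add s t _ _ hs ht =>
    simp only [map_add]
    exact A.add_mem hs ht
  | smul c t _ ht =>
    simp only [map_smul]
    exact A.smul_mem c ht

theorem mem_of_row_eq {A : Submodule F (Fin 2 → F)} {B : Submodule F (Fin 3 → F)} {t : V F}
    (h : t ∈ tensorSub A B) (i : Fin 2) {b : Fin 3 → F} (hb : ∀ j, entry i j t = b j) : b ∈ B :=
  (funext hb : (fun j => entry i j t) = b) ▸ row_mem h i

theorem mem_of_col_eq {A : Submodule F (Fin 2 → F)} {B : Submodule F (Fin 3 → F)} {t : V F}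
    (h : t ∈ tensorSub A B) (j : Fin 3) {a : Fin 2 → F} (ha : ∀ i, entry i j t = a i) : a ∈ A :=
  (funext ha : (fun i => entry i j t) = a) ▸ col_mem h j

theorem tens_mem_tensorSub {A : Submodule F (Fin 2 → F)} {B : Submodule F (Fin 3 → F)}
    {M : Matrix (Fin 2) (Fin 3) F}
    (h : ∀ i j, M i j = 0 ∨ Pi.single i 1 ∈ A ∧ Pi.single j 1 ∈ B) : tens M ∈ tensorSub A B := by
  refine Submodule.sum_mem _ fun i _ => Submodule.sum_mem _ fun j _ => ?_
  rcases h i j with h0 | ⟨ha, hb⟩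
  · rw [h0, zero_smul]
    exact Submodule.zero_mem _
  · exact Submodule.smul_mem _ _ (Submodule.subset_span ⟨_, ha, _, hb, rfl⟩)

theorem le_finrank_of_li {n k : ℕ} {A : Submodule F (Fin n → F)} {s : Fin k → Fin n → F}
    (hs : LinearIndependent F s) (h : ∀ i, s i ∈ A) : k ≤ Module.finrank F A := by
  have h1 : LinearIndependent F (fun i => (⟨s i, h i⟩ : A)) :=
    LinearIndependent.of_comp A.subtype hs
  simpa using h1.fintype_card_le_finrank

theorem one_le_finrank {n : ℕ} {A : Submodule F (Fin n → F)} {a : Fin n → F} (ha : a ∈ A)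
    (h : a ≠ 0) : 1 ≤ Module.finrank F A := by
  refine le_finrank_of_li (s := ![a]) ?_ (by simpa using ha)
  rw [linearIndependent_unique_iff]
  exact h

theorem two_le_finrank_left {A : Submodule F (Fin 2 → F)} (h0 : ![1, 0] ∈ A) (h1 : ![0, 1] ∈ A) :
    2 ≤ Module.finrank F A := by
  refine le_finrank_of_li (s := ![![1, 0], ![0, 1]]) ?_ ?_
  · rw [li_two]
    intro x y h
    simpa [funext_iff, Fin.forall_fin_succ] using h
  · simpa [Fin.forall_fin_succ] using ⟨h0, h1⟩

theorem two_le_finrank_right {B : Submodule F (Fin 3 → F)} (h0 : ![1, 0, 0] ∈ B)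
    (h1 : ![0, 1, 0] ∈ B) : 2 ≤ Module.finrank F B := by
  refine le_finrank_of_li (s := ![![1, 0, 0], ![0, 1, 0]]) ?_ ?_
  · rw [li_two]
    intro x y h
    simpa [funext_iff, Fin.forall_fin_succ] using h
  · simpa [Fin.forall_fin_succ] using ⟨h0, h1⟩

theorem three_le_finrank_right {B : Submodule F (Fin 3 → F)} (h0 : ![1, 0, 0] ∈ B)
    (h1 : ![0, 1, 0] ∈ B) (h2 : ![0, 0, 1] ∈ B) : 3 ≤ Module.finrank F B := by
  refine le_finrank_of_li (s := ![![1, 0, 0], ![0, 1, 0], ![0, 0, 1]]) ?_ ?_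
  · rw [li_three]
    intro x y z h
    simpa [funext_iff, Fin.forall_fin_succ] using h
  · simpa [Fin.forall_fin_succ] using ⟨h0, h1, h2⟩

theorem hasMinSegre_of_le {d m n : ℕ} {U : PG F d} {A : Submodule F (Fin 2 → F)}
    {B : Submodule F (Fin 3 → F)} (hA : Module.finrank F A = m) (hB : Module.finrank F B = n)
    (hU : U.1 ≤ tensorSub A B)
    (h : ∀ (A : Submodule F (Fin 2 → F)) (B : Submodule F (Fin 3 → F)), U.1 ≤ tensorSub A B →
      m ≤ Module.finrank F A ∧ n ≤ Module.finrank F B) : HasMinSegre U (m, n) :=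
  ⟨⟨A, B, hA, hB, hU⟩, h⟩

/-! ### Minimal size of each table row -/

theorem hasMinSegre_o1 {U : PG F 0}
    (hU : U.1 = rep1 fun x => !![x, 0, 0; 0, 0, 0]) : HasMinSegre U (1, 1) := by
  refine hasMinSegre_of_le (A := hyper 1) (B := Submodule.span F {Pi.single 0 1}) (finrank_hyper 1) (finrank_span_singleton (by simp)) ?_ ?_
  · rw [hU]
    refine Submodule.span_le.2 ?_
    rintro _ ⟨x, rfl⟩
    exact tens_mem_tensorSub (by simp [Fin.forall_fin_succ, Submodule.mem_span_singleton_self])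
  · intro A B h
    rw [hU] at h
    have c0 : ![1, 0] ∈ A :=
      mem_of_col_eq (h (Submodule.subset_span ⟨1, rfl⟩)) 0 (by simp [Fin.forall_fin_succ])
    have r0 : ![1, 0, 0] ∈ B :=
      mem_of_row_eq (h (Submodule.subset_span ⟨1, rfl⟩)) 0 (by simp [Fin.forall_fin_succ])
    exact ⟨one_le_finrank c0 (by simp), one_le_finrank r0 (by simp)⟩

theorem hasMinSegre_o4 {U : PG F 0}
    (hU : U.1 = rep1 fun x => !![x, 0, 0; 0, x, 0]) : HasMinSegre U (2, 2) := by
  refine hasMinSegre_of_le (A := ⊤) (B := hyper 2) (by simp) (finrank_hyper 2) ?_ ?_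
  · rw [hU]
    refine Submodule.span_le.2 ?_
    rintro _ ⟨x, rfl⟩
    exact tens_mem_tensorSub (by simp [Fin.forall_fin_succ])
  · intro A B h
    rw [hU] at h
    have c0 : ![1, 0] ∈ A :=
      mem_of_col_eq (h (Submodule.subset_span ⟨1, rfl⟩)) 0 (by simp [Fin.forall_fin_succ])
    have c1 : ![0, 1] ∈ A :=
      mem_of_col_eq (h (Submodule.subset_span ⟨1, rfl⟩)) 1 (by simp [Fin.forall_fin_succ])
    have r0 : ![1, 0, 0] ∈ B :=
      mem_of_row_eq (h (Submodule.subset_span ⟨1, rfl⟩)) 0 (by simp [Fin.forall_fin_succ])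
    have r1 : ![0, 1, 0] ∈ B :=
      mem_of_row_eq (h (Submodule.subset_span ⟨1, rfl⟩)) 1 (by simp [Fin.forall_fin_succ])
    exact ⟨two_le_finrank_left c0 c1, two_le_finrank_right r0 r1⟩

theorem hasMinSegre_o2 {U : PG F 1}
    (hU : U.1 = rep2 fun x y => !![x, y, 0; 0, 0, 0]) : HasMinSegre U (1, 2) := by
  refine hasMinSegre_of_le (A := hyper 1) (B := hyper 2) (finrank_hyper 1) (finrank_hyper 2) ?_ ?_
  · rw [hU]
    refine Submodule.span_le.2 ?_
    rintro _ ⟨x, y, rfl⟩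
    exact tens_mem_tensorSub (by simp [Fin.forall_fin_succ])
  · intro A B h
    rw [hU] at h
    have c0 : ![1, 0] ∈ A :=
      mem_of_col_eq (h (Submodule.subset_span ⟨1, 0, rfl⟩)) 0 (by simp [Fin.forall_fin_succ])
    have r0 : ![1, 0, 0] ∈ B :=
      mem_of_row_eq (h (Submodule.subset_span ⟨1, 0, rfl⟩)) 0 (by simp [Fin.forall_fin_succ])
    have r1 : ![0, 1, 0] ∈ B :=
      mem_of_row_eq (h (Submodule.subset_span ⟨0, 1, rfl⟩)) 0 (by simp [Fin.forall_fin_succ])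
    exact ⟨one_le_finrank c0 (by simp), two_le_finrank_right r0 r1⟩

theorem hasMinSegre_o4T {U : PG F 1}
    (hU : U.1 = rep2 fun x y => !![x, 0, 0; y, 0, 0]) : HasMinSegre U (2, 1) := by
  refine hasMinSegre_of_le (A := ⊤) (B := Submodule.span F {Pi.single 0 1}) (by simp) (finrank_span_singleton (by simp)) ?_ ?_
  · rw [hU]
    refine Submodule.span_le.2 ?_
    rintro _ ⟨x, y, rfl⟩
    exact tens_mem_tensorSub (by simp [Fin.forall_fin_succ, Submodule.mem_span_singleton_self])
  · intro A B h
    rw [hU] at h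
    have c0 : ![1, 0] ∈ A :=
      mem_of_col_eq (h (Submodule.subset_span ⟨1, 0, rfl⟩)) 0 (by simp [Fin.forall_fin_succ])
    have c1 : ![0, 1] ∈ A :=
      mem_of_col_eq (h (Submodule.subset_span ⟨0, 1, rfl⟩)) 0 (by simp [Fin.forall_fin_succ])
    have r0 : ![1, 0, 0] ∈ B :=
      mem_of_row_eq (h (Submodule.subset_span ⟨1, 0, rfl⟩)) 0 (by simp [Fin.forall_fin_succ])
    exact ⟨two_le_finrank_left c0 c1, one_le_finrank r0 (by simp)⟩

theorem hasMinSegre_o5 {U : PG F 1}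
    (hU : U.1 = rep2 fun x y => !![x, 0, 0; 0, y, 0]) : HasMinSegre U (2, 2) := by
  refine hasMinSegre_of_le (A := ⊤) (B := hyper 2) (by simp) (finrank_hyper 2) ?_ ?_
  · rw [hU]
    refine Submodule.span_le.2 ?_
    rintro _ ⟨x, y, rfl⟩
    exact tens_mem_tensorSub (by simp [Fin.forall_fin_succ])
  · intro A B h
    rw [hU] at h
    have c0 : ![1, 0] ∈ A :=
      mem_of_col_eq (h (Submodule.subset_span ⟨1, 0, rfl⟩)) 0 (by simp [Fin.forall_fin_succ])
    have c1 : ![0, 1] ∈ A :=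
      mem_of_col_eq (h (Submodule.subset_span ⟨0, 1, rfl⟩)) 1 (by simp [Fin.forall_fin_succ])
    have r0 : ![1, 0, 0] ∈ B :=
      mem_of_row_eq (h (Submodule.subset_span ⟨1, 0, rfl⟩)) 0 (by simp [Fin.forall_fin_succ])
    have r1 : ![0, 1, 0] ∈ B :=
      mem_of_row_eq (h (Submodule.subset_span ⟨0, 1, rfl⟩)) 1 (by simp [Fin.forall_fin_succ])
    exact ⟨two_le_finrank_left c0 c1, two_le_finrank_right r0 r1⟩

theorem hasMinSegre_o6 {U : PG F 1}
    (hU : U.1 = rep2 fun x y => !![x, 0, 0; y, x, 0]) : HasMinSegre U (2, 2) := by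
  refine hasMinSegre_of_le (A := ⊤) (B := hyper 2) (by simp) (finrank_hyper 2) ?_ ?_
  · rw [hU]
    refine Submodule.span_le.2 ?_
    rintro _ ⟨x, y, rfl⟩
    exact tens_mem_tensorSub (by simp [Fin.forall_fin_succ])
  · intro A B h
    rw [hU] at h
    have c0 : ![1, 0] ∈ A :=
      mem_of_col_eq (h (Submodule.subset_span ⟨1, 0, rfl⟩)) 0 (by simp [Fin.forall_fin_succ])
    have c1 : ![0, 1] ∈ A :=
      mem_of_col_eq (h (Submodule.subset_span ⟨0, 1, rfl⟩)) 0 (by simp [Fin.forall_fin_succ])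
    have r0 : ![1, 0, 0] ∈ B :=
      mem_of_row_eq (h (Submodule.subset_span ⟨0, 1, rfl⟩)) 1 (by simp [Fin.forall_fin_succ])
    have r1 : ![0, 1, 0] ∈ B :=
      mem_of_row_eq (h (Submodule.subset_span ⟨1, 0, rfl⟩)) 1 (by simp [Fin.forall_fin_succ])
    exact ⟨two_le_finrank_left c0 c1, two_le_finrank_right r0 r1⟩

theorem hasMinSegre_o7 {U : PG F 1}
    (hU : U.1 = rep2 fun x y => !![x, y, 0; 0, 0, x]) : HasMinSegre U (2, 3) := by
  refine hasMinSegre_of_le (A := ⊤) (B := ⊤) (by simp) (by simp) ?_ ?_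
  · rw [hU]
    refine Submodule.span_le.2 ?_
    rintro _ ⟨x, y, rfl⟩
    exact tens_mem_tensorSub (by simp)
  · intro A B h
    rw [hU] at h
    have c0 : ![1, 0] ∈ A :=
      mem_of_col_eq (h (Submodule.subset_span ⟨1, 0, rfl⟩)) 0 (by simp [Fin.forall_fin_succ])
    have c1 : ![0, 1] ∈ A :=
      mem_of_col_eq (h (Submodule.subset_span ⟨1, 0, rfl⟩)) 2 (by simp [Fin.forall_fin_succ])
    have r0 : ![1, 0, 0] ∈ B :=
      mem_of_row_eq (h (Submodule.subset_span ⟨1, 0, rfl⟩)) 0 (by simp [Fin.forall_fin_succ])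
    have r1 : ![0, 1, 0] ∈ B :=
      mem_of_row_eq (h (Submodule.subset_span ⟨0, 1, rfl⟩)) 0 (by simp [Fin.forall_fin_succ])
    have r2 : ![0, 0, 1] ∈ B :=
      mem_of_row_eq (h (Submodule.subset_span ⟨1, 0, rfl⟩)) 1 (by simp [Fin.forall_fin_succ])
    exact ⟨two_le_finrank_left c0 c1, three_le_finrank_right r0 r1 r2⟩

theorem hasMinSegre_o10 {U : PG F 1} {u v : F} (huv : QuadCond u v)
    (hU : U.1 = rep2 fun x y => !![x, u * x + y, 0; v * y, x, 0]) : HasMinSegre U (2, 2) := by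
  refine hasMinSegre_of_le (A := ⊤) (B := hyper 2) (by simp) (finrank_hyper 2) ?_ ?_
  · rw [hU]
    refine Submodule.span_le.2 ?_
    rintro _ ⟨x, y, rfl⟩
    exact tens_mem_tensorSub (by simp [Fin.forall_fin_succ])
  · intro A B h
    rw [hU] at h
    have c0 : ![1, 0] ∈ A :=
      mem_of_col_eq (h (Submodule.subset_span ⟨0, 1, rfl⟩)) 1 (by simp [Fin.forall_fin_succ])
    -- The column and the row used here and below have entry `v` instead of 1; `v` is nonzero by
    -- `QuadCond`.
    have c1 : ![0, 1] ∈ A := by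
      have h' := A.smul_mem v⁻¹ (col_mem (h (Submodule.subset_span ⟨0, 1, rfl⟩)) 0)
      convert h' using 1
      ext k
      fin_cases k <;> simp [huv.1]
    have r0 : ![1, 0, 0] ∈ B := by
      have h' := B.smul_mem v⁻¹ (row_mem (h (Submodule.subset_span ⟨0, 1, rfl⟩)) 1)
      convert h' using 1
      ext k
      fin_cases k <;> simp [huv.1]
    have r1 : ![0, 1, 0] ∈ B :=
      mem_of_row_eq (h (Submodule.subset_span ⟨0, 1, rfl⟩)) 0 (by simp [Fin.forall_fin_succ])
    exact ⟨two_le_finrank_left c0 c1, two_le_finrank_right r0 r1⟩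

theorem hasMinSegre_o11 {U : PG F 1}
    (hU : U.1 = rep2 fun x y => !![x, y, 0; 0, x, y]) : HasMinSegre U (2, 3) := by
  refine hasMinSegre_of_le (A := ⊤) (B := ⊤) (by simp) (by simp) ?_ ?_
  · rw [hU]
    refine Submodule.span_le.2 ?_
    rintro _ ⟨x, y, rfl⟩
    exact tens_mem_tensorSub (by simp)
  · intro A B h
    rw [hU] at h
    have c0 : ![1, 0] ∈ A :=
      mem_of_col_eq (h (Submodule.subset_span ⟨1, 0, rfl⟩)) 0 (by simp [Fin.forall_fin_succ])
    have c1 : ![0, 1] ∈ A :=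
      mem_of_col_eq (h (Submodule.subset_span ⟨1, 0, rfl⟩)) 1 (by simp [Fin.forall_fin_succ])
    have r0 : ![1, 0, 0] ∈ B :=
      mem_of_row_eq (h (Submodule.subset_span ⟨1, 0, rfl⟩)) 0 (by simp [Fin.forall_fin_succ])
    have r1 : ![0, 1, 0] ∈ B :=
      mem_of_row_eq (h (Submodule.subset_span ⟨0, 1, rfl⟩)) 0 (by simp [Fin.forall_fin_succ])
    have r2 : ![0, 0, 1] ∈ B :=
      mem_of_row_eq (h (Submodule.subset_span ⟨0, 1, rfl⟩)) 1 (by simp [Fin.forall_fin_succ])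
    exact ⟨two_le_finrank_left c0 c1, three_le_finrank_right r0 r1 r2⟩

theorem hasMinSegre_o3 {U : PG F 2}
    (hU : U.1 = rep3 fun x y z => !![x, y, z; 0, 0, 0]) : HasMinSegre U (1, 3) := by
  refine hasMinSegre_of_le (A := hyper 1) (B := ⊤) (finrank_hyper 1) (by simp) ?_ ?_
  · rw [hU]
    refine Submodule.span_le.2 ?_
    rintro _ ⟨x, y, z, rfl⟩
    exact tens_mem_tensorSub (by simp [Fin.forall_fin_succ])
  · intro A B h
    rw [hU] at h
    have c0 : ![1, 0] ∈ A :=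
      mem_of_col_eq (h (Submodule.subset_span ⟨1, 0, 0, rfl⟩)) 0 (by simp [Fin.forall_fin_succ])
    have r0 : ![1, 0, 0] ∈ B :=
      mem_of_row_eq (h (Submodule.subset_span ⟨1, 0, 0, rfl⟩)) 0 (by simp [Fin.forall_fin_succ])
    have r1 : ![0, 1, 0] ∈ B :=
      mem_of_row_eq (h (Submodule.subset_span ⟨0, 1, 0, rfl⟩)) 0 (by simp [Fin.forall_fin_succ])
    have r2 : ![0, 0, 1] ∈ B :=
      mem_of_row_eq (h (Submodule.subset_span ⟨0, 0, 1, rfl⟩)) 0 (by simp [Fin.forall_fin_succ])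
    exact ⟨one_le_finrank c0 (by simp), three_le_finrank_right r0 r1 r2⟩

theorem hasMinSegre_o7T {U : PG F 2}
    (hU : U.1 = rep3 fun x y z => !![z, 0, 0; x, y, 0]) : HasMinSegre U (2, 2) := by
  refine hasMinSegre_of_le (A := ⊤) (B := hyper 2) (by simp) (finrank_hyper 2) ?_ ?_
  · rw [hU]
    refine Submodule.span_le.2 ?_
    rintro _ ⟨x, y, z, rfl⟩
    exact tens_mem_tensorSub (by simp [Fin.forall_fin_succ])
  · intro A B h
    rw [hU] at h
    have c0 : ![1, 0] ∈ A :=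
      mem_of_col_eq (h (Submodule.subset_span ⟨0, 0, 1, rfl⟩)) 0 (by simp [Fin.forall_fin_succ])
    have c1 : ![0, 1] ∈ A :=
      mem_of_col_eq (h (Submodule.subset_span ⟨1, 0, 0, rfl⟩)) 0 (by simp [Fin.forall_fin_succ])
    have r0 : ![1, 0, 0] ∈ B :=
      mem_of_row_eq (h (Submodule.subset_span ⟨1, 0, 0, rfl⟩)) 1 (by simp [Fin.forall_fin_succ])
    have r1 : ![0, 1, 0] ∈ B :=
      mem_of_row_eq (h (Submodule.subset_span ⟨0, 1, 0, rfl⟩)) 1 (by simp [Fin.forall_fin_succ])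
    exact ⟨two_le_finrank_left c0 c1, two_le_finrank_right r0 r1⟩

theorem hasMinSegre_o8 {U : PG F 2}
    (hU : U.1 = rep3 fun x y z => !![x, 0, 0; 0, y, z]) : HasMinSegre U (2, 3) := by
  refine hasMinSegre_of_le (A := ⊤) (B := ⊤) (by simp) (by simp) ?_ ?_
  · rw [hU]
    refine Submodule.span_le.2 ?_
    rintro _ ⟨x, y, z, rfl⟩
    exact tens_mem_tensorSub (by simp)
  · intro A B h
    rw [hU] at h
    have c0 : ![1, 0] ∈ A :=
      mem_of_col_eq (h (Submodule.subset_span ⟨1, 0, 0, rfl⟩)) 0 (by simp [Fin.forall_fin_succ])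
    have c1 : ![0, 1] ∈ A :=
      mem_of_col_eq (h (Submodule.subset_span ⟨0, 1, 0, rfl⟩)) 1 (by simp [Fin.forall_fin_succ])
    have r0 : ![1, 0, 0] ∈ B :=
      mem_of_row_eq (h (Submodule.subset_span ⟨1, 0, 0, rfl⟩)) 0 (by simp [Fin.forall_fin_succ])
    have r1 : ![0, 1, 0] ∈ B :=
      mem_of_row_eq (h (Submodule.subset_span ⟨0, 1, 0, rfl⟩)) 1 (by simp [Fin.forall_fin_succ])
    have r2 : ![0, 0, 1] ∈ B :=
      mem_of_row_eq (h (Submodule.subset_span ⟨0, 0, 1, rfl⟩)) 1 (by simp [Fin.forall_fin_succ])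
    exact ⟨two_le_finrank_left c0 c1, three_le_finrank_right r0 r1 r2⟩

theorem hasMinSegre_o9 {U : PG F 2}
    (hU : U.1 = rep3 fun x y z => !![z, 0, 0; x, y, z]) : HasMinSegre U (2, 3) := by
  refine hasMinSegre_of_le (A := ⊤) (B := ⊤) (by simp) (by simp) ?_ ?_
  · rw [hU]
    refine Submodule.span_le.2 ?_
    rintro _ ⟨x, y, z, rfl⟩
    exact tens_mem_tensorSub (by simp)
  · intro A B h
    rw [hU] at h
    have c0 : ![1, 0] ∈ A :=
      mem_of_col_eq (h (Submodule.subset_span ⟨0, 0, 1, rfl⟩)) 0 (by simp [Fin.forall_fin_succ])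
    have c1 : ![0, 1] ∈ A :=
      mem_of_col_eq (h (Submodule.subset_span ⟨1, 0, 0, rfl⟩)) 0 (by simp [Fin.forall_fin_succ])
    have r0 : ![1, 0, 0] ∈ B :=
      mem_of_row_eq (h (Submodule.subset_span ⟨1, 0, 0, rfl⟩)) 1 (by simp [Fin.forall_fin_succ])
    have r1 : ![0, 1, 0] ∈ B :=
      mem_of_row_eq (h (Submodule.subset_span ⟨0, 1, 0, rfl⟩)) 1 (by simp [Fin.forall_fin_succ])
    have r2 : ![0, 0, 1] ∈ B :=
      mem_of_row_eq (h (Submodule.subset_span ⟨0, 0, 1, rfl⟩)) 1 (by simp [Fin.forall_fin_succ])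
    exact ⟨two_le_finrank_left c0 c1, three_le_finrank_right r0 r1 r2⟩

theorem hasMinSegre_o11T {U : PG F 2}
    (hU : U.1 = rep3 fun x y z => !![x, y, 0; y, z, 0]) : HasMinSegre U (2, 2) := by
  refine hasMinSegre_of_le (A := ⊤) (B := hyper 2) (by simp) (finrank_hyper 2) ?_ ?_
  · rw [hU]
    refine Submodule.span_le.2 ?_
    rintro _ ⟨x, y, z, rfl⟩
    exact tens_mem_tensorSub (by simp [Fin.forall_fin_succ])
  · intro A B h
    rw [hU] at h
    have c0 : ![1, 0] ∈ A :=
      mem_of_col_eq (h (Submodule.subset_span ⟨1, 0, 0, rfl⟩)) 0 (by simp [Fin.forall_fin_succ])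
    have c1 : ![0, 1] ∈ A :=
      mem_of_col_eq (h (Submodule.subset_span ⟨0, 1, 0, rfl⟩)) 0 (by simp [Fin.forall_fin_succ])
    have r0 : ![1, 0, 0] ∈ B :=
      mem_of_row_eq (h (Submodule.subset_span ⟨1, 0, 0, rfl⟩)) 0 (by simp [Fin.forall_fin_succ])
    have r1 : ![0, 1, 0] ∈ B :=
      mem_of_row_eq (h (Submodule.subset_span ⟨0, 1, 0, rfl⟩)) 0 (by simp [Fin.forall_fin_succ])
    exact ⟨two_le_finrank_left c0 c1, two_le_finrank_right r0 r1⟩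

theorem hasMinSegre_o12 {U : PG F 2}
    (hU : U.1 = rep3 fun x y z => !![x, y, 0; 0, z, x]) : HasMinSegre U (2, 3) := by
  refine hasMinSegre_of_le (A := ⊤) (B := ⊤) (by simp) (by simp) ?_ ?_
  · rw [hU]
    refine Submodule.span_le.2 ?_
    rintro _ ⟨x, y, z, rfl⟩
    exact tens_mem_tensorSub (by simp)
  · intro A B h
    rw [hU] at h
    have c0 : ![1, 0] ∈ A :=
      mem_of_col_eq (h (Submodule.subset_span ⟨1, 0, 0, rfl⟩)) 0 (by simp [Fin.forall_fin_succ])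
    have c1 : ![0, 1] ∈ A :=
      mem_of_col_eq (h (Submodule.subset_span ⟨1, 0, 0, rfl⟩)) 2 (by simp [Fin.forall_fin_succ])
    have r0 : ![1, 0, 0] ∈ B :=
      mem_of_row_eq (h (Submodule.subset_span ⟨1, 0, 0, rfl⟩)) 0 (by simp [Fin.forall_fin_succ])
    have r1 : ![0, 1, 0] ∈ B :=
      mem_of_row_eq (h (Submodule.subset_span ⟨0, 1, 0, rfl⟩)) 0 (by simp [Fin.forall_fin_succ])
    have r2 : ![0, 0, 1] ∈ B :=
      mem_of_row_eq (h (Submodule.subset_span ⟨1, 0, 0, rfl⟩)) 1 (by simp [Fin.forall_fin_succ])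
    exact ⟨two_le_finrank_left c0 c1, three_le_finrank_right r0 r1 r2⟩

theorem hasMinSegre_o13 {U : PG F 2}
    (hU : U.1 = rep3 fun x y z => !![x, y, 0; 0, x, z]) : HasMinSegre U (2, 3) := by
  refine hasMinSegre_of_le (A := ⊤) (B := ⊤) (by simp) (by simp) ?_ ?_
  · rw [hU]
    refine Submodule.span_le.2 ?_
    rintro _ ⟨x, y, z, rfl⟩
    exact tens_mem_tensorSub (by simp)
  · intro A B h
    rw [hU] at h
    have c0 : ![1, 0] ∈ A :=
      mem_of_col_eq (h (Submodule.subset_span ⟨1, 0, 0, rfl⟩)) 0 (by simp [Fin.forall_fin_succ])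
    have c1 : ![0, 1] ∈ A :=
      mem_of_col_eq (h (Submodule.subset_span ⟨1, 0, 0, rfl⟩)) 1 (by simp [Fin.forall_fin_succ])
    have r0 : ![1, 0, 0] ∈ B :=
      mem_of_row_eq (h (Submodule.subset_span ⟨1, 0, 0, rfl⟩)) 0 (by simp [Fin.forall_fin_succ])
    have r1 : ![0, 1, 0] ∈ B :=
      mem_of_row_eq (h (Submodule.subset_span ⟨0, 1, 0, rfl⟩)) 0 (by simp [Fin.forall_fin_succ])
    have r2 : ![0, 0, 1] ∈ B :=
      mem_of_row_eq (h (Submodule.subset_span ⟨0, 0, 1, rfl⟩)) 1 (by simp [Fin.forall_fin_succ])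
    exact ⟨two_le_finrank_left c0 c1, three_le_finrank_right r0 r1 r2⟩

theorem hasMinSegre_o14 {U : PG F 2}
    (hU : U.1 = rep3 fun x y z => !![x, y, 0; 0, y, z]) : HasMinSegre U (2, 3) := by
  refine hasMinSegre_of_le (A := ⊤) (B := ⊤) (by simp) (by simp) ?_ ?_
  · rw [hU]
    refine Submodule.span_le.2 ?_
    rintro _ ⟨x, y, z, rfl⟩
    exact tens_mem_tensorSub (by simp)
  · intro A B h
    rw [hU] at h
    have c0 : ![1, 0] ∈ A :=
      mem_of_col_eq (h (Submodule.subset_span ⟨1, 0, 0, rfl⟩)) 0 (by simp [Fin.forall_fin_succ])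
    have c1 : ![0, 1] ∈ A :=
      mem_of_col_eq (h (Submodule.subset_span ⟨0, 0, 1, rfl⟩)) 2 (by simp [Fin.forall_fin_succ])
    have r0 : ![1, 0, 0] ∈ B :=
      mem_of_row_eq (h (Submodule.subset_span ⟨1, 0, 0, rfl⟩)) 0 (by simp [Fin.forall_fin_succ])
    have r1 : ![0, 1, 0] ∈ B :=
      mem_of_row_eq (h (Submodule.subset_span ⟨0, 1, 0, rfl⟩)) 0 (by simp [Fin.forall_fin_succ])
    have r2 : ![0, 0, 1] ∈ B :=
      mem_of_row_eq (h (Submodule.subset_span ⟨0, 0, 1, rfl⟩)) 1 (by simp [Fin.forall_fin_succ])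
    exact ⟨two_le_finrank_left c0 c1, three_le_finrank_right r0 r1 r2⟩

theorem hasMinSegre_o15 {U : PG F 2} {u v : F} (huv : QuadCond u v)
    (hU : U.1 = rep3 fun x y z => !![x, u * x + y, z; v * y, x, 0]) : HasMinSegre U (2, 3) := by
  refine hasMinSegre_of_le (A := ⊤) (B := ⊤) (by simp) (by simp) ?_ ?_
  · rw [hU]
    refine Submodule.span_le.2 ?_
    rintro _ ⟨x, y, z, rfl⟩
    exact tens_mem_tensorSub (by simp)
  · intro A B h
    rw [hU] at h
    have c0 : ![1, 0] ∈ A :=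
      mem_of_col_eq (h (Submodule.subset_span ⟨0, 1, 0, rfl⟩)) 1 (by simp [Fin.forall_fin_succ])
    have c1 : ![0, 1] ∈ A := by
      have h' := A.smul_mem v⁻¹ (col_mem (h (Submodule.subset_span ⟨0, 1, 0, rfl⟩)) 0)
      convert h' using 1
      ext k
      fin_cases k <;> simp [huv.1]
    have r0 : ![1, 0, 0] ∈ B := by
      have h' := B.smul_mem v⁻¹ (row_mem (h (Submodule.subset_span ⟨0, 1, 0, rfl⟩)) 1)
      convert h' using 1
      ext k
      fin_cases k <;> simp [huv.1]
    have r1 : ![0, 1, 0] ∈ B :=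
      mem_of_row_eq (h (Submodule.subset_span ⟨0, 1, 0, rfl⟩)) 0 (by simp [Fin.forall_fin_succ])
    have r2 : ![0, 0, 1] ∈ B :=
      mem_of_row_eq (h (Submodule.subset_span ⟨0, 0, 1, rfl⟩)) 0 (by simp [Fin.forall_fin_succ])
    exact ⟨two_le_finrank_left c0 c1, three_le_finrank_right r0 r1 r2⟩

theorem hasMinSegre_o16 {U : PG F 2}
    (hU : U.1 = rep3 fun x y z => !![x, y, z; 0, x, y]) : HasMinSegre U (2, 3) := by
  refine hasMinSegre_of_le (A := ⊤) (B := ⊤) (by simp) (by simp) ?_ ?_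
  · rw [hU]
    refine Submodule.span_le.2 ?_
    rintro _ ⟨x, y, z, rfl⟩
    exact tens_mem_tensorSub (by simp)
  · intro A B h
    rw [hU] at h
    have c0 : ![1, 0] ∈ A :=
      mem_of_col_eq (h (Submodule.subset_span ⟨1, 0, 0, rfl⟩)) 0 (by simp [Fin.forall_fin_succ])
    have c1 : ![0, 1] ∈ A :=
      mem_of_col_eq (h (Submodule.subset_span ⟨1, 0, 0, rfl⟩)) 1 (by simp [Fin.forall_fin_succ])
    have r0 : ![1, 0, 0] ∈ B :=
      mem_of_row_eq (h (Submodule.subset_span ⟨1, 0, 0, rfl⟩)) 0 (by simp [Fin.forall_fin_succ])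
    have r1 : ![0, 1, 0] ∈ B :=
      mem_of_row_eq (h (Submodule.subset_span ⟨0, 1, 0, rfl⟩)) 0 (by simp [Fin.forall_fin_succ])
    have r2 : ![0, 0, 1] ∈ B :=
      mem_of_row_eq (h (Submodule.subset_span ⟨0, 0, 1, rfl⟩)) 0 (by simp [Fin.forall_fin_succ])
    exact ⟨two_le_finrank_left c0 c1, three_le_finrank_right r0 r1 r2⟩

/-! ### Intersections with the Segre variety -/

theorem mem_meet_iff {d : ℕ} {U : PG F d} {p : PG F 0} :
    p ∈ meet U ↔ ∃ a b, a ≠ 0 ∧ b ≠ 0 ∧ p.1 = Submodule.span F {a ⊗ₜ[F] b} ∧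
      a ⊗ₜ[F] b ∈ U.1 := by
  constructor
  · rintro ⟨⟨a, -, b, -, ha, hb, hp⟩, hU⟩
    refine ⟨a, b, ha, hb, hp, hU ?_⟩
    rw [hp]
    exact Submodule.mem_span_singleton_self _
  · rintro ⟨a, b, ha, hb, hp, hU⟩
    refine ⟨⟨a, trivial, b, trivial, ha, hb, hp⟩, ?_⟩
    rw [hp, Submodule.span_singleton_le_iff_mem]
    exact hU

theorem ne_zero_fin_two {a : Fin 2 → F} : a ≠ 0 ↔ a 0 ≠ 0 ∨ a 1 ≠ 0 := by
  rw [Function.ne_iff, Fin.exists_fin_two]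
  rfl

theorem ne_zero_fin_three {b : Fin 3 → F} : b ≠ 0 ↔ b 0 ≠ 0 ∨ b 1 ≠ 0 ∨ b 2 ≠ 0 := by
  rw [Function.ne_iff]
  simp [Fin.exists_fin_succ]

theorem meet_eq_segreSub {d : ℕ} {U : PG F d} {A : Submodule F (Fin 2 → F)}
    {B : Submodule F (Fin 3 → F)}
    (h : ∀ a b, a ≠ 0 → b ≠ 0 → (a ⊗ₜ[F] b ∈ U.1 ↔ a ∈ A ∧ b ∈ B)) :
    meet U = segreSub A B := by
  ext p
  rw [mem_meet_iff]
  constructor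
  · rintro ⟨a, b, ha, hb, hp, hU⟩
    obtain ⟨hA, hB⟩ := (h a b ha hb).1 hU
    exact ⟨a, hA, b, hB, ha, hb, hp⟩
  · rintro ⟨a, hA, b, hB, ha, hb, hp⟩
    exact ⟨a, b, ha, hb, hp, (h a b ha hb).2 ⟨hA, hB⟩⟩

theorem meet_eq_union {d : ℕ} {U : PG F d} {A A' : Submodule F (Fin 2 → F)}
    {B B' : Submodule F (Fin 3 → F)}
    (h : ∀ a b, a ≠ 0 → b ≠ 0 → (a ⊗ₜ[F] b ∈ U.1 ↔ a ∈ A ∧ b ∈ B ∨ a ∈ A' ∧ b ∈ B')) :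
    meet U = segreSub A B ∪ segreSub A' B' := by
  ext p
  rw [mem_meet_iff]
  constructor
  · rintro ⟨a, b, ha, hb, hp, hU⟩
    rcases (h a b ha hb).1 hU with ⟨hA, hB⟩ | ⟨hA, hB⟩
    · exact .inl ⟨a, hA, b, hB, ha, hb, hp⟩
    · exact .inr ⟨a, hA, b, hB, ha, hb, hp⟩
  · rintro (⟨a, hA, b, hB, ha, hb, hp⟩ | ⟨a, hA, b, hB, ha, hb, hp⟩)
    · exact ⟨a, b, ha, hb, hp, (h a b ha hb).2 (.inl ⟨hA, hB⟩)⟩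
    · exact ⟨a, b, ha, hb, hp, (h a b ha hb).2 (.inr ⟨hA, hB⟩)⟩

theorem eq_pt {p : PG F 0} {a a' : Fin 2 → F} {b b' : Fin 3 → F} {s t : F} (ha : a ≠ 0)
    (hb : b ≠ 0) (ha' : a' ≠ 0) (hb' : b' ≠ 0) (hs : a' = s • a) (ht : b' = t • b)
    (hp : p.1 = Submodule.span F {a' ⊗ₜ[F] b'}) : p = pt a b ha hb := by
  subst hs ht
  refine Subtype.ext ?_
  rw [hp, TensorProduct.smul_tmul_smul]
  refine Submodule.span_singleton_smul_eq (IsUnit.mk0 _ (mul_ne_zero ?_ ?_)) _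
  · rintro rfl
    simp at ha'
  · rintro rfl
    simp at hb'

/-- Proportionality of two pure tensors spanning the same point, in coordinates. -/
theorem exists_mul_eq_of_span_eq {a a' : Fin 2 → F} {b b' : Fin 3 → F}
    (h : Submodule.span F {a ⊗ₜ[F] b} = Submodule.span F {a' ⊗ₜ[F] b'}) :
    ∃ c : F, ∀ i j, a i * b j = c * (a' i * b' j) := by
  have : a ⊗ₜ[F] b ∈ Submodule.span F {a' ⊗ₜ[F] b'} := by
    rw [← h]
    exact Submodule.mem_span_singleton_self _
  obtain ⟨c, hc⟩ := Submodule.mem_span_singleton.1 this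
  refine ⟨c, fun i j => ?_⟩
  rw [← entry_tmul, ← hc, map_smul, entry_tmul, smul_eq_mul]

/-- A coordinate that vanishes on one of the tensors and not on the other separates the points. -/
theorem pt_ne {a a' : Fin 2 → F} {b b' : Fin 3 → F} {ha : a ≠ 0} {hb : b ≠ 0} {ha' : a' ≠ 0}
    {hb' : b' ≠ 0} (i : Fin 2) (j : Fin 3) (h : a i * b j ≠ 0) (h' : a' i * b' j = 0) :
    pt a b ha hb ≠ pt a' b' ha' hb' := by
  intro e
  obtain ⟨c, hc⟩ := exists_mul_eq_of_span_eq (congrArg Subtype.val e)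
  rw [hc, h', mul_zero] at h
  exact h rfl

theorem pt_mem_meet {d : ℕ} {U : PG F d} {a : Fin 2 → F} {b : Fin 3 → F} {ha : a ≠ 0}
    {hb : b ≠ 0} : pt a b ha hb ∈ meet U ↔ a ⊗ₜ[F] b ∈ U.1 := by
  rw [mem_meet_iff]
  constructor
  · rintro ⟨a', b', -, -, hp, hU⟩
    have : a ⊗ₜ[F] b ∈ Submodule.span F {a' ⊗ₜ[F] b'} := by
      rw [← hp]
      exact Submodule.mem_span_singleton_self _
    exact (Submodule.span_singleton_le_iff_mem _ _).2 hU this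
  · exact fun h => ⟨a, b, ha, hb, rfl, h⟩

theorem ncard_meet_eq_one {d : ℕ} {U : PG F d} {a : Fin 2 → F} {b : Fin 3 → F} (ha : a ≠ 0)
    (hb : b ≠ 0) (hU : a ⊗ₜ[F] b ∈ U.1)
    (h : ∀ a' b', a' ≠ 0 → b' ≠ 0 → a' ⊗ₜ[F] b' ∈ U.1 → ∃ s t : F, a' = s • a ∧ b' = t • b) :
    (meet U).ncard = 1 := by
  rw [Set.ncard_eq_one]
  refine ⟨pt a b ha hb, Set.eq_singleton_iff_unique_mem.2 ⟨pt_mem_meet.2 hU, fun p hp => ?_⟩⟩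
  obtain ⟨a', b', ha', hb', hp, hU'⟩ := mem_meet_iff.1 hp
  obtain ⟨s, t, hs, ht⟩ := h a' b' ha' hb' hU'
  exact eq_pt ha hb ha' hb' hs ht hp

theorem ncard_meet_eq_two {d : ℕ} {U : PG F d} {a₁ a₂ : Fin 2 → F} {b₁ b₂ : Fin 3 → F}
    (ha₁ : a₁ ≠ 0) (hb₁ : b₁ ≠ 0) (ha₂ : a₂ ≠ 0) (hb₂ : b₂ ≠ 0) (hU₁ : a₁ ⊗ₜ[F] b₁ ∈ U.1)
    (hU₂ : a₂ ⊗ₜ[F] b₂ ∈ U.1) (hne : pt a₁ b₁ ha₁ hb₁ ≠ pt a₂ b₂ ha₂ hb₂)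
    (h : ∀ a' b', a' ≠ 0 → b' ≠ 0 → a' ⊗ₜ[F] b' ∈ U.1 →
      (∃ s t : F, a' = s • a₁ ∧ b' = t • b₁) ∨ ∃ s t : F, a' = s • a₂ ∧ b' = t • b₂) :
    (meet U).ncard = 2 := by
  rw [Set.ncard_eq_two]
  refine ⟨_, _, hne, ?_⟩
  ext p
  constructor
  · intro hp
    obtain ⟨a', b', ha', hb', hp, hU'⟩ := mem_meet_iff.1 hp
    rcases h a' b' ha' hb' hU' with ⟨s, t, hs, ht⟩ | ⟨s, t, hs, ht⟩
    · exact .inl (eq_pt _ _ ha' hb' hs ht hp)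
    · exact .inr (eq_pt _ _ ha' hb' hs ht hp)
  · rintro (rfl | rfl)
    · exact pt_mem_meet.2 hU₁
    · exact pt_mem_meet.2 hU₂

theorem ncard_meet_eq_three {d : ℕ} {U : PG F d} {a₁ a₂ a₃ : Fin 2 → F} {b₁ b₂ b₃ : Fin 3 → F}
    (ha₁ : a₁ ≠ 0) (hb₁ : b₁ ≠ 0) (ha₂ : a₂ ≠ 0) (hb₂ : b₂ ≠ 0) (ha₃ : a₃ ≠ 0) (hb₃ : b₃ ≠ 0)
    (hU₁ : a₁ ⊗ₜ[F] b₁ ∈ U.1) (hU₂ : a₂ ⊗ₜ[F] b₂ ∈ U.1) (hU₃ : a₃ ⊗ₜ[F] b₃ ∈ U.1)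
    (h₁₂ : pt a₁ b₁ ha₁ hb₁ ≠ pt a₂ b₂ ha₂ hb₂) (h₁₃ : pt a₁ b₁ ha₁ hb₁ ≠ pt a₃ b₃ ha₃ hb₃)
    (h₂₃ : pt a₂ b₂ ha₂ hb₂ ≠ pt a₃ b₃ ha₃ hb₃)
    (h : ∀ a' b', a' ≠ 0 → b' ≠ 0 → a' ⊗ₜ[F] b' ∈ U.1 →
      (∃ s t : F, a' = s • a₁ ∧ b' = t • b₁) ∨ (∃ s t : F, a' = s • a₂ ∧ b' = t • b₂) ∨
        ∃ s t : F, a' = s • a₃ ∧ b' = t • b₃) :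
    (meet U).ncard = 3 := by
  rw [Set.ncard_eq_three]
  refine ⟨_, _, _, h₁₂, h₁₃, h₂₃, ?_⟩
  ext p
  constructor
  · intro hp
    obtain ⟨a', b', ha', hb', hp, hU'⟩ := mem_meet_iff.1 hp
    rcases h a' b' ha' hb' hU' with ⟨s, t, hs, ht⟩ | ⟨s, t, hs, ht⟩ | ⟨s, t, hs, ht⟩
    · exact .inl (eq_pt _ _ ha' hb' hs ht hp)
    · exact .inr (.inl (eq_pt _ _ ha' hb' hs ht hp))
    · exact .inr (.inr (eq_pt _ _ ha' hb' hs ht hp))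
  · rintro (rfl | rfl | rfl)
    · exact pt_mem_meet.2 hU₁
    · exact pt_mem_meet.2 hU₂
    · exact pt_mem_meet.2 hU₃

theorem meet_eq_empty {d : ℕ} {U : PG F d} (h : ∀ a b, a ≠ 0 → b ≠ 0 → a ⊗ₜ[F] b ∉ U.1) :
    meet U = ∅ := by
  refine Set.eq_empty_iff_forall_notMem.2 fun p hp => ?_
  obtain ⟨a, b, ha, hb, -, hU⟩ := mem_meet_iff.1 hp
  exact h a b ha hb hU

theorem eq_smul_pair {a : Fin 2 → F} {r s t : F} (h0 : a 0 = t * r) (h1 : a 1 = t * s) :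
    a = t • ![r, s] := by
  ext i
  fin_cases i
  · simpa using h0
  · simpa using h1

theorem eq_smul_triple {b : Fin 3 → F} {q r s t : F} (h0 : b 0 = t * q) (h1 : b 1 = t * r)
    (h2 : b 2 = t * s) : b = t • ![q, r, s] := by
  ext i
  fin_cases i
  · simpa using h0
  · simpa using h1
  · simpa using h2

theorem mem_span_axis_0 {b : Fin 3 → F} :
    b ∈ Submodule.span F {![1, 0, 0]} ↔ b 1 = 0 ∧ b 2 = 0 := by
  rw [Submodule.mem_span_singleton]
  constructor
  · rintro ⟨c, rfl⟩
    simp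
  · rintro ⟨h, h'⟩
    exact ⟨b 0, (eq_smul_triple (by simp) (by simp [*]) (by simp [*])).symm⟩

theorem mem_span_axis_1 {b : Fin 3 → F} :
    b ∈ Submodule.span F {![0, 1, 0]} ↔ b 0 = 0 ∧ b 2 = 0 := by
  rw [Submodule.mem_span_singleton]
  constructor
  · rintro ⟨c, rfl⟩
    simp
  · rintro ⟨h, h'⟩
    exact ⟨b 1, (eq_smul_triple (by simp [*]) (by simp) (by simp [*])).symm⟩

/-! ### Intersection of each table row with the Segre variety -/

theorem meet_o2 {U : PG F 1} (hU : U.1 = rep2 fun x y => !![x, y, 0; 0, 0, 0]) :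
    IsLineFirstKind (meet U) := by
  refine ⟨hyper 1, hyper 2, finrank_hyper _, finrank_hyper _, meet_eq_segreSub fun a b ha hb => ?_⟩
  rw [hU, mem_rep_o2]
  rw [ne_zero_fin_two] at ha
  rw [ne_zero_fin_three] at hb
  simp only [entry_tmul, mem_hyper]
  grind

theorem meet_o9 {U : PG F 2} (hU : U.1 = rep3 fun x y z => !![z, 0, 0; x, y, z]) :
    IsLineFirstKind (meet U) := by
  refine ⟨hyper 0, hyper 2, finrank_hyper _, finrank_hyper _, meet_eq_segreSub fun a b ha hb => ?_⟩
  rw [hU, mem_rep_o9]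
  rw [ne_zero_fin_two] at ha
  rw [ne_zero_fin_three] at hb
  simp only [entry_tmul, mem_hyper]
  grind

theorem meet_o4T {U : PG F 1} (hU : U.1 = rep2 fun x y => !![x, 0, 0; y, 0, 0]) :
    IsLineSecondKind (meet U) := by
  refine ⟨Submodule.span F {![1, 0, 0]}, finrank_span_singleton (by simp),
    meet_eq_segreSub fun a b ha hb => ?_⟩
  rw [hU, mem_rep_o4T, mem_span_axis_0]
  rw [ne_zero_fin_two] at ha
  rw [ne_zero_fin_three] at hb
  simp only [entry_tmul, Submodule.mem_top]
  grind

theorem meet_o12 {U : PG F 2} (hU : U.1 = rep3 fun x y z => !![x, y, 0; 0, z, x]) :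
    IsLineSecondKind (meet U) := by
  refine ⟨Submodule.span F {![0, 1, 0]}, finrank_span_singleton (by simp),
    meet_eq_segreSub fun a b ha hb => ?_⟩
  rw [hU, mem_rep_o12, mem_span_axis_1]
  rw [ne_zero_fin_two] at ha
  rw [ne_zero_fin_three] at hb
  simp only [entry_tmul, Submodule.mem_top]
  grind

theorem meet_o3 {U : PG F 2} (hU : U.1 = rep3 fun x y z => !![x, y, z; 0, 0, 0]) :
    IsSegrePlane (meet U) := by
  refine ⟨hyper 1, finrank_hyper _, meet_eq_segreSub fun a b ha hb => ?_⟩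
  rw [hU, mem_rep_o3]
  rw [ne_zero_fin_two] at ha
  rw [ne_zero_fin_three] at hb
  simp only [entry_tmul, mem_hyper, Submodule.mem_top]
  grind

theorem meet_o7T {U : PG F 2} (hU : U.1 = rep3 fun x y z => !![z, 0, 0; x, y, 0]) :
    ∃ S T, IsLineFirstKind S ∧ IsLineSecondKind T ∧ (S ∩ T).ncard = 1 ∧ meet U = S ∪ T := by
  refine ⟨segreSub (hyper 0) (hyper 2), segreSub ⊤ (Submodule.span F {![1, 0, 0]}),
    ⟨_, _, finrank_hyper _, finrank_hyper _, rfl⟩, ⟨_, finrank_span_singleton (by simp), rfl⟩,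
    ?_, meet_eq_union fun a b ha hb => ?_⟩
  · rw [Set.ncard_eq_one]
    refine ⟨pt ![0, 1] ![1, 0, 0] (by simp) (by simp), Set.eq_singleton_iff_unique_mem.2 ⟨⟨?_, ?_⟩, ?_⟩⟩
    · exact ⟨_, by simp, _, by simp, by simp, by simp, rfl⟩
    · exact ⟨_, by simp, _, Submodule.mem_span_singleton_self _, by simp, by simp, rfl⟩
    · rintro p ⟨⟨a, ha, b, hb, ha0, hb0, hp⟩, ⟨a', -, b', hb', ha0', hb0', hp'⟩⟩
      obtain ⟨c, hc⟩ := exists_mul_eq_of_span_eq (hp.symm.trans hp')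
      rw [mem_span_axis_0] at hb'
      have ha1 := (ne_zero_fin_two.1 ha0).resolve_left (not_not.2 ha)
      have hb1 : b 1 = 0 := by
        have := hc 1 1
        rw [hb'.1, mul_zero, mul_zero] at this
        exact (mul_eq_zero.1 this).resolve_left ha1
      exact eq_pt (s := a 1) (t := b 0) _ _ ha0 hb0 (eq_smul_pair (by simpa using ha) (by simp))
        (eq_smul_triple (by simp) (by simpa using hb1) (by simpa using hb)) hp
  · rw [hU, mem_rep_o7T, mem_span_axis_0]
    rw [ne_zero_fin_two] at ha
    rw [ne_zero_fin_three] at hb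
    simp only [entry_tmul, mem_hyper, Submodule.mem_top]
    grind

theorem meet_o8 {U : PG F 2} (hU : U.1 = rep3 fun x y z => !![x, 0, 0; 0, y, z]) :
    ∃ S p, IsLineFirstKind S ∧ p ∉ S ∧ meet U = S ∪ {p} := by
  refine ⟨segreSub (hyper 0) (hyper 0), pt ![1, 0] ![1, 0, 0] (by simp) (by simp),
    ⟨_, _, finrank_hyper _, finrank_hyper _, rfl⟩, ?_, ?_⟩
  · rintro ⟨a, ha, b, hb, -, -, hp⟩
    obtain ⟨c, hc⟩ := exists_mul_eq_of_span_eq hp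
    have := hc 0 0
    rw [mem_hyper] at ha hb
    simp [ha] at this
  -- The isolated point is itself of the form `segreSub A B`, so that `meet_eq_union` applies.
  have hs : segreSub (hyper 1) (Submodule.span F {![1, 0, 0]}) =
      {pt ![1, 0] ![1, 0, 0] (by simp) (by simp)} := by
    refine Set.eq_singleton_iff_unique_mem.2 ⟨?_, ?_⟩
    · exact ⟨_, by simp, _, Submodule.mem_span_singleton_self _, by simp, by simp, rfl⟩
    · rintro p ⟨a, ha, b, hb, ha0, hb0, hp⟩
      rw [mem_span_axis_0] at hb
      exact eq_pt (s := a 0) (t := b 0) _ _ ha0 hb0 (eq_smul_pair (by simp) (by simpa using ha))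
        (eq_smul_triple (by simp) (by simpa using hb.1) (by simpa using hb.2)) hp
  rw [← hs]
  refine meet_eq_union fun a b ha hb => ?_
  rw [hU, mem_rep_o8, mem_span_axis_0]
  rw [ne_zero_fin_two] at ha
  rw [ne_zero_fin_three] at hb
  simp only [entry_tmul, mem_hyper]
  grind

theorem meet_o1 {U : PG F 0} (hU : U.1 = rep1 fun x => !![x, 0, 0; 0, 0, 0]) :
    (meet U).ncard = 1 := by
  refine ncard_meet_eq_one (a := ![1, 0]) (b := ![1, 0, 0])
    (by simp) (by simp)
    ?_ fun a b ha hb h => ?_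
  · rw [hU, mem_rep_o1]
    simp
  · rw [hU, mem_rep_o1] at h
    rw [ne_zero_fin_two] at ha
    rw [ne_zero_fin_three] at hb
    simp only [entry_tmul] at h
    exact ⟨a 0, b 0, eq_smul_pair (by grind) (by grind), eq_smul_triple (by grind) (by grind) (by grind)⟩

theorem meet_o5 {U : PG F 1} (hU : U.1 = rep2 fun x y => !![x, 0, 0; 0, y, 0]) :
    (meet U).ncard = 2 := by
  refine ncard_meet_eq_two (a₁ := ![1, 0]) (b₁ := ![1, 0, 0]) (a₂ := ![0, 1]) (b₂ := ![0, 1, 0])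
    (by simp) (by simp) (by simp) (by simp)
    ?_ ?_ (pt_ne 0 0 (by simp) (by simp)) fun a b ha hb h => ?_
  · rw [hU, mem_rep_o5]
    simp
  · rw [hU, mem_rep_o5]
    simp
  · rw [hU, mem_rep_o5] at h
    rw [ne_zero_fin_two] at ha
    rw [ne_zero_fin_three] at hb
    simp only [entry_tmul] at h
    rcases eq_or_ne (a 0) 0 with h0 | h0
    · exact .inr ⟨a 1, b 1, eq_smul_pair (by grind) (by grind), eq_smul_triple (by grind) (by grind) (by grind)⟩
    · exact .inl ⟨a 0, b 0, eq_smul_pair (by grind) (by grind), eq_smul_triple (by grind) (by grind) (by grind)⟩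

theorem meet_o6 {U : PG F 1} (hU : U.1 = rep2 fun x y => !![x, 0, 0; y, x, 0]) :
    (meet U).ncard = 1 := by
  refine ncard_meet_eq_one (a := ![0, 1]) (b := ![1, 0, 0])
    (by simp) (by simp)
    ?_ fun a b ha hb h => ?_
  · rw [hU, mem_rep_o6]
    simp
  · rw [hU, mem_rep_o6] at h
    rw [ne_zero_fin_two] at ha
    rw [ne_zero_fin_three] at hb
    simp only [entry_tmul] at h
    exact ⟨a 1, b 0, eq_smul_pair (by grind) (by grind), eq_smul_triple (by grind) (by grind) (by grind)⟩

theorem meet_o7 {U : PG F 1} (hU : U.1 = rep2 fun x y => !![x, y, 0; 0, 0, x]) :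
    (meet U).ncard = 1 := by
  refine ncard_meet_eq_one (a := ![1, 0]) (b := ![0, 1, 0])
    (by simp) (by simp)
    ?_ fun a b ha hb h => ?_
  · rw [hU, mem_rep_o7]
    simp
  · rw [hU, mem_rep_o7] at h
    rw [ne_zero_fin_two] at ha
    rw [ne_zero_fin_three] at hb
    simp only [entry_tmul] at h
    exact ⟨a 0, b 1, eq_smul_pair (by grind) (by grind), eq_smul_triple (by grind) (by grind) (by grind)⟩

theorem meet_o13 {U : PG F 2} (hU : U.1 = rep3 fun x y z => !![x, y, 0; 0, x, z]) :
    (meet U).ncard = 2 := by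
  refine ncard_meet_eq_two (a₁ := ![1, 0]) (b₁ := ![0, 1, 0]) (a₂ := ![0, 1]) (b₂ := ![0, 0, 1])
    (by simp) (by simp) (by simp) (by simp)
    ?_ ?_ (pt_ne 0 1 (by simp) (by simp)) fun a b ha hb h => ?_
  · rw [hU, mem_rep_o13]
    simp
  · rw [hU, mem_rep_o13]
    simp
  · rw [hU, mem_rep_o13] at h
    rw [ne_zero_fin_two] at ha
    rw [ne_zero_fin_three] at hb
    simp only [entry_tmul] at h
    rcases eq_or_ne (a 0) 0 with h0 | h0
    · exact .inr ⟨a 1, b 2, eq_smul_pair (by grind) (by grind), eq_smul_triple (by grind) (by grind) (by grind)⟩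
    · exact .inl ⟨a 0, b 1, eq_smul_pair (by grind) (by grind), eq_smul_triple (by grind) (by grind) (by grind)⟩

theorem meet_o14 {U : PG F 2} (hU : U.1 = rep3 fun x y z => !![x, y, 0; 0, y, z]) :
    (meet U).ncard = 3 := by
  refine ncard_meet_eq_three (a₁ := ![1, 0]) (b₁ := ![1, 0, 0]) (a₂ := ![1, 1]) (b₂ := ![0, 1, 0]) (a₃ := ![0, 1]) (b₃ := ![0, 0, 1])
    (by simp) (by simp) (by simp) (by simp) (by simp) (by simp)
    ?_ ?_ ?_ (pt_ne 0 0 (by simp) (by simp)) (pt_ne 0 0 (by simp) (by simp)) (pt_ne 0 1 (by simp) (by simp)) fun a b ha hb h => ?_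
  · rw [hU, mem_rep_o14]
    simp
  · rw [hU, mem_rep_o14]
    simp
  · rw [hU, mem_rep_o14]
    simp
  · rw [hU, mem_rep_o14] at h
    rw [ne_zero_fin_two] at ha
    rw [ne_zero_fin_three] at hb
    simp only [entry_tmul] at h
    rcases eq_or_ne (a 0) 0 with h0 | h0
    · exact .inr (.inr ⟨a 1, b 2, eq_smul_pair (by grind) (by grind), eq_smul_triple (by grind) (by grind) (by grind)⟩)
    rcases eq_or_ne (a 1) 0 with h1 | h1
    · exact .inl ⟨a 0, b 0, eq_smul_pair (by grind) (by grind), eq_smul_triple (by grind) (by grind) (by grind)⟩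
    · exact .inr (.inl ⟨a 0, b 1, eq_smul_pair (by grind) (by grind), eq_smul_triple (by grind) (by grind) (by grind)⟩)

theorem meet_o16 {U : PG F 2} (hU : U.1 = rep3 fun x y z => !![x, y, z; 0, x, y]) :
    (meet U).ncard = 1 := by
  refine ncard_meet_eq_one (a := ![1, 0]) (b := ![0, 0, 1])
    (by simp) (by simp)
    ?_ fun a b ha hb h => ?_
  · rw [hU, mem_rep_o16]
    simp
  · rw [hU, mem_rep_o16] at h
    rw [ne_zero_fin_two] at ha
    rw [ne_zero_fin_three] at hb
    simp only [entry_tmul] at h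
    exact ⟨a 0, b 2, eq_smul_pair (by grind) (by grind), eq_smul_triple (by grind) (by grind) (by grind)⟩

/-- With `λ = a 0 / a 1` the first equation reads `b 1 = λ b 0`, and the second becomes `v λ² - u v
λ - 1 = 0` after cancelling `b 0`. Then `λ - u` is a root of the polynomial in `QuadCond`. -/
theorem quad_aux {u v : F} (huv : QuadCond u v) {a : Fin 2 → F} {b : Fin 3 → F} (ha : a 1 ≠ 0)
    (hb : b 0 ≠ 0 ∨ b 1 ≠ 0) (h : a 0 * b 0 = a 1 * b 1)
    (h' : a 1 * b 0 = v * (a 0 * b 1 - u * (a 1 * b 1))) : False := by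
  have hb0 : b 0 ≠ 0 := by
    intro h0
    rw [h0, mul_zero] at h
    rcases mul_eq_zero.1 h.symm with h1 | h1
    · exact ha h1
    · rcases hb with hb | hb <;> contradiction
  refine huv.2 (-u + a 0 / a 1) ?_
  have hb1 : b 1 = a 0 / a 1 * b 0 := by
    field_simp
    linear_combination -h
  rw [hb1] at h'
  field_simp at h' ⊢
  linear_combination -h'

theorem meet_o10 {U : PG F 1} {u v : F} (huv : QuadCond u v)
    (hU : U.1 = rep2 fun x y => !![x, u * x + y, 0; v * y, x, 0]) : meet U = ∅ := by
  refine meet_eq_empty fun a b ha hb h => ?_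
  rw [hU, mem_rep_o10] at h
  rw [ne_zero_fin_two] at ha
  rw [ne_zero_fin_three] at hb
  simp only [entry_tmul] at h
  have h1 : a 1 ≠ 0 := by
    have := huv.1
    grind
  have hb2 : b 2 = 0 := (mul_eq_zero.1 h.2.1).resolve_left h1
  exact quad_aux huv h1 (by tauto) h.2.2.1 h.2.2.2

theorem meet_o15 {U : PG F 2} {u v : F} (huv : QuadCond u v)
    (hU : U.1 = rep3 fun x y z => !![x, u * x + y, z; v * y, x, 0]) :
    (meet U).ncard = 1 := by
  refine ncard_meet_eq_one (a := ![1, 0]) (b := ![0, 0, 1])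
    (by simp) (by simp)
    ?_ fun a b ha hb h => ?_
  · rw [hU, mem_rep_o15]
    simp
  · rw [hU, mem_rep_o15] at h
    rw [ne_zero_fin_two] at ha
    rw [ne_zero_fin_three] at hb
    simp only [entry_tmul] at h
    have hv := huv.1
    have h1 : a 1 = 0 := by
      by_contra h1
      have hb2 : b 2 = 0 := (mul_eq_zero.1 h.1).resolve_left h1
      exact quad_aux huv h1 (by tauto) h.2.1 h.2.2
    exact ⟨a 0, b 2, eq_smul_pair (by grind) (by grind), eq_smul_triple (by grind) (by grind) (by grind)⟩

theorem meet_o4 {U : PG F 0} (hU : U.1 = rep1 fun x => !![x, 0, 0; 0, x, 0]) :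
    meet U = ∅ := by
  refine meet_eq_empty fun a b ha hb h => ?_
  rw [hU, mem_rep_o4] at h
  rw [ne_zero_fin_two] at ha
  rw [ne_zero_fin_three] at hb
  simp only [entry_tmul] at h
  grind

theorem meet_o11 {U : PG F 1} (hU : U.1 = rep2 fun x y => !![x, y, 0; 0, x, y]) :
    meet U = ∅ := by
  refine meet_eq_empty fun a b ha hb h => ?_
  rw [hU, mem_rep_o11] at h
  rw [ne_zero_fin_two] at ha
  rw [ne_zero_fin_three] at hb
  simp only [entry_tmul] at h
  grind

/-- The symmetric tensors of the row `o₁₁ᵀ`. -/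
noncomputable def symmTens : (Fin 3 → F) →ₗ[F] V F where
  toFun c := tens !![c 0, c 1, 0; c 1, c 2, 0]
  map_add' c d := ext_entry (by simp [Fin.forall_fin_succ])
  map_smul' r c := ext_entry (by simp [Fin.forall_fin_succ])

theorem symmTens_apply (c : Fin 3 → F) : symmTens c = tens !![c 0, c 1, 0; c 1, c 2, 0] := rfl

theorem symmTens_injective : Function.Injective (symmTens : (Fin 3 → F) →ₗ[F] V F) := by
  intro c d h
  have := tens_injective h
  simp at this
  ext i
  fin_cases i <;> tauto

theorem meet_o11T {U : PG F 2} (hU : U.1 = rep3 fun x y z => !![x, y, 0; y, z, 0]) :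
    IsConicOf U (meet U) := by
  -- The entries `c 0, c 1, c 2` serve as coordinates of the plane, and the conic is the vanishing
  -- of the 2 × 2 determinant `c 0 * c 2 - c 1 ^ 2`.
  have hr : LinearMap.range (symmTens : (Fin 3 → F) →ₗ[F] V F) = U.1 := by
    rw [hU]
    ext t
    rw [isParam_o11T.mem_iff]
    constructor
    · rintro ⟨c, rfl⟩
      exact ⟨c 0, c 1, c 2, rfl⟩
    · rintro ⟨x, y, z, rfl⟩
      exact ⟨![x, y, z], rfl⟩
  refine ⟨(LinearEquiv.ofInjective symmTens symmTens_injective).trans (LinearEquiv.ofEq _ _ hr), ?_⟩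
  ext p
  change _ ↔ ∃ c : Fin 3 → F, c ≠ 0 ∧ c 0 * c 2 = c 1 ^ 2 ∧ p.1 = Submodule.span F {symmTens c}
  rw [mem_meet_iff]
  constructor
  · rintro ⟨a, b, ha, hb, hp, h⟩
    rw [hU, mem_rep_o11T] at h
    simp only [entry_tmul] at h
    have e : a ⊗ₜ[F] b = symmTens ![a 0 * b 0, a 0 * b 1, a 1 * b 1] := by
      rw [symmTens_apply, eq_tens_iff]
      simp [Fin.forall_fin_succ, h]
      exact mul_eq_zero.1 h.2.1
    refine ⟨_, fun h0 => tmul_ne_zero ha hb ?_, ?_, e ▸ hp⟩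
    · rw [e, h0, map_zero]
    · change a 0 * b 0 * (a 1 * b 1) = (a 0 * b 1) ^ 2
      linear_combination -(a 0 * b 1) * h.2.2
  · rintro ⟨c, hc, hc', hp⟩
    suffices h : ∃ a b, a ≠ 0 ∧ b ≠ 0 ∧ symmTens c = a ⊗ₜ[F] b by
      obtain ⟨a, b, ha, hb, e⟩ := h
      exact ⟨a, b, ha, hb, e ▸ hp, hr ▸ e ▸ LinearMap.mem_range_self _ c⟩
    -- Explicit factorizations of a singular symmetric matrix: only the corner `c 2` survives if `c
    -- 0 = 0`; otherwise it is `(c 0, c 1) ⊗ (1, c 1 / c 0, 0)`.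
    rcases eq_or_ne (c 0) 0 with h0 | h0
    · have h1 : c 1 = 0 := by
        rw [h0, zero_mul] at hc'
        exact pow_eq_zero_iff two_ne_zero |>.1 hc'.symm
      have h2 : c 2 ≠ 0 := by
        intro h2
        exact ne_zero_fin_three.1 hc |>.elim (· h0) (·.elim (· h1) (· h2))
      refine ⟨![0, 1], ![0, c 2, 0], by simp, by simpa using h2, ?_⟩
      rw [symmTens_apply, eq_comm, eq_tens_iff]
      simp [Fin.forall_fin_succ, h0, h1]
    · refine ⟨![c 0, c 1], ![1, c 1 / c 0, 0], by simp [h0], by simp, ?_⟩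
      rw [symmTens_apply, eq_comm, eq_tens_iff]
      have e1 : c 0 * (c 1 / c 0) = c 1 := by field_simp
      have e2 : c 1 * (c 1 / c 0) = c 2 := by
        field_simp
        rw [← hc']
      simp [Fin.forall_fin_succ, e1, e2]

/-- The line is the part `z = 0` of the plane. -/
theorem exists_line_o15 {U : PG F 2} {u v : F} (huv : QuadCond u v)
    (hU : U.1 = rep3 fun x y z => !![x, u * x + y, z; v * y, x, 0]) :
    ∃ L ∈ lineOrbit F .o10, L.1 ≤ U.1 := by
  refine ⟨⟨_, (isParam_o10 u v).isRep.finrank_eq⟩, ⟨_, ⟨u, v, huv, rfl⟩, 1, ?_⟩, fun t ht => ?_⟩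
  · rw [act_one, Submodule.map_id]
  · rw [hU, mem_rep_o15]
    exact (mem_rep_o10.1 ht).2

theorem exists_line_o16 {U : PG F 2} (hU : U.1 = rep3 fun x y z => !![x, y, z; 0, x, y]) :
    ∃ L ∈ lineOrbit F .o11, L.1 ≤ U.1 := by
  refine ⟨⟨_, isParam_o11.isRep.finrank_eq⟩, ⟨_, rfl, 1, ?_⟩, fun t ht => ?_⟩
  · rw [act_one, Submodule.map_id]
  · rw [hU, mem_rep_o16]
    exact (mem_rep_o11.1 ht).2

/-! ### The tables for all members of the classes -/

theorem pointTable {t : PointType} {U : PG F 0} (hU : U ∈ pointOrbit F t) :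
    pointMeet U t ∧ HasMinSegre U (pointMin t) := by
  refine orbitsOf_induction (P := fun U => pointMeet U t ∧ HasMinSegre U (pointMin t))
    (fun g U h => ⟨pointMeet_smul g h.1, h.2.smul g⟩) (fun U hU => ?_) hU
  cases t
  · exact ⟨meet_o1 hU, hasMinSegre_o1 hU⟩
  · exact ⟨meet_o4 hU, hasMinSegre_o4 hU⟩

theorem lineTable {t : LineType} {U : PG F 1} (hU : U ∈ lineOrbit F t) :
    lineMeet U t ∧ HasMinSegre U (lineMin t) := by
  refine orbitsOf_induction (P := fun U => lineMeet U t ∧ HasMinSegre U (lineMin t))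
    (fun g U h => ⟨lineMeet_smul g h.1, h.2.smul g⟩) (fun U hU => ?_) hU
  cases t
  · exact ⟨meet_o2 hU, hasMinSegre_o2 hU⟩
  · exact ⟨meet_o4T hU, hasMinSegre_o4T hU⟩
  · exact ⟨meet_o5 hU, hasMinSegre_o5 hU⟩
  · exact ⟨meet_o6 hU, hasMinSegre_o6 hU⟩
  · exact ⟨meet_o7 hU, hasMinSegre_o7 hU⟩
  · obtain ⟨u, v, huv, hU⟩ := hU
    exact ⟨meet_o10 huv hU, hasMinSegre_o10 huv hU⟩
  · exact ⟨meet_o11 hU, hasMinSegre_o11 hU⟩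

/-- The class o₁₇ may be left out: it is empty as soon as every cubic has a root. -/
theorem planeTable {t : PlaneType} (ht : t ≠ .o17) {U : PG F 2} (hU : U ∈ planeOrbit F t) :
    planeMeet U t ∧ HasMinSegre U (planeMin t) := by
  refine orbitsOf_induction (P := fun U => planeMeet U t ∧ HasMinSegre U (planeMin t))
    (fun g U h => ⟨planeMeet_smul g h.1, h.2.smul g⟩) (fun U hU => ?_) hU
  cases t
  · exact ⟨meet_o3 hU, hasMinSegre_o3 hU⟩
  · exact ⟨meet_o7T hU, hasMinSegre_o7T hU⟩
  · exact ⟨meet_o8 hU, hasMinSegre_o8 hU⟩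
  · exact ⟨meet_o9 hU, hasMinSegre_o9 hU⟩
  · exact ⟨meet_o11T hU, hasMinSegre_o11T hU⟩
  · exact ⟨meet_o12 hU, hasMinSegre_o12 hU⟩
  · exact ⟨meet_o13 hU, hasMinSegre_o13 hU⟩
  · exact ⟨meet_o14 hU, hasMinSegre_o14 hU⟩
  · obtain ⟨u, v, huv, hU⟩ := hU
    exact ⟨⟨meet_o15 huv hU, exists_line_o15 huv hU⟩, hasMinSegre_o15 huv hU⟩
  · exact ⟨⟨meet_o16 hU, exists_line_o16 hU⟩, hasMinSegre_o16 hU⟩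
  · exact absurd rfl ht

/-! ### Distinct table rows give distinct orbits -/

/-- Different values of `t` give different points `⟨v + t • w⟩`, so the field embeds in `S`. It is
applied to the two kinds of lines on the Segre variety. -/
theorem infinite_of_pencil [Infinite F] {S : Set (PG F 0)} {v w : V F}
    (h : LinearIndependent F ![v, w])
    (hS : ∀ t : F, ∃ p ∈ S, p.1 = Submodule.span F {v + t • w}) : S.Infinite := by
  choose p hp hpt using hS
  refine Set.infinite_of_injective_forall_mem (f := p) (fun s t e => ?_) hp
  have hs : v + s • w ∈ Submodule.span F {v + t • w} := by
    rw [← hpt, ← e, hpt]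
    exact Submodule.mem_span_singleton_self _
  obtain ⟨c, hc⟩ := Submodule.mem_span_singleton.1 hs
  have h0 : (c - 1) • v + (c * t - s) • w = 0 := by
    trans c • (v + t • w) - (v + s • w)
    · module
    · rw [hc, sub_self]
  obtain ⟨h1, h2⟩ := li_two.1 h _ _ h0
  obtain rfl := sub_eq_zero.1 h1
  rw [one_mul] at h2
  exact (sub_eq_zero.1 h2).symm

theorem li_tmul_left {a : Fin 2 → F} (ha : a ≠ 0) {b b' : Fin 3 → F}
    (h : LinearIndependent F ![b, b']) : LinearIndependent F ![a ⊗ₜ[F] b, a ⊗ₜ[F] b'] := by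
  rw [li_two] at h ⊢
  intro x y e
  refine h x y ?_
  by_contra h0
  refine tmul_ne_zero ha h0 ?_
  rw [← e, TensorProduct.tmul_add, TensorProduct.tmul_smul, TensorProduct.tmul_smul]

theorem li_tmul_right {b : Fin 3 → F} (hb : b ≠ 0) {a a' : Fin 2 → F}
    (h : LinearIndependent F ![a, a']) : LinearIndependent F ![a ⊗ₜ[F] b, a' ⊗ₜ[F] b] := by
  rw [li_two] at h ⊢
  intro x y e
  refine h x y ?_
  by_contra h0
  refine tmul_ne_zero h0 hb ?_
  rw [← e, TensorProduct.add_tmul, TensorProduct.smul_tmul', TensorProduct.smul_tmul']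

theorem add_smul_ne_zero {E : Type*} [AddCommGroup E] [Module F E] {v w : E}
    (h : LinearIndependent F ![v, w]) (t : F) : v + t • w ≠ 0 := by
  intro h0
  exact one_ne_zero (li_two.1 h 1 t (by rw [one_smul, h0])).1

theorem IsLineFirstKind.infinite [Infinite F] {S : Set (PG F 0)} (h : IsLineFirstKind S) :
    S.Infinite := by
  obtain ⟨A, B, hA, hB, rfl⟩ := h
  obtain ⟨a, ha, hali⟩ := exists_li_of_finrank (n := 0) hA
  obtain ⟨b, hb, hbli⟩ := exists_li_of_finrank (n := 1) hB
  have hbli : LinearIndependent F ![b 0, b 1] := by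
    rw [li_two]
    intro x y e
    have := Fintype.linearIndependent_iff.1 hbli ![x, y] (by simpa [Fin.sum_univ_two] using e)
    exact ⟨this 0, this 1⟩
  refine infinite_of_pencil (li_tmul_left (hali.ne_zero 0) hbli) fun t => ?_
  have hne := add_smul_ne_zero hbli t
  refine ⟨pt (a 0) (b 0 + t • b 1) (hali.ne_zero 0) hne, ⟨_, ha 0, _,
    B.add_mem (hb 0) (B.smul_mem t (hb 1)), hali.ne_zero 0, hne, rfl⟩, ?_⟩
  rw [← TensorProduct.tmul_smul, ← TensorProduct.tmul_add]
  rfl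

theorem IsLineSecondKind.infinite [Infinite F] {S : Set (PG F 0)} (h : IsLineSecondKind S) :
    S.Infinite := by
  obtain ⟨B, hB, rfl⟩ := h
  obtain ⟨b, hb, hbli⟩ := exists_li_of_finrank (n := 0) hB
  have ha := li_single (F := F)
  refine infinite_of_pencil (li_tmul_right (hbli.ne_zero 0) ha) fun t => ?_
  have hne := add_smul_ne_zero ha t
  refine ⟨pt _ (b 0) hne (hbli.ne_zero 0), ⟨_, trivial, _, hb 0, hne, hbli.ne_zero 0, rfl⟩, ?_⟩
  rw [TensorProduct.smul_tmul', ← TensorProduct.add_tmul]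
  rfl

/-- The number of points on the Segre variety, read as `0` where it is infinite. -/
def linePoints : LineType → ℕ
  | .o5 => 2
  | .o6 => 1
  | .o7 => 1
  -- Zero covers both infinite (o₂, o₄ᵀ) and empty (o₁₀, o₁₁) intersections; these four rows have
  -- pairwise different minimal sizes.
  | _ => 0

theorem ncard_of_mem_lineOrbit [Infinite F] {t : LineType} {U : PG F 1} (hU : U ∈ lineOrbit F t) :
    (meet U).ncard = linePoints t := by
  have h := (lineTable hU).1
  cases t
  case o2 => exact (IsLineFirstKind.infinite h).ncard
  case o4T => exact (IsLineSecondKind.infinite h).ncard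
  case o10 | o11 => rw [show meet U = ∅ from h, Set.ncard_empty]; rfl
  all_goals exact h

/-- The number of points on the Segre variety for the planes of minimal size `2 × 3`, read as `0`
where it is infinite. -/
def planePoints : PlaneType → ℕ
  | .o13 => 2
  | .o14 => 3
  | .o15 => 1
  | .o16 => 1
  -- Among the planes of size 2 × 3 other than o₁₇, the value zero is left for o₈, o₉ and o₁₂, which
  -- contain a line of the Segre variety.
  | _ => 0

theorem ncard_of_mem_planeOrbit [Infinite F] {t : PlaneType} (ht : t ≠ .o17)
    (ht' : planeMin t = (2, 3)) {U : PG F 2} (hU : U ∈ planeOrbit F t) :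
    (meet U).ncard = planePoints t := by
  have h := (planeTable ht hU).1
  cases t
  case o3 | o7T | o11T => simp [planeMin] at ht'
  case o8 =>
    obtain ⟨S, p, hS, -, e⟩ := h
    exact (hS.infinite.mono (e ▸ Set.subset_union_left)).ncard
  case o9 => exact (IsLineFirstKind.infinite h).ncard
  case o12 => exact (IsLineSecondKind.infinite h).ncard
  case o13 | o14 => exact h
  case o15 | o16 => exact h.1
  case o17 => exact absurd rfl ht

theorem pointOrbit_unique {s t : PointType} {U : PG F 0} (hs : U ∈ pointOrbit F s)
    (ht : U ∈ pointOrbit F t) : s = t := by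
  have h := (pointTable hs).2.unique (pointTable ht).2
  cases s <;> cases t <;> first | rfl | simp [pointMin] at h

theorem lineOrbit_unique [Infinite F] {s t : LineType} {U : PG F 1} (hs : U ∈ lineOrbit F s)
    (ht : U ∈ lineOrbit F t) : s = t := by
  have h := (lineTable hs).2.unique (lineTable ht).2
  have h' := (ncard_of_mem_lineOrbit hs).symm.trans (ncard_of_mem_lineOrbit ht)
  cases s <;> cases t <;> first
    | rfl
    | (simp [lineMin] at h; done)
    | simp [linePoints] at h'

/-- The plane contains the tensors `a ⊗ b` for some fixed `b`. -/
def ContainsRuling (U : PG F 2) : Prop := ∃ b ≠ 0, ∀ a, a ⊗ₜ[F] b ∈ U.1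

/-- The plane contains two pure tensors with independent left factors. -/
def ContainsSkewPair (U : PG F 2) : Prop :=
  ∃ a a' b b', LinearIndependent F ![a, a'] ∧ b ≠ 0 ∧ b' ≠ 0 ∧ a ⊗ₜ[F] b ∈ U.1 ∧ a' ⊗ₜ[F] b' ∈ U.1

/-- The plane contains a pure tensor `a ⊗ b` and a tensor tangent to the Segre variety along it,
which is not in `a ⊗ F³`. -/
def ContainsTangent (U : PG F 2) : Prop :=
  ∃ a a' b c, LinearIndependent F ![a, a'] ∧ b ≠ 0 ∧ a ⊗ₜ[F] b ∈ U.1 ∧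
    a ⊗ₜ[F] c + a' ⊗ₜ[F] b ∈ U.1

theorem li_map_pair {a a' : Fin 2 → F} (h : LinearIndependent F ![a, a'])
    (g : (Fin 2 → F) ≃ₗ[F] (Fin 2 → F)) : LinearIndependent F ![g a, g a'] := by
  rw [li_two] at h ⊢
  intro x y e
  refine h x y (g.map_eq_zero_iff.1 ?_)
  rw [← e, map_add, map_smul, map_smul]

theorem ContainsRuling.smul {U : PG F 2} (h : ContainsRuling U) (g : H2 F) :
    ContainsRuling (g • U) := by
  obtain ⟨b, hb, h⟩ := h
  refine ⟨g.2 b, by simpa using hb, fun a => ?_⟩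
  have := (act_mem_smul (g := g)).2 (h (g.1.symm a))
  rwa [act_tmul, LinearEquiv.apply_symm_apply] at this

theorem ContainsSkewPair.smul {U : PG F 2} (h : ContainsSkewPair U) (g : H2 F) :
    ContainsSkewPair (g • U) := by
  obtain ⟨a, a', b, b', ha, hb, hb', h, h'⟩ := h
  refine ⟨g.1 a, g.1 a', g.2 b, g.2 b', li_map_pair ha g.1, by simpa using hb, by simpa using hb',
    ?_, ?_⟩
  · simpa using (act_mem_smul (g := g)).2 h
  · simpa using (act_mem_smul (g := g)).2 h'

theorem ContainsTangent.smul {U : PG F 2} (h : ContainsTangent U) (g : H2 F) :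
    ContainsTangent (g • U) := by
  obtain ⟨a, a', b, c, ha, hb, h, h'⟩ := h
  refine ⟨g.1 a, g.1 a', g.2 b, g.2 c, li_map_pair ha g.1, by simpa using hb, ?_, ?_⟩
  · simpa using (act_mem_smul (g := g)).2 h
  · have := (act_mem_smul (g := g)).2 h'
    rwa [map_add, act_tmul, act_tmul] at this

/-- Invariance under `g⁻¹` makes the negation invariant too, so `orbitsOf_induction` can also
exclude a property on a whole class. -/
theorem not_smul_of_smul {P : PG F 2 → Prop} (hP : ∀ (g : H2 F) U, P U → P (g • U)) (g : H2 F)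
    (U : PG F 2) (h : ¬P U) : ¬P (g • U) := fun h' => h (by simpa using hP g⁻¹ _ h')

theorem containsRuling_of_mem {t : PlaneType} (ht : t = .o7T ∨ t = .o12) {U : PG F 2}
    (hU : U ∈ planeOrbit F t) : ContainsRuling U := by
  refine orbitsOf_induction (P := ContainsRuling) (fun g U h => h.smul g) (fun U hU => ?_) hU
  rcases ht with rfl | rfl
  · refine ⟨![1, 0, 0], by simp, fun a => ?_⟩
    rw [show U.1 = _ from hU, mem_rep_o7T]
    simp
  · refine ⟨![0, 1, 0], by simp, fun a => ?_⟩
    rw [show U.1 = _ from hU, mem_rep_o12]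
    simp

/-- In each of these rows the two conditions `e₀ ⊗ b ∈ U` and `e₁ ⊗ b ∈ U` together force `b = 0`.
-/
theorem not_containsRuling_of_mem {t : PlaneType} (ht : t = .o11T ∨ t = .o8 ∨ t = .o9)
    {U : PG F 2} (hU : U ∈ planeOrbit F t) : ¬ContainsRuling U := by
  refine orbitsOf_induction (P := fun U => ¬ContainsRuling U)
    (not_smul_of_smul fun g U h => h.smul g) (fun U hU => ?_) hU
  rintro ⟨b, hb, h⟩
  have h0 := h ![1, 0]
  have h1 := h ![0, 1]
  rw [ne_zero_fin_three] at hb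
  rcases ht with rfl | rfl | rfl
  · rw [show U.1 = _ from hU, mem_rep_o11T] at h0 h1
    simp at h0 h1
    grind
  · rw [show U.1 = _ from hU, mem_rep_o8] at h0 h1
    simp at h0 h1
    grind
  · rw [show U.1 = _ from hU, mem_rep_o9] at h0 h1
    simp at h0 h1
    grind

theorem containsSkewPair_of_mem {U : PG F 2} (hU : U ∈ planeOrbit F .o8) :
    ContainsSkewPair U := by
  refine orbitsOf_induction (P := ContainsSkewPair) (fun g U h => h.smul g) (fun U hU => ?_) hU
  refine ⟨_, _, ![1, 0, 0], ![0, 1, 0], li_single, by simp, by simp, ?_, ?_⟩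
  · rw [show U.1 = _ from hU, mem_rep_o8]
    simp
  · rw [show U.1 = _ from hU, mem_rep_o8]
    simp

/-- All pure tensors of o₉ have a left factor proportional to `e₁`, so no two left factors are
independent. -/
theorem not_containsSkewPair_of_mem {U : PG F 2} (hU : U ∈ planeOrbit F .o9) :
    ¬ContainsSkewPair U := by
  refine orbitsOf_induction (P := fun U => ¬ContainsSkewPair U)
    (not_smul_of_smul fun g U h => h.smul g) (fun U hU => ?_) hU
  rintro ⟨a, a', b, b', ha, hb, hb', h, h'⟩
  rw [show U.1 = _ from hU, mem_rep_o9] at h h'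
  simp only [entry_tmul] at h h'
  rw [ne_zero_fin_three] at hb hb'
  have h0 : a 0 = 0 := by grind
  have h0' : a' 0 = 0 := by grind
  have := (li_two.1 ha (a' 1) (-a 1) (by
    ext i
    fin_cases i
    · simp [h0, h0']
    · simp
      ring)).2
  refine li_left_ne ha (funext fun i => ?_)
  fin_cases i
  · exact h0
  · exact neg_eq_zero.1 this

theorem containsTangent_of_mem {U : PG F 2} (hU : U ∈ planeOrbit F .o16) :
    ContainsTangent U := by
  refine orbitsOf_induction (P := ContainsTangent) (fun g U h => h.smul g) (fun U hU => ?_) hU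
  refine ⟨_, _, ![0, 0, 1], ![0, 1, 0], li_single, by simp, ?_, ?_⟩
  · rw [show U.1 = _ from hU, mem_rep_o16]
    simp
  · rw [show U.1 = _ from hU, mem_rep_o16]
    simp

/-- The only pure point of o₁₅ is `e₀ ⊗ e₂`. A tangent tensor there has second row `a' 1 • b`, and
since the (1,2) entry vanishes on the plane while `b 2` is nonzero, `a' 1 = 0`; so `a'` is a
multiple of `a`. -/
theorem not_containsTangent_of_mem {U : PG F 2} (hU : U ∈ planeOrbit F .o15) :
    ¬ContainsTangent U := by
  refine orbitsOf_induction (P := fun U => ¬ContainsTangent U)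
    (not_smul_of_smul fun g U h => h.smul g) (fun U hU => ?_) hU
  obtain ⟨u, v, huv, hU⟩ := hU
  rintro ⟨a, a', b, c, ha, hb, h, h'⟩
  rw [hU, mem_rep_o15] at h h'
  simp only [map_add, entry_tmul] at h h'
  rw [ne_zero_fin_three] at hb
  have ha0 := ne_zero_fin_two.1 (li_left_ne ha)
  have hv := huv.1
  have h1 : a 1 = 0 := by
    by_contra h1
    have hb2 : b 2 = 0 := (mul_eq_zero.1 h.1).resolve_left h1
    exact quad_aux huv h1 (by tauto) h.2.1 h.2.2
  have h1' : a' 1 = 0 := by grind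
  have := (li_two.1 ha (a' 0) (-a 0) (by
    ext i
    fin_cases i
    · simp
      ring
    · simp [h1, h1'])).2
  exact ha0.elim (· (neg_eq_zero.1 this)) (· h1)

/-- A finite check that lists the pairs not separated by size and number of points. They are grouped
so that `ContainsRuling` treats o₇ᵀ and o₁₂ against o₁₁ᵀ, o₈ and o₉ at once. -/
theorem planeType_eq_or {s t : PlaneType} (hs : s ≠ .o17) (ht : t ≠ .o17)
    (h : planeMin s = planeMin t) (h' : planeMin s = (2, 3) → planePoints s = planePoints t) :
    s = t ∨ ((s = .o7T ∨ s = .o12) ∧ (t = .o11T ∨ t = .o8 ∨ t = .o9)) ∨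
      ((t = .o7T ∨ t = .o12) ∧ (s = .o11T ∨ s = .o8 ∨ s = .o9)) ∨ (s = .o8 ∧ t = .o9) ∨
      (s = .o9 ∧ t = .o8) ∨ (s = .o15 ∧ t = .o16) ∨ (s = .o16 ∧ t = .o15) := by
  cases s <;> cases t <;> simp [planeMin, planePoints] at *

theorem planeOrbit_unique [Infinite F] {s t : PlaneType} (hs' : s ≠ .o17) (ht' : t ≠ .o17)
    {U : PG F 2} (hs : U ∈ planeOrbit F s) (ht : U ∈ planeOrbit F t) : s = t := by
  have h := (planeTable hs' hs).2.unique (planeTable ht' ht).2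
  have h' : planeMin s = (2, 3) → planePoints s = planePoints t := fun hm =>
    (ncard_of_mem_planeOrbit hs' hm hs).symm.trans (ncard_of_mem_planeOrbit ht' (h ▸ hm) ht)
  rcases planeType_eq_or hs' ht' h h' with h | ⟨h1, h2⟩ | ⟨h1, h2⟩ | ⟨rfl, rfl⟩ | ⟨rfl, rfl⟩ |
    ⟨rfl, rfl⟩ | ⟨rfl, rfl⟩
  · exact h
  · exact absurd (containsRuling_of_mem h1 hs) (not_containsRuling_of_mem h2 ht)
  · exact absurd (containsRuling_of_mem h1 ht) (not_containsRuling_of_mem h2 hs)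
  · exact absurd (containsSkewPair_of_mem hs) (not_containsSkewPair_of_mem ht)
  · exact absurd (containsSkewPair_of_mem ht) (not_containsSkewPair_of_mem hs)
  · exact absurd (containsTangent_of_mem ht) (not_containsTangent_of_mem hs)
  · exact absurd (containsTangent_of_mem hs) (not_containsTangent_of_mem ht)

/-! ### Single orbits and their number -/

theorem orbitsOf_eq_orbit {d : ℕ} {R : Set (Submodule F (V F))} {U₀ : PG F d} (h₀ : U₀.1 ∈ R)
    (hR : ∀ W ∈ R, ∃ g : H2 F, W = U₀.1.map ((act g) : V F →ₗ[F] V F)) :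
    orbitsOf R = MulAction.orbit (H2 F) U₀ := by
  ext U
  constructor
  · rintro ⟨W, hW, g, hU⟩
    obtain ⟨h, rfl⟩ := hR W hW
    refine ⟨g * h, Subtype.ext ?_⟩
    change ((g * h) • U₀).1 = U.1
    rw [hU, coe_smul, act_mul, Submodule.map_comp]
  · rintro ⟨g, rfl⟩
    exact ⟨U₀.1, h₀, g, rfl⟩

theorem exists_orbitsOf_singleton {d : ℕ} {W : Submodule F (V F)}
    {T : Fin (d + 1) → Matrix (Fin 2) (Fin 3) F} (h : IsRep W T) :
    ∃ U : PG F d, orbitsOf {W} = MulAction.orbit (H2 F) U := by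
  refine ⟨⟨W, h.finrank_eq⟩, orbitsOf_eq_orbit rfl ?_⟩
  rintro _ rfl
  exact ⟨1, by rw [act_one, Submodule.map_id]⟩

theorem orbitsOf_eq_empty {d : ℕ} {R : Set (Submodule F (V F))} (h : ∀ W, W ∉ R) :
    (orbitsOf R : Set (PG F d)) = ∅ := by
  refine Set.eq_empty_iff_forall_notMem.2 ?_
  rintro U ⟨W, hW, -⟩
  exact h W hW

/-- Sending a class outside `missing` to the orbit it equals is injective because classes are
disjoint, and surjective because they cover everything while the missing ones are empty. -/
theorem numOrbits_eq {d : ℕ} {ι : Type} {orb : ι → Set (PG F d)} {missing : Set ι}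
    (h : IsOrbitList orb missing) (l : Finset ι) {n : ℕ} (hn : l.card = n)
    (hl : ∀ t, t ∈ l ↔ t ∉ missing) : numOrbits F d = n := by
  subst hn
  choose U hU using fun t : l => h.orbit_of_not_missing t ((hl t).1 t.2)
  have hmem : ∀ t : l, U t ∈ orb t := fun t => by
    rw [hU]
    exact MulAction.mem_orbit_self _
  rw [← Nat.card_eq_finsetCard l, numOrbits]
  refine (Nat.card_congr (Equiv.ofBijective
    (fun t : l => (Quotient.mk'' (U t) : MulAction.orbitRel.Quotient (H2 F) (PG F d)))
    ⟨fun s t e => ?_, fun q => ?_⟩)).symm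
  · have hst : U s ∈ orb t := by
      rw [hU]
      exact MulAction.orbitRel_apply.1 (Quotient.eq''.1 e)
    exact Subtype.ext ((h.exists_unique (U s)).unique (hmem s) hst)
  · induction q using Quotient.inductionOn' with
    | h W =>
      obtain ⟨t, ht, -⟩ := h.exists_unique W
      have htm : t ∈ l := by
        rw [hl]
        intro hm
        simp only [h.empty_of_missing t hm, Set.mem_empty_iff_false] at ht
      refine ⟨⟨t, htm⟩, Quotient.eq''.2 (MulAction.orbitRel_apply.2 ?_)⟩
      rw [hU ⟨t, htm⟩] at ht
      rwa [← MulAction.mem_orbit_symm] at ht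

theorem pointOrbit_isOrbitList : IsOrbitList (pointOrbit F) ∅ where
  empty_of_missing t ht := ht.elim
  orbit_of_not_missing t _ := by
    cases t
    · exact exists_orbitsOf_singleton isParam_o1.isRep
    · exact exists_orbitsOf_singleton isParam_o4.isRep
  exists_unique U := by
    obtain ⟨t, ht⟩ := exists_mem_pointOrbit U
    exact ⟨t, ht, fun s hs => pointOrbit_unique hs ht⟩

/-- Every class except o₁₀ has a single representative and is an orbit over any field; only o₁₀,
with its parameters, depends on the field. -/
theorem lineOrbit_isOrbitList [Infinite F] {missing : Set LineType}
    (h₀ : ∀ t ∈ missing, lineOrbit F t = ∅)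
    (h₁₀ : .o10 ∉ missing → ∃ U, lineOrbit F .o10 = MulAction.orbit (H2 F) U) :
    IsOrbitList (lineOrbit F) missing where
  empty_of_missing := h₀
  orbit_of_not_missing t ht := by
    cases t
    · exact exists_orbitsOf_singleton isParam_o2.isRep
    · exact exists_orbitsOf_singleton isParam_o4T.isRep
    · exact exists_orbitsOf_singleton isParam_o5.isRep
    · exact exists_orbitsOf_singleton isParam_o6.isRep
    · exact exists_orbitsOf_singleton isParam_o7.isRep
    · exact h₁₀ ht
    · exact exists_orbitsOf_singleton isParam_o11.isRep
  exists_unique U := by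
    obtain ⟨t, ht⟩ := exists_mem_lineOrbit U
    exact ⟨t, ht, fun s hs => lineOrbit_unique hs ht⟩

theorem planeOrbit_o17_eq_empty
    (hF : ∀ b c d : F, ∃ x, x ^ 3 + b * x ^ 2 + c * x + d = 0) : planeOrbit F .o17 = ∅ := by
  refine orbitsOf_eq_empty ?_
  rintro W ⟨α, β, γ, h, -⟩
  obtain ⟨l, hl⟩ := hF γ (-β) α
  exact h l (by linear_combination hl)

theorem planeOrbit_isOrbitList [Infinite F]
    (hF : ∀ b c d : F, ∃ x, x ^ 3 + b * x ^ 2 + c * x + d = 0) {missing : Set PlaneType}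
    (h₁₇ : .o17 ∈ missing) (h₀ : ∀ t ∈ missing, planeOrbit F t = ∅)
    (h₁₅ : .o15 ∉ missing → ∃ U, planeOrbit F .o15 = MulAction.orbit (H2 F) U) :
    IsOrbitList (planeOrbit F) missing where
  empty_of_missing := h₀
  orbit_of_not_missing t ht := by
    cases t
    · exact exists_orbitsOf_singleton isParam_o3.isRep
    · exact exists_orbitsOf_singleton isParam_o7T.isRep
    · exact exists_orbitsOf_singleton isParam_o8.isRep
    · exact exists_orbitsOf_singleton isParam_o9.isRep
    · exact exists_orbitsOf_singleton isParam_o11T.isRep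
    · exact exists_orbitsOf_singleton isParam_o12.isRep
    · exact exists_orbitsOf_singleton isParam_o13.isRep
    · exact exists_orbitsOf_singleton isParam_o14.isRep
    · exact h₁₅ ht
    · exact exists_orbitsOf_singleton isParam_o16.isRep
    · exact absurd h₁₇ ht
  exists_unique U := by
    have hne : ∀ s, U ∈ planeOrbit F s → s ≠ .o17 := by
      rintro _ hs rfl
      rw [planeOrbit_o17_eq_empty hF] at hs
      exact hs
    obtain ⟨t, ht⟩ := exists_mem_planeOrbit hF U
    exact ⟨t, ht, fun s hs => planeOrbit_unique (hne s hs) (hne t ht) hs ht⟩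

theorem tablesHold_of_cubic (hF : ∀ b c d : F, ∃ x, x ^ 3 + b * x ^ 2 + c * x + d = 0) :
    TablesHold F := by
  refine ⟨fun t U hU => pointTable hU, fun t U hU => lineTable hU, fun t U hU => planeTable ?_ hU⟩
  rintro rfl
  rw [planeOrbit_o17_eq_empty hF] at hU
  exact hU

/-! ### Algebraically closed fields -/

theorem exists_cubic_root_of_isAlgClosed [IsAlgClosed F] (b c d : F) :
    ∃ x, x ^ 3 + b * x ^ 2 + c * x + d = 0 := by
  have hdeg := Polynomial.degree_cubic (a := (1 : F)) (b := b) (c := c) (d := d) one_ne_zero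
  obtain ⟨x, hx⟩ := IsAlgClosed.exists_root _ (by rw [hdeg]; decide)
  exact ⟨x, by simpa [Polynomial.IsRoot] using hx⟩

theorem not_quadCond_of_isAlgClosed [IsAlgClosed F] (u v : F) : ¬QuadCond u v := by
  rintro ⟨hv, h⟩
  have hdeg := Polynomial.degree_quadratic (a := v) (b := u * v) (c := -1) hv
  obtain ⟨x, hx⟩ := IsAlgClosed.exists_root _ (by rw [hdeg]; decide)
  refine h x ?_
  simpa [Polynomial.IsRoot, sub_eq_add_neg] using hx

/-! ### The real numbers -/

theorem exists_cubic_root_real (b c d : ℝ) : ∃ x, x ^ 3 + b * x ^ 2 + c * x + d = 0 := by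
  -- At `±r` the leading term dominates the sum of the others, since `|b| + |c| + |d| ≤ r` and `1 ≤
  -- r`. The cubic therefore changes sign on `[-r, r]`.
  set r : ℝ := 1 + |b| + |c| + |d| with hr
  have hb := abs_nonneg b
  have hc := abs_nonneg c
  have hd := abs_nonneg d
  have hr1 : 1 ≤ r := by linarith
  have h1 : |b * r ^ 2 + c * r + d| ≤ r ^ 3 ∧ |b * r ^ 2 - c * r + d| ≤ r ^ 3 := by
    have e1 : |b * r ^ 2| = |b| * r ^ 2 := by rw [abs_mul, abs_of_nonneg (sq_nonneg r)]
    have e2 : |c * r| = |c| * r := by rw [abs_mul, abs_of_nonneg (show 0 ≤ r by linarith)]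
    have e3 : |b| * r ^ 2 + |c| * r + |d| ≤ r ^ 3 := by
      have f1 : |c| * r ≤ |c| * r ^ 2 := by
        gcongr
        nlinarith
      have f2 : |d| ≤ |d| * r ^ 2 := le_mul_of_one_le_right hd (one_le_pow₀ hr1)
      calc |b| * r ^ 2 + |c| * r + |d| ≤ (|b| + |c| + |d|) * r ^ 2 := by linarith
        _ ≤ r * r ^ 2 := by
          gcongr
          linarith
        _ = r ^ 3 := by ring
    constructor
    · refine (abs_add_le _ _).trans (le_trans ?_ e3)
      gcongr
      exact (abs_add_le _ _).trans (by rw [e1, e2])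
    · refine (abs_add_le _ _).trans (le_trans ?_ e3)
      gcongr
      exact (abs_sub _ _).trans (by rw [e1, e2])
  have hcont : ContinuousOn (fun x : ℝ => x ^ 3 + b * x ^ 2 + c * x + d) (Set.Icc (-r) r) := by
    fun_prop
  have hle : -r ≤ r := by linarith
  have := intermediate_value_Icc hle hcont
  obtain ⟨x, -, hx⟩ := this (show (0 : ℝ) ∈ Set.Icc _ _ by
    constructor
    · have := (abs_le.1 h1.2).2
      nlinarith
    · have := (abs_le.1 h1.1).1
      nlinarith)
  exact ⟨x, hx⟩

/-- Completing the square gives `v ((l + u/2)² - (v⁻¹ + u²/4))`, which has a real root as soon as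
the constant in the bracket is nonnegative. -/
theorem quadCond_real_neg {u v : ℝ} (h : QuadCond u v) : v⁻¹ + u ^ 2 / 4 < 0 := by
  by_contra! h0
  refine h.2 (-u / 2 + √(v⁻¹ + u ^ 2 / 4)) ?_
  have hs := Real.sq_sqrt h0
  have hv := mul_inv_cancel₀ h.1
  linear_combination v * hs + hv

theorem quadCond_zero_neg_one : QuadCond (0 : ℝ) (-1) :=
  ⟨by norm_num, fun l => by nlinarith [sq_nonneg l]⟩

/-- Bases of `ℝ²` and `ℝ³` in which the rows with parameters `u, v` become those with
parameters `0, -1`. -/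
theorem exists_real_normalization {u v : ℝ} (h : QuadCond u v) :
    ∃ (a₁ : Fin 2 → ℝ) (b₀ b₁ : Fin 3 → ℝ), LinearIndependent ℝ ![![1, 0], a₁] ∧
      LinearIndependent ℝ ![b₀, b₁, ![0, 0, 1]] ∧
      ![1, 0] ⊗ₜ[ℝ] b₀ + a₁ ⊗ₜ[ℝ] b₁ ∈ (rep2 fun x y => !![x, u * x + y, 0; v * y, x, 0]) ∧
      ![1, 0] ⊗ₜ[ℝ] b₁ + (-1 : ℝ) • (a₁ ⊗ₜ[ℝ] b₀) ∈ (rep2 fun x y => !![x, u * x + y, 0; v * y, x, 0]) := by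
  set r : ℝ := √(-(v⁻¹ + u ^ 2 / 4)) with hr
  have h0 := quadCond_real_neg h
  have hr0 : r ≠ 0 := (Real.sqrt_pos.2 (by linarith)).ne'
  have hr2 : r ^ 2 = -(v⁻¹ + u ^ 2 / 4) := Real.sq_sqrt (by linarith)
  have hv := h.1
  -- The associated endomorphism satisfies `S² = u S + v⁻¹`, hence `(S - u/2)² = -r²`, and `(S -
  -- u/2) / r` is a square root of -1. In the row's parameters the first tensor below is `x = 1, y =
  -- 0` and the second is `x = -u/(2r), y = -1/(v r)`.
  refine ⟨![r⁻¹ * (u / 2), r⁻¹], ![1, u / 2, 0], ![0, r, 0], ?_, ?_, ?_, ?_⟩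
  · rw [li_two]
    intro x y e
    have e0 := congrFun e 0
    have e1 := congrFun e 1
    simp [hr0] at e0 e1
    subst e1
    exact ⟨by simpa using e0, rfl⟩
  · rw [li_three]
    intro x y z e
    have e0 := congrFun e 0
    have e1 := congrFun e 1
    have e2 := congrFun e 2
    simp at e0 e1 e2
    subst e0
    exact ⟨rfl, by simpa [hr0] using e1, e2⟩
  · rw [mem_rep_o10]
    simp [hr0]
    field_simp
    ring_nf
    simp
  · rw [mem_rep_o10]
    simp
    field_simp
    field_simp at hr2
    linear_combination -hr2

theorem exists_map_eq_o10_real {u v : ℝ} (h : QuadCond u v) :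
    ∃ g : H2 ℝ, (rep2 fun x y => !![x, u * x + y, 0; v * y, x, 0]) =
      (rep2 fun x y : ℝ => !![x, 0 * x + y, 0; -1 * y, x, 0]).map ((act g) : V ℝ →ₗ[ℝ] V ℝ) := by
  obtain ⟨a₁, b₀, b₁, ha, hb, h0, h1⟩ := exists_real_normalization h
  -- The factors `0 *` and `-1 *` are kept unsimplified in the statement so that the representative
  -- is literally the o₁₀ family at `u = 0, v = -1`.
  refine (isParam_o10 (0 : ℝ) (-1)).isRep.exists_map_eq
    (U := ⟨_, (isParam_o10 u v).isRep.finrank_eq⟩) ha hb fun k => ?_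
  fin_cases k
  · simpa [mix_apply, Fin.sum_univ_succ] using h0
  · simpa [mix_apply, Fin.sum_univ_succ] using h1

/-- The normalization of o₁₀ keeps `e₀` and `e₂` as basis vectors, so the additional generator `e₀ ⊗
e₂` of o₁₅ needs no change. -/
theorem exists_map_eq_o15_real {u v : ℝ} (h : QuadCond u v) :
    ∃ g : H2 ℝ, (rep3 fun x y z => !![x, u * x + y, z; v * y, x, 0]) =
      (rep3 fun x y z : ℝ => !![x, 0 * x + y, z; -1 * y, x, 0]).map
        ((act g) : V ℝ →ₗ[ℝ] V ℝ) := by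
  obtain ⟨a₁, b₀, b₁, ha, hb, h0, h1⟩ := exists_real_normalization h
  have hle : ∀ t ∈ (rep2 fun x y => !![x, u * x + y, 0; v * y, x, 0]),
      t ∈ (rep3 fun x y z => !![x, u * x + y, z; v * y, x, 0]) := by
    intro t ht
    rw [mem_rep_o15]
    exact (mem_rep_o10.1 ht).2
  have h2 : ![1, 0] ⊗ₜ[ℝ] ![0, 0, 1] ∈ (rep3 fun x y z => !![x, u * x + y, z; v * y, x, 0]) := by
    rw [mem_rep_o15]
    simp
  refine (isParam_o15 (0 : ℝ) (-1)).isRep.exists_map_eq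
    (U := ⟨_, (isParam_o15 u v).isRep.finrank_eq⟩) ha hb fun k => ?_
  fin_cases k
  · simpa [mix_apply, Fin.sum_univ_succ] using hle _ h0
  · simpa [mix_apply, Fin.sum_univ_succ] using hle _ h1
  · simpa [mix_apply, Fin.sum_univ_succ] using h2

theorem exists_lineOrbit_o10_real : ∃ U, lineOrbit ℝ .o10 = MulAction.orbit (H2 ℝ) U := by
  refine ⟨⟨_, (isParam_o10 (0 : ℝ) (-1)).isRep.finrank_eq⟩, orbitsOf_eq_orbit
    ⟨0, -1, quadCond_zero_neg_one, rfl⟩ ?_⟩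
  rintro W ⟨u, v, h, rfl⟩
  exact exists_map_eq_o10_real h

theorem exists_planeOrbit_o15_real : ∃ U, planeOrbit ℝ .o15 = MulAction.orbit (H2 ℝ) U := by
  refine ⟨⟨_, (isParam_o15 (0 : ℝ) (-1)).isRep.finrank_eq⟩, orbitsOf_eq_orbit
    ⟨0, -1, quadCond_zero_neg_one, rfl⟩ ?_⟩
  rintro W ⟨u, v, h, rfl⟩
  exact exists_map_eq_o15_real h

end SegreOrbits

/-! ### The classifications over algebraically closed fields and over ℝ -/

open SegreOrbits
theorem mainTheorem2 :
    (∀ (F : Type*) [Field F] [IsAlgClosed F],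
      numOrbits F 0 = 2 ∧ numOrbits F 1 = 6 ∧ numOrbits F 2 = 9 ∧
      IsOrbitList (pointOrbit F) ∅ ∧
      IsOrbitList (lineOrbit F) {LineType.o10} ∧
      IsOrbitList (planeOrbit F) {PlaneType.o15, PlaneType.o17} ∧
      TablesHold F) ∧
    (numOrbits ℝ 0 = 2 ∧ numOrbits ℝ 1 = 7 ∧ numOrbits ℝ 2 = 10 ∧
      IsOrbitList (pointOrbit ℝ) ∅ ∧
      IsOrbitList (lineOrbit ℝ) ∅ ∧
      IsOrbitList (planeOrbit ℝ) {PlaneType.o17} ∧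
      TablesHold ℝ) := by
  classical
  refine ⟨fun F _ _ => ?_, ?_⟩
  · have hF := exists_cubic_root_of_isAlgClosed (F := F)
    have hl : IsOrbitList (lineOrbit F) {LineType.o10} := by
      refine lineOrbit_isOrbitList ?_ (by simp)
      rintro _ rfl
      refine orbitsOf_eq_empty ?_
      rintro _ ⟨u, v, h, -⟩
      exact not_quadCond_of_isAlgClosed u v h
    have hp : IsOrbitList (planeOrbit F) {PlaneType.o15, PlaneType.o17} := by
      refine planeOrbit_isOrbitList hF (by simp) ?_ (by simp)
      rintro _ (rfl | rfl)
      · refine orbitsOf_eq_empty ?_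
        rintro _ ⟨u, v, h, -⟩
        exact not_quadCond_of_isAlgClosed u v h
      · exact planeOrbit_o17_eq_empty hF
    refine ⟨?_, ?_, ?_, pointOrbit_isOrbitList, hl, hp, tablesHold_of_cubic hF⟩
    · exact numOrbits_eq pointOrbit_isOrbitList {.o1, .o4} (by simp) (by intro t; cases t <;> simp)
    · exact numOrbits_eq hl {.o2, .o4T, .o5, .o6, .o7, .o11} (by simp)
        (by intro t; cases t <;> simp)
    · exact numOrbits_eq hp {.o3, .o7T, .o8, .o9, .o11T, .o12, .o13, .o14, .o16} (by simp)
        (by intro t; cases t <;> simp)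
  · have hl : IsOrbitList (lineOrbit ℝ) ∅ :=
      lineOrbit_isOrbitList (fun t ht => ht.elim) fun _ => exists_lineOrbit_o10_real
    have hp : IsOrbitList (planeOrbit ℝ) {PlaneType.o17} := by
      refine planeOrbit_isOrbitList exists_cubic_root_real (by simp) ?_
        fun _ => exists_planeOrbit_o15_real
      rintro _ rfl
      exact planeOrbit_o17_eq_empty exists_cubic_root_real
    refine ⟨?_, ?_, ?_, pointOrbit_isOrbitList, hl, hp, tablesHold_of_cubic exists_cubic_root_real⟩
    · exact numOrbits_eq pointOrbit_isOrbitList {.o1, .o4} (by simp) (by intro t; cases t <;> simp)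
    · exact numOrbits_eq hl {.o2, .o4T, .o5, .o6, .o7, .o10, .o11} (by simp)
        (by intro t; cases t <;> simp)
    · exact numOrbits_eq hp {.o3, .o7T, .o8, .o9, .o11T, .o12, .o13, .o14, .o15, .o16} (by simp)
        (by intro t; cases t <;> simp)
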